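/- Let $g\ge 0$ be an integer, let $E_0<E_1<\dots<E_{2g+1}$ be real numbers, and put $R^{1/2}(z)=-\prod_{j=0}^{2g+1}\sqrt{z-E_j}$, where $\sqrt{\cdot}$ is the standard square root with branch cut along $(-\infty,0)$ (on the cut, the limit from above). Let $\lambda_1<\dots<\lambda_g$ be the real numbers determined by the normalization $$\int_{E_{2j-1}}^{E_{2j}}\frac{\prod_{k=1}^g(x-\lambda_k)}{R^{1/2}(x)}\,dx=0,\qquad 1\le j\le g,$$ so that $\omega=\prod_{k}(z-\lambda_k)R^{-1/2}(z)\,dz$ is the normalized Abelian differential of the third kind $\omega_{\infty_+,\infty_-}$ on the upper sheet of the Riemann surface of $R^{1/2}$. For $\pm\operatorname{Im} z>0$ let $$g(z)=\int_{E_0}^{z}\omega ,$$ the integral being taken inside the half plane $\mathbb C^\pm=\{z\in\mathbb C\mid \pm\operatorname{Im} z>0\}$ of $z$. Let $H_q$ be a quasi-periodic finite-gap Jacobi operator with band edges $E_j$: the bounded operator $(H_qu)(n)=a(n)u(n+1)+a(n-1)u(n-1)+b(n)u(n)$ on $\ell^2(\mathbb Z)$, with real $a,b$, such that for some Dirichlet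 data $\mu_j\in[E_{2j-1},E_{2j}]$, $\sigma_j\in\{\pm1\}$ $(1\le j\le g)$ there are real polynomials $G_n$ (monic of degree $g$) and $K_n$, $n\in\mathbb Z$, with $$K_n+K_{n-1}=2(z-b(n))G_n,\qquad K_n^2-4a(n)^2G_nG_{n+1}=\prod_{j=0}^{2g+1}(z-E_j)\qquad(n\in\mathbb Z),$$ $$G_0(z)=\prod_{j=1}^g(z-\mu_j),\qquad K_0(\mu_j)=\sigma_jR^{1/2}(\mu_j)\quad(1\le j\le g).$$ Then, for either choice of the sign $\pm$: 1. $g$ is continuous on $\mathbb C^\pm$ and has limits at all points of the real line from within $\mathbb C^\pm$. Denote the resulting extension to the closed half plane $\overline{\mathbb C^\pm}=\{\pm\operatorname{Im} z\ge 0\}$ by $g_\pm$. 2. $g$ is a bijection from $\mathbb C^\pm$ onto the slit half strip $$S^\pm=\{w\in\mathbb C\mid \operatorname{Re} w<0,\ 0<\pm\operatorname{Im} w<\pi\}\setminus\bigcup_{j=1}^g[g_\pm(\lambda_j),g_\pm(E_{2j})],$$ where $[p,q]$ is the straight line segment from $p$ to $q$. 3. The spectrum of $H_q$ corresponds to the line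 $\operatorname{Re}=0$: $$\sigma(H_q)=\{z\in\overline{\mathbb C^\pm}\mid \operatorname{Re} g_\pm(z)=0\},\qquad g_\pm(\sigma(H_q))=\{w\in\mathbb C\mid \operatorname{Re} w=0,\ 0\le\pm\operatorname{Im} w\le\pi\}.$$ -/

import Mathlib

open Polynomial

noncomputable section

/-- The left end point of the `j`-th spectral gap. With band edges
`E₀ < E₁ < ⋯ < E_{2g+1}` and gaps counted from `0`, the `j`-th gap is
`(E_{2j+1}, E_{2j+2})`. -/
def gapLeft {g : ℕ} (E : Fin (2 * g + 2) → ℝ) (j : Fin g) : ℝ :=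
  E ⟨2 * j + 1, by omega⟩

/-- The right end point of the `j`-th spectral gap. -/
def gapRight {g : ℕ} (E : Fin (2 * g + 2) → ℝ) (j : Fin g) : ℝ :=
  E ⟨2 * j + 2, by omega⟩

/-- The branch `-∏ √(z - E_j)` of the square root of `∏ (z - E_j)`, with the standard square root
cut along the negative axis (on the cut: the limit from above). -/
def rootR {g : ℕ} (E : Fin (2 * g + 2) → ℝ) (z : ℂ) : ℂ :=
  -∏ j, (z - (E j : ℂ)) ^ (1 / 2 : ℂ)

/-- The coefficient of `dz` in the differential `∏ (z - λ_j) / R^{1/2}(z) dz` on the upper sheet. -/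
def omegaCoeff {g : ℕ} (E : Fin (2 * g + 2) → ℝ) (lam : Fin g → ℝ) (z : ℂ) : ℂ :=
  (∏ j, (z - (lam j : ℂ))) / rootR E z

/-- The differential has vanishing integrals over all gaps, i.e. vanishing `a`-periods: it is the
normalized Abelian differential of the third kind with poles at `∞₊` and `∞₋`. The numbers `λ_j`
are listed in increasing order. -/
structure IsNormalized {g : ℕ} (E : Fin (2 * g + 2) → ℝ) (lam : Fin g → ℝ) : Prop where
  strictMono : StrictMono lam
  period_eq_zero : ∀ j : Fin g,
    ∫ x in gapLeft E j..gapRight E j, omegaCoeff E lam (x : ℂ) = 0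

/-- The quasi-momentum map: the integral of the differential from `E₀` to `z`, along the straight
segment, which stays in the half plane of `z`. -/
def quasiMomentum {g : ℕ} (E : Fin (2 * g + 2) → ℝ) (lam : Fin g → ℝ) (z : ℂ) : ℂ :=
  ∫ t in (0 : ℝ)..1, (z - (E 0 : ℂ)) * omegaCoeff E lam ((E 0 : ℂ) + (t : ℂ) * (z - (E 0 : ℂ)))

/-- The open upper (`s = 1`) or lower (`s = -1`) half plane. -/
def halfPlane (s : ℤˣ) : Set ℂ := {z | 0 < ((s : ℤ) : ℝ) * z.im}

/-- The extension of the quasi-momentum map from the open half plane to its closure by limits. -/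
def quasiMomentumExt {g : ℕ} (E : Fin (2 * g + 2) → ℝ) (lam : Fin g → ℝ) (s : ℤˣ) : ℂ → ℂ :=
  extendFrom (halfPlane s) (quasiMomentum E lam)

/-- The half strip `Re < 0`, `0 < ± Im < π` with one slit for each gap, joining the boundary value
at `λ_j` to the boundary value at the end point of the gap. -/
def slitStrip {g : ℕ} (E : Fin (2 * g + 2) → ℝ) (lam : Fin g → ℝ) (s : ℤˣ) : Set ℂ :=
  {w | w.re < 0 ∧ 0 < ((s : ℤ) : ℝ) * w.im ∧ ((s : ℤ) : ℝ) * w.im < Real.pi} \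
    ⋃ j : Fin g, segment ℝ (quasiMomentumExt E lam s (lam j : ℂ))
      (quasiMomentumExt E lam s (gapRight E j : ℂ))

/-- `H` is the Jacobi operator on `ℓ²(ℤ)` with coefficients `a`, `b`. -/
def IsJacobiOperator (a b : ℤ → ℝ)
    (H : lp (fun _ : ℤ => ℂ) 2 →L[ℂ] lp (fun _ : ℤ => ℂ) 2) : Prop :=
  ∀ (u : lp (fun _ : ℤ => ℂ) 2) (n : ℤ),
    (H u : ℤ → ℂ) n = (a n : ℂ) * u (n + 1) + (a (n - 1) : ℂ) * u (n - 1) + (b n : ℂ) * u n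

/-- `a`, `b` are the coefficients of the quasi-periodic finite-gap (algebro-geometric) Jacobi
operator with band edges `E` and Dirichlet data `(μ_j, σ_j)`: the stationary Toda equations of
the curve `y² = ∏ (z - E_j)`, with the Dirichlet data as initial condition at `n = 0`.
Here `G n = ∏ (z - μ_j(n))`, and `(K n ± R^{1/2}) / (2 a(n) G n)` are the quotients
`ψ_±(z, n + 1) / ψ_±(z, n)` of the two branches of the Baker-Akhiezer function. -/
structure IsFiniteGap {g : ℕ} (E : Fin (2 * g + 2) → ℝ) (μ : Fin g → ℝ) (σ : Fin g → ℤˣ)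
    (a b : ℤ → ℝ) : Prop where
  dirichlet_mem : ∀ j, μ j ∈ Set.Icc (gapLeft E j) (gapRight E j)
  exists_poly : ∃ G K : ℤ → ℝ[X],
    (∀ n, (G n).Monic ∧ (G n).natDegree = g) ∧
    G 0 = ∏ j, (X - C (μ j)) ∧
    (∀ j, (((K 0).eval (μ j) : ℝ) : ℂ) = ((σ j : ℤ) : ℂ) * rootR E (μ j : ℂ)) ∧
    (∀ n, K n + K (n - 1) = 2 * (X - C (b n)) * G n) ∧
    (∀ n, K n ^ 2 - 4 * C (a n) ^ 2 * G n * G (n + 1) = ∏ j, (X - C (E j)))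

end

/-!
The argument treats the upper half plane; the lower one follows by complex conjugation.

*Spectrum.* The polynomials `G n`, `K n` turn the Jacobi equation at a real point `x` into a
symplectic recursion that preserves the quadratic form `G p² - K p u + a² G⁺ u²` in
`p = a(n) u(n + 1)` and `u = u(n)`, with discriminant `r = ∏ (x - E_i)` (`conserved_form_step`).
Inside the bands `r < 0` and the form is definite, so
that a square-summable solution on a half line vanishes and the unit vector at `0` is not in the
range of `H - x` (`FiniteGapValues.not_solution`). Where `r > 0`, half the Poisson bracket of this
form with its derivative in `x` is a strict Lyapunov function (`lyapunov_form_step`), so that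
`H - x` is bounded below, hence invertible by self-adjointness (`FiniteGapValues.tsum_sq_le`). Both
arguments need the coefficients of the forms to be bounded in `n`, which holds because all zeros of
all `G n` stay in the convex hull of the bands (`exists_zeros`). Hence the spectrum is the set
`r ≤ 0` (`spectrum_eq`).

*Boundary values.* The differential has only inverse square root singularities at the band edges.
Therefore its primitive `F` extends continuously to the real line (`exists_primitive_continuousOn`),
and the increments of the extension are the integrals of the boundary values of the differential
(`IsUpperPrimitive.sub_eq_integral`). The normalization forces one zero `λ_j` into each gap
(`IsNormalized.mem_gap`). From this, the argument of the differential is known on the real line: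
the differential is purely imaginary on the bands, and real outside the bands, with a change of sign at `λ_j`. So `F`
runs up the imaginary axis on the bands, and in the `j`-th gap it runs along a horizontal slit up to
`F (λ_j)` and back, returning to the imaginary axis because the period vanishes. The pole at
infinity gives the strip its height `π` (`IsUpperPrimitive.im_last`) and makes `Re F` tend to `-∞`.

*Bijectivity.* Interlacing of the zeros and the band edges confines the argument of the differential
to an interval of length `π` in the half plane: the derivative of `F` has positive imaginary part
(`omegaCoeff_im_pos`), and `F` is injective. Its image is open, its boundary consists of values of
`F` on the real line, that is, of points on the boundary of the half strip and on the slits, and it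
omits these values. Connectedness of the slit half strip and of the exterior of the half strip then
identifies the image (`IsUpperPrimitive.image_eq`).
-/

/-! ### Band edges, gaps and bands -/

section
variable {g : ℕ}

/-- A product over the band edges, grouped into the lowest edge, the gaps, and the highest edge. -/
@[to_additive]
theorem prod_edges_eq {M : Type*} [CommMonoid M] (F : Fin (2 * g + 2) → M) :
    ∏ i, F i = F 0 * (∏ j : Fin g, F ⟨2 * j + 1, by omega⟩ * F ⟨2 * j + 2, by omega⟩) *
      F (Fin.last _) := by
  have key : ∀ (n : ℕ) (H : ℕ → M), ∏ i ∈ Finset.range (2 * n + 2), H i =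
      H 0 * (∏ j ∈ Finset.range n, H (2 * j + 1) * H (2 * j + 2)) * H (2 * n + 1) := by
    intro n H
    induction n with
    | zero => simp [Finset.prod_range_succ]
    | succ n ih =>
      rw [show 2 * (n + 1) + 2 = (2 * n + 2) + 1 + 1 by ring, Finset.prod_range_succ,
        Finset.prod_range_succ, ih, Finset.prod_range_succ,
        show 2 * (n + 1) + 1 = 2 * n + 3 by ring]
      simp only [mul_assoc]
  have h := key g (fun i => if h : i < 2 * g + 2 then F ⟨i, h⟩ else 1)
  rw [← Fin.prod_univ_eq_prod_range, ← Fin.prod_univ_eq_prod_range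
    (fun j => (fun i => if h : i < 2 * g + 2 then F ⟨i, h⟩ else 1) (2 * j + 1) *
      (fun i => if h : i < 2 * g + 2 then F ⟨i, h⟩ else 1) (2 * j + 2))] at h
  simp only [Fin.is_lt, dite_true, Fin.eta] at h
  rw [h]
  congr 1
  · congr 1
    · refine Finset.prod_congr rfl fun j _ => ?_
      rw [dif_pos (by omega), dif_pos (by omega)]
  · rw [dif_pos (by omega)]; rfl

section Order
variable {E : Fin (2 * g + 2) → ℝ}

theorem prod_edges_eq_gap {M : Type*} [CommMonoid M] (F : ℝ → M) :
    ∏ i, F (E i) = F (E 0) * (∏ j : Fin g, F (gapLeft E j) * F (gapRight E j)) *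
      F (E (Fin.last _)) := prod_edges_eq _

theorem sum_edges_eq_gap {M : Type*} [AddCommMonoid M] (F : ℝ → M) :
    ∑ i, F (E i) = F (E 0) + (∑ j : Fin g, (F (gapLeft E j) + F (gapRight E j))) +
      F (E (Fin.last _)) := sum_edges_eq _

theorem first_lt_gapLeft (hE : StrictMono E) (j : Fin g) : E 0 < gapLeft E j :=
  hE (by simp [Fin.lt_def])

theorem gapLeft_lt_gapRight (hE : StrictMono E) (j : Fin g) : gapLeft E j < gapRight E j :=
  hE (by simp [Fin.lt_def])

theorem gapRight_lt_last (hE : StrictMono E) (j : Fin g) : gapRight E j < E (Fin.last _) :=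
  hE (by simp only [Fin.lt_def, Fin.val_last]; omega)

theorem gapRight_lt_gapLeft (hE : StrictMono E) {i j : Fin g} (h : i < j) :
    gapRight E i < gapLeft E j :=
  hE (by simp only [Fin.lt_def] at *; omega)

theorem first_lt_last (hE : StrictMono E) : E 0 < E (Fin.last _) :=
  hE (by simp [Fin.lt_def])

/-- A point of `[E₀, E_{2g+1}]` lies in an open gap or in a closed band. -/
theorem mem_gap_or_mem_band (hE : StrictMono E) {x : ℝ} (h0 : E 0 ≤ x)
    (h1 : x ≤ E (Fin.last _)) :
    (∃ j : Fin g, gapLeft E j < x ∧ x < gapRight E j) ∨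
    ∃ k : Fin (g + 1), E ⟨2 * k, by omega⟩ ≤ x ∧ x ≤ E ⟨2 * k + 1, by omega⟩ := by
  obtain ⟨i, hi, hmax⟩ := (Finset.univ.filter (fun i => E i ≤ x)).exists_max_image id
    ⟨0, by simpa using h0⟩
  simp only [Finset.mem_filter, Finset.mem_univ, true_and, id] at hi hmax
  rcases Nat.even_or_odd' i.1 with ⟨k, hk | hk⟩
  · refine Or.inr ⟨⟨k, by omega⟩, ?_, ?_⟩
    · exact le_of_eq_of_le (congrArg E (Fin.ext hk.symm)) hi
    · by_contra! hc
      have := hmax _ hc.le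
      simp only [Fin.le_def] at this; omega
  · rcases eq_or_ne k g with rfl | hne
    · refine Or.inr ⟨Fin.last _, ?_, h1⟩
      refine le_trans (hE.monotone ?_) hi
      simp only [Fin.le_def, Fin.val_last]; omega
    · rcases hi.eq_or_lt with he | hlt
      · refine Or.inr ⟨⟨k, by omega⟩, ?_, ?_⟩
        · rw [← he]; exact hE.monotone (by simp only [Fin.le_def]; omega)
        · rw [← he]; exact hE.monotone (by simp only [Fin.le_def]; omega)
      · refine Or.inl ⟨⟨k, by omega⟩, ?_, ?_⟩
        · exact lt_of_eq_of_lt (congrArg E (Fin.ext hk.symm)) hlt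
        · by_contra! hc
          have := hmax _ hc
          simp only [Fin.le_def] at this; omega

/-- A band contains no gap points. -/
theorem band_le_gapLeft_or_gapRight_le (hE : StrictMono E) (k : Fin (g + 1)) (j : Fin g) :
    E ⟨2 * k + 1, by omega⟩ ≤ gapLeft E j ∨ gapRight E j ≤ E ⟨2 * k, by omega⟩ := by
  rcases le_or_gt k.1 j.1 with h | h
  · exact Or.inl (hE.monotone (by simp only [Fin.le_def]; omega))
  · exact Or.inr (hE.monotone (by simp only [Fin.le_def]; omega))

theorem prod_sub_edges_neg (hE : StrictMono E) {x : ℝ} {k : Fin (g + 1)}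
    (h0 : E ⟨2 * k, by omega⟩ < x) (h1 : x < E ⟨2 * k + 1, by omega⟩) : ∏ i, (x - E i) < 0 := by
  rw [prod_edges_eq_gap (fun e => x - e)]
  have hx0 : E 0 < x := lt_of_le_of_lt (hE.monotone (Fin.zero_le _)) h0
  have hx1 : x < E (Fin.last _) := lt_of_lt_of_le h1 (hE.monotone (Fin.le_last _))
  refine mul_neg_of_pos_of_neg (mul_pos (by linarith) (Finset.prod_pos fun j _ => ?_)) (by linarith)
  have := gapLeft_lt_gapRight hE j
  rcases band_le_gapLeft_or_gapRight_le hE k j with h | h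
  · exact mul_pos_of_neg_of_neg (by linarith) (by linarith)
  · exact mul_pos (by linarith) (by linarith)

theorem prod_sub_edges_pos_of_mem_gap (hE : StrictMono E) {x : ℝ} {j : Fin g}
    (h0 : gapLeft E j < x) (h1 : x < gapRight E j) : 0 < ∏ i, (x - E i) := by
  rw [prod_edges_eq_gap (fun e => x - e)]
  have hx0 := first_lt_gapLeft hE j
  have hx1 := gapRight_lt_last hE j
  refine mul_pos_of_neg_of_neg (mul_neg_of_pos_of_neg (by linarith) ?_) (by linarith)
  rw [← Finset.mul_prod_erase _ _ (Finset.mem_univ j)]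
  refine mul_neg_of_neg_of_pos (mul_neg_of_pos_of_neg (by linarith) (by linarith))
    (Finset.prod_pos fun i hi => ?_)
  have := gapLeft_lt_gapRight hE i
  rcases lt_or_gt_of_ne (Finset.ne_of_mem_erase hi) with h | h
  · have := gapRight_lt_gapLeft hE h
    exact mul_pos (by linarith) (by linarith)
  · have := gapRight_lt_gapLeft hE h
    exact mul_pos_of_neg_of_neg (by linarith) (by linarith)

theorem prod_sub_edges_pos_of_last_lt (hE : StrictMono E) {x : ℝ} (h : E (Fin.last _) < x) :
    0 < ∏ i, (x - E i) :=
  Finset.prod_pos fun i _ => by linarith [hE.monotone (Fin.le_last i)]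

theorem prod_sub_edges_pos_of_lt_first (hE : StrictMono E) {x : ℝ} (h : x < E 0) :
    0 < ∏ i, (x - E i) := by
  rw [prod_edges_eq_gap (fun e => x - e)]
  have := first_lt_last hE
  refine mul_pos_of_neg_of_neg (mul_neg_of_neg_of_pos (by linarith)
    (Finset.prod_pos fun j _ => ?_)) (by linarith)
  have h1 := first_lt_gapLeft hE j
  have h2 := gapLeft_lt_gapRight hE j
  exact mul_pos_of_neg_of_neg (by linarith) (by linarith)

theorem prod_sub_edges_nonpos (hE : StrictMono E) {x : ℝ} {k : Fin (g + 1)}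
    (h0 : E ⟨2 * k, by omega⟩ ≤ x) (h1 : x ≤ E ⟨2 * k + 1, by omega⟩) : ∏ i, (x - E i) ≤ 0 := by
  rcases h0.eq_or_lt with h | h0
  · exact (Finset.prod_eq_zero (Finset.mem_univ (⟨2 * k, by omega⟩ : Fin (2 * g + 2)))
      (sub_eq_zero.2 h.symm)).le
  rcases h1.eq_or_lt with h | h1
  · exact (Finset.prod_eq_zero (Finset.mem_univ (⟨2 * k + 1, by omega⟩ : Fin (2 * g + 2)))
      (sub_eq_zero.2 h)).le
  exact (prod_sub_edges_neg hE h0 h1).le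

/-- The bands are the set where `∏ (x - E_i) ≤ 0`. -/
theorem exists_band_of_prod_sub_edges_nonpos (hE : StrictMono E) {x : ℝ}
    (hx : ∏ i, (x - E i) ≤ 0) :
    ∃ k : Fin (g + 1), E ⟨2 * k, by omega⟩ ≤ x ∧ x ≤ E ⟨2 * k + 1, by omega⟩ := by
  have h0 : E 0 ≤ x := by
    by_contra! h; exact absurd (prod_sub_edges_pos_of_lt_first hE h) (not_lt.2 hx)
  have h1 : x ≤ E (Fin.last _) := by
    by_contra! h; exact absurd (prod_sub_edges_pos_of_last_lt hE h) (not_lt.2 hx)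
  rcases mem_gap_or_mem_band hE h0 h1 with ⟨j, hj0, hj1⟩ | h
  · exact absurd (prod_sub_edges_pos_of_mem_gap hE hj0 hj1) (not_lt.2 hx)
  · exact h

end Order

end

/-! ### The conserved form and the Lyapunov form -/

section
/-- The quadratic form whose conservation along solutions of the Jacobi equation expresses that the
product of the two branches of the Baker-Akhiezer function is a polynomial. -/
theorem conserved_form_step {a₀ a₁ c u₀ u₁ G₀ G₁ G₂ K₀ K₁ : ℝ} (p : ℝ)
    (hp : p = c * u₁ - a₀ * u₀) (hK : K₁ + K₀ = 2 * c * G₁)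
    (hD : 2 * (a₀ ^ 2 * G₀ - a₁ ^ 2 * G₂) = c * (K₀ - K₁)) :
    G₀ * (a₀ * u₁) ^ 2 - K₀ * (a₀ * u₁) * u₀ + a₀ ^ 2 * G₁ * u₀ ^ 2 =
      G₁ * p ^ 2 - K₁ * p * u₁ + a₁ ^ 2 * G₂ * u₁ ^ 2 := by
  subst hp
  linear_combination (u₁ ^ 2 / 2) * hD + (c * u₁ ^ 2 / 2 - a₀ * u₀ * u₁) * hK

/-- The step map `(a₀ u₁, u₀) ↦ (p, u₁)` of the Jacobi equation is symplectic and carries the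
conserved form at one site to the conserved form at the next. The form considered here is half the
Poisson bracket of the conserved form `Q` with its derivative in the spectral parameter; `g`, `k`,
`r'` stand for the derivatives of `G`, `K`, `r`. Differentiating the conservation law shows that it
decreases in each step by half of `r u₁² + (∂Q/∂p)²`, which is at least `r u₁² / 2`. -/
theorem lyapunov_form_step {a₀ a₁ c u₀ u₁ G₀ G₁ G₂ K₀ K₁ g₀ g₁ g₂ k₀ k₁ r r' : ℝ} (p : ℝ)
    (hp : p = c * u₁ - a₀ * u₀) (hK : K₁ + K₀ = 2 * c * G₁)
    (hk : k₁ + k₀ = 2 * G₁ + 2 * c * g₁)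
    (hD : 2 * (a₀ ^ 2 * G₀ - a₁ ^ 2 * G₂) = c * (K₀ - K₁))
    (hd : 2 * (a₀ ^ 2 * g₀ - a₁ ^ 2 * g₂) = (K₀ - K₁) + c * (k₀ - k₁))
    (hR₀ : K₀ ^ 2 - 4 * a₀ ^ 2 * G₀ * G₁ = r) (hR₁ : K₁ ^ 2 - 4 * a₁ ^ 2 * G₁ * G₂ = r)
    (hr₀ : 2 * K₀ * k₀ - 4 * a₀ ^ 2 * (g₀ * G₁ + G₀ * g₁) = r') :
    ((g₀ * K₀ - k₀ * G₀) * (a₀ * u₁) ^ 2 + 2 * a₀ ^ 2 * (G₀ * g₁ - g₀ * G₁) * ((a₀ * u₁) * u₀) +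
      a₀ ^ 2 * (k₀ * G₁ - K₀ * g₁) * u₀ ^ 2) -
    ((g₁ * K₁ - k₁ * G₁) * p ^ 2 + 2 * a₁ ^ 2 * (G₁ * g₂ - g₁ * G₂) * (p * u₁) +
      a₁ ^ 2 * (k₁ * G₂ - K₁ * g₂) * u₁ ^ 2) =
    (r * u₁ ^ 2 + (2 * G₁ * p - K₁ * u₁) ^ 2) / 2 := by
  subst hp
  obtain rfl : K₀ = 2 * c * G₁ - K₁ := by linarith
  obtain rfl : k₀ = 2 * G₁ + 2 * c * g₁ - k₁ := by linarith
  grind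

end

/-! ### The polynomials of the stationary Toda equations -/

section
variable {g : ℕ} {E : Fin (2 * g + 2) → ℝ} {a b : ℤ → ℝ} {G K : ℤ → ℝ[X]}

/-- The difference of the quadratic relations at `n` and `n + 1` is divisible by `G (n + 1)`. -/
theorem toda_difference (hG : ∀ n, (G n).Monic)
    (hK : ∀ n, K n + K (n - 1) = 2 * (X - C (b n)) * G n)
    (hR : ∀ n, K n ^ 2 - 4 * C (a n) ^ 2 * G n * G (n + 1) = ∏ j, (X - C (E j))) (n : ℤ) :
    2 * (C (a n) ^ 2 * G n - C (a (n + 1)) ^ 2 * G (n + 1 + 1)) =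
      (X - C (b (n + 1))) * (K n - K (n + 1)) := by
  have h1 := hK (n + 1)
  rw [add_sub_cancel_right] at h1
  have h0 : (2 * G (n + 1)) ≠ 0 := mul_ne_zero two_ne_zero (hG (n + 1)).ne_zero
  apply mul_left_cancel₀ h0
  linear_combination (-1 : ℝ[X]) * hR n + hR (n + 1) + (K n - K (n + 1)) * h1

/-- Inside a band all `G n` have the same sign, because `4 a(n)² G n G (n + 1) = K n ² - ∏ (X - E_i)`
is positive there. -/
theorem mul_pos_of_prod_sub_edges_neg
    (hR : ∀ n, K n ^ 2 - 4 * C (a n) ^ 2 * G n * G (n + 1) = ∏ j, (X - C (E j))) {x : ℝ}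
    (hx : ∏ i, (x - E i) < 0) (m n : ℤ) : 0 < (G m).eval x * (G n).eval x := by
  have h : ∀ n, 0 < (G n).eval x * (G (n + 1)).eval x := fun n => by
    have := congrArg (Polynomial.eval x) (hR n)
    simp only [eval_sub, eval_pow, eval_mul, eval_C, eval_ofNat, eval_prod, eval_X] at this
    have h2 : 0 < a n ^ 2 * ((G n).eval x * (G (n + 1)).eval x) := by
      nlinarith [sq_nonneg ((K n).eval x)]
    exact pos_of_mul_pos_right h2 (sq_nonneg _)
  have h0 : ∀ n, 0 < (G 0).eval x * (G n).eval x := fun n => by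
    have step : ∀ n, 0 < (G 0).eval x * (G n).eval x ↔ 0 < (G 0).eval x * (G (n + 1)).eval x := by
      intro n
      have := h n
      refine ⟨fun h' => ?_, fun h' => ?_⟩
      · refine pos_of_mul_pos_right (a := (G n).eval x ^ 2) ?_ (sq_nonneg _)
        linarith [mul_pos h' this]
      · refine pos_of_mul_pos_right (a := (G (n + 1)).eval x ^ 2) ?_ (sq_nonneg _)
        linarith [mul_pos h' this]
    induction n using Int.induction_on with
    | zero =>
      have := h 0
      exact mul_self_pos.2 fun h => by simp [h] at this
    | succ n ih => exact (step _).1 ih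
    | pred n ih => exact (step _).2 (by rwa [sub_add_cancel])
  have h1 := mul_pos (h0 m) (h0 n)
  refine pos_of_mul_pos_right (a := ((G 0).eval x) ^ 2) ?_ (sq_nonneg _)
  linarith

/-- The zeros of all `G n` lie in the convex hull of the spectrum: `G n` keeps its sign inside each
band as `n` varies, hence, like `G 0`, changes sign from each band to the next one. -/
theorem exists_zeros (hE : StrictMono E) {μ : Fin g → ℝ}
    (hμ : ∀ j, μ j ∈ Set.Icc (gapLeft E j) (gapRight E j))
    (hG : ∀ n, (G n).Monic ∧ (G n).natDegree = g) (hG0 : G 0 = ∏ j, (X - C (μ j)))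
    (hR : ∀ n, K n ^ 2 - 4 * C (a n) ^ 2 * G n * G (n + 1) = ∏ j, (X - C (E j))) (n : ℤ) :
    ∃ ν : Fin g → ℝ, (∀ j, ν j ∈ Set.Icc (E 0) (E (Fin.last _))) ∧ G n = ∏ j, (X - C (ν j)) := by
  have hlt : ∀ k : Fin (g + 1), E ⟨2 * k, by omega⟩ < E ⟨2 * k + 1, by omega⟩ :=
    fun k => hE (by simp [Fin.lt_def])
  choose x hx using fun k => exists_between (hlt k)
  have hxR : ∀ k, ∏ i, (x k - E i) < 0 := fun k => prod_sub_edges_neg hE (hx k).1 (hx k).2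
  have hL : ∀ j : Fin g, x j.castSucc < gapLeft E j := fun j => (hx j.castSucc).2
  have hRt : ∀ j : Fin g, gapRight E j < x j.succ := fun j =>
    lt_of_le_of_lt (hE.monotone (by simp [Fin.le_def]; omega)) (hx j.succ).1
  have h0 : ∀ j : Fin g, (G 0).eval (x j.castSucc) * (G 0).eval (x j.succ) < 0 := by
    intro j
    simp only [hG0, eval_prod, eval_sub, eval_X, eval_C]
    rw [← Finset.prod_mul_distrib, ← Finset.mul_prod_erase _ _ (Finset.mem_univ j)]
    have hgap := gapLeft_lt_gapRight hE
    have := hμ j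
    refine mul_neg_of_neg_of_pos (mul_neg_of_neg_of_pos (by linarith [hL j, this.1])
      (by linarith [hRt j, this.2])) (Finset.prod_pos fun i hi => ?_)
    have hi' := hμ i
    rcases lt_or_gt_of_ne (Finset.ne_of_mem_erase hi) with h | h
    · have h2 : gapRight E i ≤ E ⟨2 * j.castSucc, by simp; omega⟩ :=
        hE.monotone (by simp only [Fin.le_def, Fin.lt_def, Fin.val_castSucc] at *; omega)
      have h3 := (hx j.castSucc).1
      exact mul_pos (by linarith [hi'.2]) (by linarith [hi'.2, hL j, hRt j, hgap j])
    · have h2 : E ⟨2 * j.succ + 1, by simp⟩ ≤ gapLeft E i :=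
        hE.monotone (by simp only [Fin.le_def, Fin.lt_def, Fin.val_succ] at *; omega)
      have h3 := (hx j.succ).2
      exact mul_pos_of_neg_of_neg (by linarith [hi'.1, hL j, hRt j, hgap j]) (by linarith [hi'.1])
  have hn : ∀ j : Fin g, (G n).eval (x j.castSucc) * (G n).eval (x j.succ) < 0 := by
    intro j
    have h1 := mul_pos_of_prod_sub_edges_neg hR (hxR j.castSucc) 0 n
    have h2 := mul_pos_of_prod_sub_edges_neg hR (hxR j.succ) 0 n
    have h3 := mul_pos h1 h2
    by_contra! h
    nlinarith [h0 j, mul_nonneg h (neg_pos.2 (h0 j)).le]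
  have hroot : ∀ j : Fin g, ∃ ν ∈ Set.Ioo (x j.castSucc) (x j.succ), (G n).eval ν = 0 := by
    intro j
    have hlt' : x j.castSucc ≤ x j.succ := by linarith [hL j, hRt j, gapLeft_lt_gapRight hE j]
    have hc : ContinuousOn (fun t => (G n).eval t) (Set.Icc (x j.castSucc) (x j.succ)) :=
      (G n).continuous.continuousOn
    rcases mul_neg_iff.1 (hn j) with h | h
    · exact intermediate_value_Ioo' hlt' hc ⟨h.2, h.1⟩
    · exact intermediate_value_Ioo hlt' hc ⟨h.1, h.2⟩
  choose ν hν hν0 using hroot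
  have hxmono : Monotone x := by
    refine Fin.monotone_iff_le_succ.2 fun j => ?_
    linarith [hL j, hRt j, gapLeft_lt_gapRight hE j]
  have hinj : StrictMono ν := by
    intro i j hij
    have h1 : x i.succ ≤ x j.castSucc := hxmono (by
      rw [Fin.le_def, Fin.val_succ, Fin.val_castSucc]; exact hij)
    linarith [(hν i).2, (hν j).1]
  refine ⟨ν, fun j => ⟨?_, ?_⟩, ?_⟩
  · have h1 : E 0 ≤ E ⟨2 * j.castSucc, by simp; omega⟩ := hE.monotone (Fin.zero_le _)
    linarith [(hν j).1, (hx j.castSucc).1]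
  · have h1 : E ⟨2 * j.succ + 1, by simp⟩ ≤ E (Fin.last _) := hE.monotone (Fin.le_last _)
    linarith [(hν j).2, (hx j.succ).2]
  · refine Polynomial.eq_of_monic_of_dvd_of_natDegree_le (monic_prod_of_monic _ _
      fun j _ => monic_X_sub_C _) (hG n).1 ?_ ?_
    · refine Finset.prod_dvd_of_coprime ?_ fun j _ => dvd_iff_isRoot.2 (hν0 j)
      exact fun i _ j _ hij => pairwise_coprime_X_sub_C hinj.injective hij
    · rw [(hG n).2, natDegree_prod_of_monic _ _ fun j _ => monic_X_sub_C _]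
      simp

/-- A bound on the values of polynomials of bounded degree, at each point, bounds the values of the
derivatives at each point, by Lagrange interpolation. -/
theorem exists_bound_derivative {P : ℤ → ℝ[X]} {d : ℕ} (hd : ∀ n, (P n).degree < d)
    (hP : ∀ t : ℝ, ∃ B, ∀ n, |(P n).eval t| ≤ B) (t : ℝ) :
    ∃ B, ∀ n, |(derivative (P n)).eval t| ≤ B := by
  choose B hB using hP
  let v : Fin d → ℝ := fun i => i
  have hv : Set.InjOn v (Finset.univ : Finset (Fin d)) := fun i _ j _ h =>
    Fin.ext (by simpa [v] using h)
  refine ⟨∑ i, B (v i) * |(derivative (Lagrange.basis Finset.univ v i)).eval t|, fun n => ?_⟩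
  have h := Lagrange.eq_interpolate hv (f := P n) (by simpa using hd n)
  rw [h, Lagrange.interpolate_apply, derivative_sum, eval_finsetSum]
  refine (Finset.abs_sum_le_sum_abs _ _).trans (Finset.sum_le_sum fun i _ => ?_)
  rw [derivative_C_mul, eval_C_mul, abs_mul]
  exact mul_le_mul_of_nonneg_right (hB _ _) (abs_nonneg _)

theorem exists_bound_eval_G (hE : StrictMono E) {μ : Fin g → ℝ}
    (hμ : ∀ j, μ j ∈ Set.Icc (gapLeft E j) (gapRight E j))
    (hG : ∀ n, (G n).Monic ∧ (G n).natDegree = g) (hG0 : G 0 = ∏ j, (X - C (μ j)))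
    (hR : ∀ n, K n ^ 2 - 4 * C (a n) ^ 2 * G n * G (n + 1) = ∏ j, (X - C (E j))) (t : ℝ) :
    ∃ B, ∀ n, |(G n).eval t| ≤ B := by
  refine ⟨(|t - E 0| + |t - E (Fin.last _)|) ^ g, fun n => ?_⟩
  obtain ⟨ν, hν, h⟩ := exists_zeros hE hμ hG hG0 hR n
  rw [h, eval_prod, Finset.abs_prod]
  refine (Finset.prod_le_prod (fun _ _ => abs_nonneg _)
    (g := fun _ => |t - E 0| + |t - E (Fin.last _)|) fun j _ => ?_).trans (by simp)
  simp only [eval_sub, eval_X, eval_C]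
  have := hν j
  rw [abs_le]
  constructor
  · linarith [this.2, neg_abs_le (t - E (Fin.last _)), abs_nonneg (t - E 0)]
  · linarith [this.1, le_abs_self (t - E 0), abs_nonneg (t - E (Fin.last _))]

theorem exists_bound_eval_K {A : ℝ} (ha : ∀ n, |a n| ≤ A)
    (hG : ∀ t : ℝ, ∃ B, ∀ n, |(G n).eval t| ≤ B)
    (hR : ∀ n, K n ^ 2 - 4 * C (a n) ^ 2 * G n * G (n + 1) = ∏ j, (X - C (E j))) (t : ℝ) :
    ∃ B, ∀ n, |(K n).eval t| ≤ B := by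
  obtain ⟨B, hB⟩ := hG t
  have hB0 : 0 ≤ B := (abs_nonneg _).trans (hB 0)
  refine ⟨√(4 * A ^ 2 * B * B + ∏ i, (t - E i)), fun n => Real.abs_le_sqrt ?_⟩
  have := congrArg (Polynomial.eval t) (hR n)
  simp only [eval_sub, eval_pow, eval_mul, eval_C, eval_ofNat, eval_prod, eval_X] at this
  have h1 : a n ^ 2 ≤ A ^ 2 := sq_le_sq' (abs_le.1 (ha n)).1 (abs_le.1 (ha n)).2
  have h2 : a n ^ 2 * ((G n).eval t * (G (n + 1)).eval t) ≤ A ^ 2 * (B * B) :=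
    (mul_le_mul_of_nonneg_left ((le_abs_self _).trans (by
      rw [abs_mul]; exact mul_le_mul (hB _) (hB _) (abs_nonneg _) hB0)) (sq_nonneg _)).trans
      (mul_le_mul_of_nonneg_right h1 (mul_nonneg hB0 hB0))
  linarith

theorem degree_K_lt (hG : ∀ n, (G n).natDegree = g)
    (hR : ∀ n, K n ^ 2 - 4 * C (a n) ^ 2 * G n * G (n + 1) = ∏ j, (X - C (E j))) (n : ℤ) :
    (K n).degree < (g + 2 : ℕ) := by
  have h1 : K n ^ 2 = ∏ j, (X - C (E j)) + 4 * C (a n) ^ 2 * G n * G (n + 1) := by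
    rw [← hR n]; ring
  have h2 : (K n ^ 2).natDegree ≤ 2 * g + 2 := by
    rw [h1]
    refine (natDegree_add_le _ _).trans (max_le ?_ ?_)
    · rw [natDegree_prod_of_monic _ _ fun j _ => monic_X_sub_C _]; simp
    · rw [show (4 : ℝ[X]) * C (a n) ^ 2 = C (4 * a n ^ 2) by
        rw [C_mul, C_pow]; rfl, mul_assoc]
      refine (natDegree_C_mul_le _ _).trans (natDegree_mul_le.trans ?_)
      rw [hG, hG]; omega
  rw [natDegree_pow] at h2
  exact (degree_le_natDegree).trans_lt (by exact_mod_cast (by omega))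

end

/-! ### Square-summable solutions of the Jacobi equation -/

section
open Filter Topology

theorem abs_mul_le_young {r a b : ℝ} (hr : 0 < r) : |a * b| ≤ r / 8 * a ^ 2 + 2 / r * b ^ 2 := by
  have h : r / 8 * a ^ 2 + 2 / r * b ^ 2 - |a| * |b| = (r / 4 * |a| - |b|) ^ 2 * (2 / r) := by
    rw [← sq_abs a, ← sq_abs b]; field_simp; ring
  have : 0 ≤ (r / 4 * |a| - |b|) ^ 2 * (2 / r) := by positivity
  rw [abs_mul]; linarith

/-- Telescoping a Lyapunov function `M` along the whole lattice. The two terms with `r / 8` are the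
losses caused by the inhomogeneity `f`. -/
theorem tsum_sq_le_of_telescope {u f M : ℤ → ℝ} {r C D : ℝ}
    (hu : Summable fun n => u n ^ 2) (hf : Summable fun n => f n ^ 2)
    (hM : ∀ n, |M n| ≤ D * (u n ^ 2 + u (n + 1) ^ 2))
    (h : ∀ n, r / 2 * u (n + 1) ^ 2 - r / 8 * u (n + 1) ^ 2 - r / 8 * u (n + 1 + 1) ^ 2
      - C * f (n + 1) ^ 2 ≤ M n - M (n + 1)) :
    r / 4 * ∑' n, u n ^ 2 ≤ C * ∑' n, f n ^ 2 := by
  have shift : ∀ {φ : ℤ → ℝ}, Summable φ → Summable fun n => φ (n + 1) := fun hφ =>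
    (Equiv.addRight (1 : ℤ)).summable_iff.2 hφ
  have shift_eq : ∀ φ : ℤ → ℝ, ∑' n, φ (n + 1) = ∑' n, φ n := fun φ =>
    (Equiv.addRight (1 : ℤ)).tsum_eq φ
  have hu1 := shift hu
  have hu2 := shift hu1
  have hf1 := shift hf
  have hMs : Summable M := Summable.of_norm_bounded ((hu.add hu1).mul_left D) hM
  have key := Summable.tsum_le_tsum h
    ((((hu1.mul_left (r / 2)).sub (hu1.mul_left (r / 8))).sub (hu2.mul_left (r / 8))).sub
      (hf1.mul_left C)) (hMs.sub (shift hMs))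
  rw [Summable.tsum_sub (((hu1.mul_left (r / 2)).sub (hu1.mul_left (r / 8))).sub
      (hu2.mul_left (r / 8))) (hf1.mul_left C), Summable.tsum_sub ((hu1.mul_left (r / 2)).sub
      (hu1.mul_left (r / 8))) (hu2.mul_left (r / 8)), Summable.tsum_sub (hu1.mul_left (r / 2))
      (hu1.mul_left (r / 8)), Summable.tsum_sub hMs (shift hMs)] at key
  simp only [tsum_mul_left] at key
  rw [shift_eq M, shift_eq (fun n => f n ^ 2), shift_eq (fun n => u (n + 1) ^ 2),
    shift_eq (fun n => u n ^ 2)] at key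
  linarith

/-- The values at a real point `x` of the polynomials `G n`, `K n` of a finite-gap operator and of
their derivatives `G' n`, `K' n`, with the relations that link them; `r` and `r'` are the values of
`∏ (X - E_i)` and of its derivative, and `B` is a bound uniform in `n`. -/
structure FiniteGapValues (a b : ℤ → ℝ) (x r r' B : ℝ) (G K G' K' : ℤ → ℝ) : Prop where
  bound_G : ∀ n, |G n| ≤ B
  bound_K : ∀ n, |K n| ≤ B
  bound_G' : ∀ n, |G' n| ≤ B
  bound_K' : ∀ n, |K' n| ≤ B
  trace : ∀ n, K (n + 1) + K n = 2 * (x - b (n + 1)) * G (n + 1)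
  trace' : ∀ n, K' (n + 1) + K' n = 2 * G (n + 1) + 2 * (x - b (n + 1)) * G' (n + 1)
  diff : ∀ n, 2 * (a n ^ 2 * G n - a (n + 1) ^ 2 * G (n + 1 + 1)) =
    (x - b (n + 1)) * (K n - K (n + 1))
  diff' : ∀ n, 2 * (a n ^ 2 * G' n - a (n + 1) ^ 2 * G' (n + 1 + 1)) =
    (K n - K (n + 1)) + (x - b (n + 1)) * (K' n - K' (n + 1))
  disc : ∀ n, K n ^ 2 - 4 * a n ^ 2 * G n * G (n + 1) = r
  disc' : ∀ n, 2 * K n * K' n - 4 * a n ^ 2 * (G' n * G (n + 1) + G n * G' (n + 1)) = r'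

theorem IsFiniteGap.exists_values {g : ℕ} {E : Fin (2 * g + 2) → ℝ} (hE : StrictMono E)
    {μ : Fin g → ℝ} {σ : Fin g → ℤˣ} {a b : ℤ → ℝ} (hab : IsFiniteGap E μ σ a b) {A : ℝ}
    (hA : ∀ n, |a n| ≤ A) (x : ℝ) :
    ∃ (r' B : ℝ) (G K G' K' : ℤ → ℝ),
      FiniteGapValues a b x (∏ i, (x - E i)) r' B G K G' K' := by
  obtain ⟨G, K, hG, hG0, -, hK, hR⟩ := hab.exists_poly
  have hD := toda_difference (fun n => (hG n).1) hK hR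
  have hK' : ∀ n, K (n + 1) + K n = 2 * (X - C (b (n + 1))) * G (n + 1) := fun n => by
    simpa using hK (n + 1)
  have bG := exists_bound_eval_G hE hab.dirichlet_mem hG hG0 hR
  have bK := exists_bound_eval_K hA bG hR
  obtain ⟨B1, h1⟩ := bG x
  obtain ⟨B2, h2⟩ := bK x
  obtain ⟨B3, h3⟩ := exists_bound_derivative (d := g + 1) (fun n =>
    (degree_le_natDegree).trans_lt (by rw [(hG n).2]; exact_mod_cast Nat.lt_succ_self g)) bG x
  obtain ⟨B4, h4⟩ := exists_bound_derivative (degree_K_lt (fun n => (hG n).2) hR) bK x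
  refine ⟨(derivative (∏ i, (X - C (E i)))).eval x, max (max B1 B2) (max B3 B4),
    fun n => (G n).eval x, fun n => (K n).eval x, fun n => (derivative (G n)).eval x,
    fun n => (derivative (K n)).eval x, ?_⟩
  have ev : ∀ {p q : ℝ[X]}, p = q → p.eval x = q.eval x ∧
      (derivative p).eval x = (derivative q).eval x := by rintro p _ rfl; exact ⟨rfl, rfl⟩
  constructor
  · exact fun n => (h1 n).trans (by simp)
  · exact fun n => (h2 n).trans (by simp)
  · exact fun n => (h3 n).trans (by simp)
  · exact fun n => (h4 n).trans (by simp)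
  · intro n
    have := (ev (hK' n)).1
    simpa using this
  · intro n
    have := (ev (hK' n)).2
    simp [derivative_mul] at this
    linear_combination this
  · intro n
    have := (ev (hD n)).1
    simpa using this
  · intro n
    have := (ev (hD n)).2
    simp [derivative_mul, derivative_pow] at this
    linear_combination this
  · intro n
    have := (ev (hR n)).1
    simpa [eval_prod] using this
  · intro n
    have := (ev (hR n)).2
    rw [← this]
    simp [derivative_mul, derivative_pow]
    ring

variable {a b : ℤ → ℝ} {x r r' B : ℝ} {G K G' K' : ℤ → ℝ}

/-- Where the discriminant is positive, the Jacobi operator minus `x` is bounded below on real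
sequences. -/
theorem FiniteGapValues.tsum_sq_le (h : FiniteGapValues a b x r r' B G K G' K') (hr : 0 < r)
    {A : ℝ} (hA : ∀ n, |a n| ≤ A) :
    ∃ C : ℝ, ∀ u f : ℤ → ℝ, (∀ n, f n = a n * u (n + 1) + a (n - 1) * u (n - 1) + (b n - x) * u n) →
      (Summable fun n => u n ^ 2) → (Summable fun n => f n ^ 2) →
      r / 4 * ∑' n, u n ^ 2 ≤ C * ∑' n, f n ^ 2 := by
  have hA0 : 0 ≤ A := (abs_nonneg _).trans (hA 0)
  have hB0 : 0 ≤ B := (abs_nonneg _).trans (h.bound_G 0)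
  let α : ℤ → ℝ := fun n => G' n * K n - K' n * G n
  let β : ℤ → ℝ := fun n => 2 * a n ^ 2 * (G n * G' (n + 1) - G' n * G (n + 1))
  let γ : ℤ → ℝ := fun n => a n ^ 2 * (K' n * G (n + 1) - K n * G' (n + 1))
  have hmul : ∀ {s t s' t' : ℝ}, |s| ≤ B → |t| ≤ B → |s'| ≤ B → |t'| ≤ B →
      |s * t - s' * t'| ≤ 2 * B ^ 2 := by
    intro s t s' t' hs ht hs' ht'
    have h1 : |s * t| ≤ B * B := by
      rw [abs_mul]; exact mul_le_mul hs ht (abs_nonneg _) hB0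
    have h2 : |s' * t'| ≤ B * B := by
      rw [abs_mul]; exact mul_le_mul hs' ht' (abs_nonneg _) hB0
    have := abs_sub (s * t) (s' * t')
    linarith
  have ha2 : ∀ n, a n ^ 2 ≤ A ^ 2 := fun n => sq_le_sq' (abs_le.1 (hA n)).1 (abs_le.1 (hA n)).2
  have hα : ∀ n, |α n| ≤ 2 * B ^ 2 := fun n =>
    hmul (h.bound_G' _) (h.bound_K _) (h.bound_K' _) (h.bound_G _)
  have hβ : ∀ n, |β n| ≤ 2 * A ^ 2 * (2 * B ^ 2) := fun n => by
    simp only [β]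
    rw [abs_mul, abs_of_nonneg (by positivity)]
    exact mul_le_mul (by linarith [ha2 n])
      (hmul (h.bound_G _) (h.bound_G' _) (h.bound_G' _) (h.bound_G _)) (abs_nonneg _)
      (by positivity)
  have hγ : ∀ n, |γ n| ≤ A ^ 2 * (2 * B ^ 2) := fun n => by
    simp only [γ]
    rw [abs_mul, abs_of_nonneg (by positivity)]
    exact mul_le_mul (ha2 n)
      (hmul (h.bound_K' _) (h.bound_G _) (h.bound_K _) (h.bound_G' _)) (abs_nonneg _)
      (by positivity)
  refine ⟨2 / r * (2 * B ^ 2 * (2 * A)) ^ 2 + 2 / r * (2 * A ^ 2 * (2 * B ^ 2)) ^ 2 + 2 * B ^ 2,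
    fun u f hf hu hfs => ?_⟩
  refine tsum_sq_le_of_telescope (M := fun n => α n * (a n * u (n + 1)) ^ 2 +
    β n * ((a n * u (n + 1)) * u n) + γ n * u n ^ 2)
    (D := 2 * B ^ 2 * A ^ 2 + 2 * A ^ 2 * (2 * B ^ 2) * A + A ^ 2 * (2 * B ^ 2)) hu hfs ?_ ?_
  · intro n
    have e1 : |α n * (a n * u (n + 1)) ^ 2| ≤ 2 * B ^ 2 * A ^ 2 * (u n ^ 2 + u (n + 1) ^ 2) := by
      rw [abs_mul, mul_pow, abs_of_nonneg (mul_nonneg (sq_nonneg (a n)) (sq_nonneg _)), mul_assoc]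
      exact mul_le_mul (hα n) (mul_le_mul (ha2 n) (by linarith [sq_nonneg (u n)]) (sq_nonneg _)
        (sq_nonneg _)) (by positivity) (by positivity)
    have e2 : |β n * ((a n * u (n + 1)) * u n)| ≤
        2 * A ^ 2 * (2 * B ^ 2) * A * (u n ^ 2 + u (n + 1) ^ 2) := by
      rw [abs_mul, mul_assoc (a n), abs_mul (a n), mul_assoc (2 * A ^ 2 * (2 * B ^ 2))]
      refine mul_le_mul (hβ n) (mul_le_mul (hA n) ?_ (abs_nonneg _) hA0) (by positivity)
        (by positivity)
      rw [abs_le]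
      constructor <;> nlinarith [sq_nonneg (u n + u (n + 1)), sq_nonneg (u n - u (n + 1)),
        sq_nonneg (u n), sq_nonneg (u (n + 1))]
    have e3 : |γ n * u n ^ 2| ≤ A ^ 2 * (2 * B ^ 2) * (u n ^ 2 + u (n + 1) ^ 2) := by
      rw [abs_mul, abs_of_nonneg (sq_nonneg (u n))]
      exact mul_le_mul (hγ n) (by linarith [sq_nonneg (u (n + 1))]) (sq_nonneg _) (by positivity)
    have := abs_add_three (α n * (a n * u (n + 1)) ^ 2) (β n * ((a n * u (n + 1)) * u n))
      (γ n * u n ^ 2)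
    linarith
  · intro n
    have hf1 := hf (n + 1)
    rw [add_sub_cancel_right] at hf1
    have step := lyapunov_form_step (u₀ := u n) (u₁ := u (n + 1))
      (p := a (n + 1) * u (n + 1 + 1) - f (n + 1)) (a₀ := a n) (c := x - b (n + 1))
      (by rw [hf1]; ring) (h.trace n) (h.trace' n) (h.diff n) (h.diff' n) (h.disc n)
      (h.disc (n + 1)) (h.disc' n)
    -- the inhomogeneity perturbs the exact step by terms linear and quadratic in `f (n + 1)`
    have y1 := abs_mul_le_young (a := u (n + 1 + 1)) (b := 2 * B ^ 2 * (2 * A) * f (n + 1)) hr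
    have y2 := abs_mul_le_young (a := u (n + 1)) (b := 2 * A ^ 2 * (2 * B ^ 2) * f (n + 1)) hr
    have e1 : |α (n + 1) * (2 * (a (n + 1) * u (n + 1 + 1)) * f (n + 1))| ≤
        |u (n + 1 + 1) * (2 * B ^ 2 * (2 * A) * f (n + 1))| := by
      rw [show u (n + 1 + 1) * (2 * B ^ 2 * (2 * A) * f (n + 1)) =
        2 * B ^ 2 * (2 * (A * u (n + 1 + 1)) * f (n + 1)) by ring, abs_mul, abs_mul (2 * B ^ 2),
        abs_of_nonneg (show 0 ≤ 2 * B ^ 2 by positivity)]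
      refine mul_le_mul (hα _) ?_ (abs_nonneg _) (by positivity)
      simp only [abs_mul, abs_of_nonneg hA0]
      gcongr
      exact hA _
    have e2 : |β (n + 1) * (u (n + 1) * f (n + 1))| ≤
        |u (n + 1) * (2 * A ^ 2 * (2 * B ^ 2) * f (n + 1))| := by
      rw [show u (n + 1) * (2 * A ^ 2 * (2 * B ^ 2) * f (n + 1)) =
        2 * A ^ 2 * (2 * B ^ 2) * (u (n + 1) * f (n + 1)) by ring, abs_mul,
        abs_mul (2 * A ^ 2 * (2 * B ^ 2)),
        abs_of_nonneg (show 0 ≤ 2 * A ^ 2 * (2 * B ^ 2) by positivity)]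
      exact mul_le_mul (hβ _) le_rfl (abs_nonneg _) (by positivity)
    have e3 : |α (n + 1) * f (n + 1) ^ 2| ≤ 2 * B ^ 2 * f (n + 1) ^ 2 := by
      rw [abs_mul, abs_of_nonneg (sq_nonneg (f (n + 1)))]
      exact mul_le_mul_of_nonneg_right (hα _) (sq_nonneg _)
    have i1 := (le_abs_self _).trans (e1.trans y1)
    have i2 := (le_abs_self _).trans (e2.trans y2)
    have i3 := (neg_abs_le (α (n + 1) * f (n + 1) ^ 2))
    have i4 := sq_nonneg (2 * G (n + 1) * (a (n + 1) * u (n + 1 + 1) - f (n + 1)) -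
      K (n + 1) * u (n + 1))
    simp only [α, β, γ] at *
    linear_combination (-1 : ℝ) * step + i1 + i2 + i3 + e3 + i4 / 2

/-- Where the discriminant is negative, a real square-summable sequence that solves the Jacobi
equation at all sites but `0` also solves it at `0`: on both half lines it conserves a definite
quadratic form, which tends to zero at infinity. In particular the unit vector at `0` is not in the
range of the Jacobi operator minus `x`. -/
theorem FiniteGapValues.not_solution (h : FiniteGapValues a b x r r' B G K G' K') (hr : r < 0)
    {A : ℝ} (hA : ∀ n, |a n| ≤ A) {u : ℤ → ℝ} (hu : Summable fun n => u n ^ 2)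
    (hne : ∀ n, n ≠ 0 → a n * u (n + 1) + a (n - 1) * u (n - 1) + (b n - x) * u n = 0) :
    a 0 * u (0 + 1) + a (0 - 1) * u (0 - 1) + (b 0 - x) * u 0 = 0 := by
  let Q : ℤ → ℝ := fun n => G n * (a n * u (n + 1)) ^ 2 - K n * (a n * u (n + 1)) * u n +
    a n ^ 2 * G (n + 1) * u n ^ 2
  have hA0 : 0 ≤ A := (abs_nonneg _).trans (hA 0)
  have hB0 : 0 ≤ B := (abs_nonneg _).trans (h.bound_G 0)
  have hQ : ∀ n, n + 1 ≠ 0 → Q n = Q (n + 1) := by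
    intro n hn
    have h1 := hne (n + 1) hn
    rw [add_sub_cancel_right] at h1
    exact conserved_form_step _ (by linarith) (h.trace n) (h.diff n)
  have hu0 : Tendsto u cofinite (𝓝 0) := by
    have := hu.tendsto_cofinite_zero
    rw [tendsto_zero_iff_abs_tendsto_zero]
    have h2 := (Real.continuous_sqrt.tendsto 0).comp this
    rw [Real.sqrt_zero] at h2
    refine h2.congr fun n => ?_
    simp [Real.sqrt_sq_eq_abs]
  have hu1 : Tendsto (fun n => u (n + 1)) cofinite (𝓝 0) :=
    hu0.comp (Equiv.addRight (1 : ℤ)).injective.tendsto_cofinite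
  have hab : ∀ {φ ψ : ℤ → ℝ} {D : ℝ}, (∀ n, |φ n| ≤ D) → Tendsto ψ cofinite (𝓝 0) →
      Tendsto (fun n => φ n * ψ n) cofinite (𝓝 0) := fun hφ hψ =>
    hψ.zero_mul_isBoundedUnder_le (isBoundedUnder_of ⟨_, hφ⟩) |>.congr fun n => mul_comm _ _
  have hp := hab hA hu1
  have hQ0 : Tendsto Q cofinite (𝓝 0) := by
    have h1 := hab h.bound_G (show Tendsto
      (fun n => a n * u (n + 1) * (a n * u (n + 1))) cofinite (𝓝 0) by
      simpa using hp.mul hp)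
    have h2 := hab h.bound_K (show Tendsto (fun n => a n * u (n + 1) * u n) cofinite (𝓝 0) by
      simpa using hp.mul hu0)
    have h3 := hab (fun n => h.bound_G (n + 1)) (show Tendsto
      (fun n => a n * u n * (a n * u n)) cofinite (𝓝 0) by
        simpa using (hab hA hu0).mul (hab hA hu0))
    have := (h1.sub h2).add h3
    rw [sub_zero, add_zero] at this
    exact this.congr fun n => by simp only [Q]; ring
  have hQp : ∀ n : ℕ, Q n = Q 0 := by
    intro n
    induction n with
    | zero => rfl
    | succ n ih => rw [← ih, hQ n (by omega)]; norm_cast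
  have hQm : ∀ n : ℕ, Q (-1 - n) = Q (-1) := by
    intro n
    induction n with
    | zero => simp
    | succ n ih =>
      rw [← ih, hQ (-1 - (n + 1 : ℕ)) (by omega)]; congr 1; push_cast; ring
  have hz0 : Q 0 = 0 := by
    refine tendsto_nhds_unique (tendsto_const_nhds.congr fun n => (hQp n).symm)
      (hQ0.comp (Nat.cast_injective (R := ℤ)).tendsto_cofinite)
  have hzm : Q (-1) = 0 := by
    refine tendsto_nhds_unique (tendsto_const_nhds.congr fun n => (hQm n).symm)
      (hQ0.comp (f := fun n : ℕ => (-1 - n : ℤ)) (Function.Injective.tendsto_cofinite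
        fun m n hmn => by simpa using hmn))
  have hz1 : Q 1 = 0 := by simpa using (hQp 1).trans hz0
  have hdef : ∀ n, Q n = 0 → u n = 0 := by
    intro n hn
    -- completing the square: `4 G Q` is a sum of squares for `r < 0`
    have e : (2 * G n * (a n * u (n + 1)) - K n * u n) ^ 2 + (-r) * u n ^ 2 = 4 * G n * Q n := by
      simp only [Q]; rw [← h.disc n]; ring
    rw [hn, mul_zero] at e
    have h1 := sq_nonneg (2 * G n * (a n * u (n + 1)) - K n * u n)
    have h2 : 0 ≤ (-r) * u n ^ 2 := mul_nonneg (by linarith) (sq_nonneg _)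
    have h3 : (-r) * u n ^ 2 = 0 := by linarith
    rcases mul_eq_zero.1 h3 with h4 | h4
    · linarith
    · exact pow_eq_zero_iff (two_ne_zero) |>.1 h4
  have e1 : u (0 + 1) = 0 := hdef _ (by simpa using hz1)
  have e2 : u (0 - 1) = 0 := hdef _ (by simpa using hzm)
  rw [e1, e2, hdef 0 hz0]; ring

end

/-! ### The spectrum of the finite-gap Jacobi operator -/

section
open Filter Topology

local notation "ℓ2" => lp (fun _ : ℤ => ℂ) 2

theorem IsJacobiOperator.abs_le_norm {a b : ℤ → ℝ} {H : ℓ2 →L[ℂ] ℓ2} (hH : IsJacobiOperator a b H)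
    (n : ℤ) : |a n| ≤ ‖H‖ := by
  have h := hH (lp.single 2 (n + 1) 1) n
  simp only [lp.single_apply, Pi.single_eq_same] at h
  rw [Pi.single_eq_of_ne (by omega), Pi.single_eq_of_ne (by omega)] at h
  have h1 := lp.norm_apply_le_norm (by norm_num) (H (lp.single 2 (n + 1) 1)) n
  rw [h] at h1
  have h2 := H.le_opNorm (lp.single 2 (n + 1) 1)
  rw [lp.norm_single (by norm_num)] at h2
  simp at h1 h2
  linarith

theorem IsJacobiOperator.apply_single {a b : ℤ → ℝ} {H : ℓ2 →L[ℂ] ℓ2}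
    (hH : IsJacobiOperator a b H) (n : ℤ) :
    H (lp.single 2 n 1) = lp.single 2 (n - 1) (a (n - 1) : ℂ) + lp.single 2 (n + 1) (a n : ℂ) +
      lp.single 2 n (b n : ℂ) := by
  refine lp.ext (funext fun m => ?_)
  rw [hH]
  simp only [lp.coeFn_add, Pi.add_apply, lp.single_apply, Pi.single_apply]
  split_ifs <;> first | omega | (subst_vars; simp)

theorem IsJacobiOperator.isSelfAdjoint {a b : ℤ → ℝ} {H : ℓ2 →L[ℂ] ℓ2}
    (hH : IsJacobiOperator a b H) : IsSelfAdjoint H := by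
  rw [ContinuousLinearMap.isSelfAdjoint_iff']
  refine ContinuousLinearMap.ext fun u => lp.ext (funext fun n => ?_)
  have h1 : inner ℂ (lp.single 2 n (1 : ℂ) : ℓ2) (ContinuousLinearMap.adjoint H u) =
    ContinuousLinearMap.adjoint H u n := by rw [lp.inner_single_left]; simp
  rw [← h1, ContinuousLinearMap.adjoint_inner_right, hH.apply_single, hH, inner_add_left,
    inner_add_left, lp.inner_single_left, lp.inner_single_left, lp.inner_single_left]
  simp
  ring

theorem isUnit_of_isSelfAdjoint_of_antilipschitz {V : Type*} [NormedAddCommGroup V]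
    [InnerProductSpace ℂ V] [CompleteSpace V] {T : V →L[ℂ] V} (hT : IsSelfAdjoint T) {c : NNReal}
    (h : ∀ v, ‖v‖ ≤ c * ‖T v‖) : IsUnit T := by
  rw [ContinuousLinearMap.isUnit_iff_bijective,
    ContinuousLinearMap.bijective_iff_dense_range_and_antilipschitz]
  refine ⟨?_, c, T.antilipschitz_of_bound h⟩
  have h1 := ContinuousLinearMap.orthogonal_ker T
  rw [ContinuousLinearMap.isSelfAdjoint_iff'.1 hT] at h1
  rw [← h1]
  have : T.ker = ⊥ := by
    refine LinearMap.ker_eq_bot'.2 fun v hv => norm_le_zero_iff.1 ?_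
    have := h v
    rw [show T v = 0 from hv] at this
    simpa using this
  rw [this, Submodule.bot_orthogonal_eq_top]

theorem lp_norm_sq (u : ℓ2) : HasSum (fun n => (u n).re ^ 2 + (u n).im ^ 2) (‖u‖ ^ 2) := by
  have := lp.hasSum_norm (p := 2) (by norm_num) u
  simp only [ENNReal.toReal_ofNat, Real.rpow_ofNat] at this
  refine this.congr_fun ?_
  intro n
  rw [Complex.sq_norm, Complex.normSq_apply]; ring

theorem lp_summable_re (u : ℓ2) : Summable fun n => (u n).re ^ 2 :=
  Summable.of_nonneg_of_le (fun n => sq_nonneg _) (fun n => by linarith [sq_nonneg (u n).im])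
    (lp_norm_sq u).summable

theorem lp_summable_im (u : ℓ2) : Summable fun n => (u n).im ^ 2 :=
  Summable.of_nonneg_of_le (fun n => sq_nonneg _) (fun n => by linarith [sq_nonneg (u n).re])
    (lp_norm_sq u).summable

theorem lp_norm_sq_eq (u : ℓ2) : ‖u‖ ^ 2 = ∑' n, (u n).re ^ 2 + ∑' n, (u n).im ^ 2 := by
  rw [← (lp_norm_sq u).tsum_eq, Summable.tsum_add (lp_summable_re u) (lp_summable_im u)]

variable {g : ℕ} {E : Fin (2 * g + 2) → ℝ} {μ : Fin g → ℝ} {σ : Fin g → ℤˣ} {a b : ℤ → ℝ}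
  {H : ℓ2 →L[ℂ] ℓ2}

theorem IsJacobiOperator.sub_apply (hH : IsJacobiOperator a b H) (x : ℝ) (u : ℓ2) (n : ℤ) :
    ((H - algebraMap ℂ _ (x : ℂ)) u : ℤ → ℂ) n =
      (a n : ℂ) * u (n + 1) + (a (n - 1) : ℂ) * u (n - 1) + ((b n - x : ℝ) : ℂ) * u n := by
  have : (H - algebraMap ℂ (ℓ2 →L[ℂ] ℓ2) (x : ℂ)) u = H u - (x : ℂ) • u := by
    rw [_root_.sub_apply, Algebra.algebraMap_eq_smul_one]; rfl
  rw [this, lp.coeFn_sub, Pi.sub_apply, hH, lp.coeFn_smul, Pi.smul_apply, smul_eq_mul]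
  push_cast; ring

theorem notMem_spectrum_of_prod_pos (hE : StrictMono E) (hab : IsFiniteGap E μ σ a b)
    (hH : IsJacobiOperator a b H) {x : ℝ} (hx : 0 < ∏ i, (x - E i)) : (x : ℂ) ∉ spectrum ℂ H := by
  obtain ⟨r', B, G, K, G', K', hv⟩ := hab.exists_values hE hH.abs_le_norm x
  obtain ⟨C, hC⟩ := hv.tsum_sq_le hx hH.abs_le_norm
  rw [spectrum.notMem_iff, ← IsUnit.sub_iff]
  set r := ∏ i, (x - E i)
  have hsa : IsSelfAdjoint (H - algebraMap ℂ (ℓ2 →L[ℂ] ℓ2) (x : ℂ)) := by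
    refine hH.isSelfAdjoint.sub ?_
    rw [isSelfAdjoint_iff, ← algebraMap_star_comm]; simp
  refine isUnit_of_isSelfAdjoint_of_antilipschitz hsa (c := ⟨√(4 / r * C), Real.sqrt_nonneg _⟩)
    fun u => ?_
  set f := (H - algebraMap ℂ (ℓ2 →L[ℂ] ℓ2) (x : ℂ)) u with hf
  have e := hH.sub_apply x u
  have h1 := hC (fun n => (u n).re) (fun n => (f n).re) (fun n => by
    rw [hf, e]; simp [-Complex.ofReal_sub]) (lp_summable_re _) (lp_summable_re _)
  have h2 := hC (fun n => (u n).im) (fun n => (f n).im) (fun n => by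
    rw [hf, e]; simp [-Complex.ofReal_sub]) (lp_summable_im _) (lp_summable_im _)
  have h3 : ‖u‖ ^ 2 ≤ 4 / r * C * ‖f‖ ^ 2 := by
    have : r / 4 * ‖u‖ ^ 2 ≤ C * ‖f‖ ^ 2 := by
      rw [lp_norm_sq_eq u, lp_norm_sq_eq f]; linarith
    have h4 := mul_le_mul_of_nonneg_left this (show 0 ≤ 4 / r by positivity)
    calc ‖u‖ ^ 2 = 4 / r * (r / 4 * ‖u‖ ^ 2) := by field_simp
      _ ≤ _ := by rw [mul_assoc]; exact h4
  change ‖u‖ ≤ √(4 / r * C) * ‖f‖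
  have h5 := Real.sqrt_le_sqrt h3
  rwa [Real.sqrt_sq (norm_nonneg _), Real.sqrt_mul' _ (sq_nonneg _), Real.sqrt_sq (norm_nonneg _)]
    at h5

theorem mem_spectrum_of_prod_neg (hE : StrictMono E) (hab : IsFiniteGap E μ σ a b)
    (hH : IsJacobiOperator a b H) {x : ℝ} (hx : ∏ i, (x - E i) < 0) : (x : ℂ) ∈ spectrum ℂ H := by
  obtain ⟨r', B, G, K, G', K', hv⟩ := hab.exists_values hE hH.abs_le_norm x
  by_contra hns
  rw [spectrum.notMem_iff, ← IsUnit.sub_iff, ContinuousLinearMap.isUnit_iff_bijective] at hns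
  obtain ⟨u, hu⟩ := hns.2 (lp.single 2 0 1)
  have e := hH.sub_apply x u
  rw [hu] at e
  have e' : ∀ n, (if n = 0 then 1 else 0 : ℝ) = a n * (u (n + 1)).re + a (n - 1) * (u (n - 1)).re +
      (b n - x) * (u n).re := fun n => by
    have := congrArg Complex.re (e n)
    rw [lp.single_apply, Pi.single_apply] at this
    simp [-Complex.ofReal_sub] at this
    rw [← this]
    split_ifs <;> simp
  have h0 := hv.not_solution hx hH.abs_le_norm (lp_summable_re u) fun n hn => by
    rw [← e' n, if_neg hn]
  have h1 := e' 0
  rw [if_pos rfl] at h1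
  linarith

/-- The spectrum of a finite-gap Jacobi operator is the union of the bands. -/
theorem spectrum_eq (hE : StrictMono E) (hab : IsFiniteGap E μ σ a b)
    (hH : IsJacobiOperator a b H) :
    spectrum ℂ H = {z : ℂ | z.im = 0 ∧ ∏ i, (z.re - E i) ≤ 0} := by
  ext z
  constructor
  · intro hz
    have hre := hH.isSelfAdjoint.mem_spectrum_eq_re hz
    refine ⟨hH.isSelfAdjoint.im_eq_zero_of_mem_spectrum hz, ?_⟩
    by_contra! h
    rw [hre] at hz
    exact notMem_spectrum_of_prod_pos hE hab hH h hz
  · rintro ⟨him, hre⟩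
    obtain ⟨x, rfl⟩ : ∃ x : ℝ, z = x := ⟨z.re, Complex.ext rfl (by simpa using him)⟩
    obtain ⟨k, hk⟩ := exists_band_of_prod_sub_edges_nonpos hE hre
    have hlt : E ⟨2 * k, by omega⟩ < E ⟨2 * k + 1, by omega⟩ := hE (by simp [Fin.lt_def])
    have hcl : x ∈ closure (Set.Ioo (E ⟨2 * k, by omega⟩) (E ⟨2 * k + 1, by omega⟩)) := by
      rw [closure_Ioo hlt.ne]; exact hk
    have hclosed : IsClosed ((fun x : ℝ => (x : ℂ)) ⁻¹' spectrum ℂ H) :=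
      (spectrum.isClosed H).preimage Complex.continuous_ofReal
    exact closure_minimal (fun y hy => mem_spectrum_of_prod_neg hE hab hH
      (prod_sub_edges_neg hE hy.1 hy.2)) hclosed hcl

end

/-! ### The argument of the differential -/

section
open Filter Topology
variable {g : ℕ} {E : Fin (2 * g + 2) → ℝ} {lam : Fin g → ℝ}

theorem cpow_half_eq (w : ℂ) :
    w ^ (1 / 2 : ℂ) = (√‖w‖ : ℝ) * Complex.exp ((w.arg / 2 : ℝ) * Complex.I) := by
  rcases eq_or_ne w 0 with rfl | hw
  · simp
  · rw [Complex.cpow_def_of_ne_zero hw, Complex.log]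
    have h : (√‖w‖ : ℝ) = Real.exp (Real.log ‖w‖ / 2) := by
      rw [← Real.log_sqrt (norm_nonneg w), Real.exp_log (Real.sqrt_pos.2 (norm_pos_iff.2 hw))]
    rw [h, Complex.ofReal_exp, ← Complex.exp_add]
    congr 1
    push_cast
    ring

/-- The argument of `-∏ (z - λ_j) / R^{1/2}(z)`, for `z` in the closed upper half plane. -/
noncomputable def phase (E : Fin (2 * g + 2) → ℝ) (lam : Fin g → ℝ) (z : ℂ) : ℝ :=
  ∑ j, (z - (lam j : ℂ)).arg - (∑ i, (z - (E i : ℂ)).arg) / 2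

theorem rootR_eq (E : Fin (2 * g + 2) → ℝ) (z : ℂ) :
    rootR E z = -((∏ i, √‖z - (E i : ℂ)‖ : ℝ) *
      Complex.exp (((∑ i, (z - (E i : ℂ)).arg) / 2 : ℝ) * Complex.I)) := by
  simp only [rootR, cpow_half_eq, Finset.prod_mul_distrib, ← Complex.exp_sum]
  push_cast
  rw [← Finset.sum_mul, Finset.sum_div]

theorem norm_omegaCoeff (E : Fin (2 * g + 2) → ℝ) (lam : Fin g → ℝ) (z : ℂ) :
    ‖omegaCoeff E lam z‖ = (∏ j, ‖z - (lam j : ℂ)‖) * ∏ i, (√‖z - (E i : ℂ)‖)⁻¹ := by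
  rw [omegaCoeff, norm_div, norm_prod, rootR_eq, norm_neg, norm_mul, Complex.norm_exp_ofReal_mul_I,
    mul_one, Complex.norm_real, Real.norm_of_nonneg (Finset.prod_nonneg fun _ _ =>
    Real.sqrt_nonneg _), div_eq_mul_inv, Finset.prod_inv_distrib]

theorem omegaCoeff_eq (E : Fin (2 * g + 2) → ℝ) (lam : Fin g → ℝ) (z : ℂ) :
    omegaCoeff E lam z =
      -((‖omegaCoeff E lam z‖ : ℂ) * Complex.exp ((phase E lam z : ℝ) * Complex.I)) := by
  have h1 : ∏ j, (z - (lam j : ℂ)) = (∏ j, ‖z - (lam j : ℂ)‖ : ℝ) *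
      Complex.exp ((∑ j, (z - (lam j : ℂ)).arg : ℝ) * Complex.I) := by
    push_cast
    rw [Finset.sum_mul, Complex.exp_sum, ← Finset.prod_mul_distrib]
    exact Finset.prod_congr rfl fun j _ => (Complex.norm_mul_exp_arg_mul_I _).symm
  rw [norm_omegaCoeff, omegaCoeff, rootR_eq, h1, phase, Complex.ofReal_sub, sub_mul,
    Complex.exp_sub, Finset.prod_inv_distrib]
  push_cast
  rw [div_neg, mul_div_mul_comm, div_eq_mul_inv (∏ j, (‖z - (lam j : ℂ)‖ : ℂ))]

theorem omegaCoeff_re (E : Fin (2 * g + 2) → ℝ) (lam : Fin g → ℝ) (z : ℂ) :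
    (omegaCoeff E lam z).re = -(‖omegaCoeff E lam z‖ * Real.cos (phase E lam z)) := by
  conv_lhs => rw [omegaCoeff_eq]
  rw [Complex.neg_re, Complex.re_ofReal_mul, Complex.exp_ofReal_mul_I_re]

theorem omegaCoeff_im (E : Fin (2 * g + 2) → ℝ) (lam : Fin g → ℝ) (z : ℂ) :
    (omegaCoeff E lam z).im = -(‖omegaCoeff E lam z‖ * Real.sin (phase E lam z)) := by
  conv_lhs => rw [omegaCoeff_eq]
  rw [Complex.neg_im, Complex.im_ofReal_mul, Complex.exp_ofReal_mul_I_im]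

theorem phase_eq (E : Fin (2 * g + 2) → ℝ) (lam : Fin g → ℝ) (z : ℂ) :
    phase E lam z = ∑ j, ((z - (lam j : ℂ)).arg - (z - (gapLeft E j : ℂ)).arg / 2 -
      (z - (gapRight E j : ℂ)).arg / 2) - (z - (E 0 : ℂ)).arg / 2 -
      (z - (E (Fin.last _) : ℂ)).arg / 2 := by
  rw [phase, sum_edges_eq_gap (fun e : ℝ => (z - (e : ℂ)).arg)]
  simp only [Finset.sum_sub_distrib, Finset.sum_add_distrib, ← Finset.sum_div]
  ring

theorem arg_mem_Ioo {w : ℂ} (hw : 0 < w.im) : w.arg ∈ Set.Ioo 0 Real.pi := by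
  refine ⟨lt_of_le_of_ne (Complex.arg_nonneg_iff.2 hw.le) fun h => ?_,
    lt_of_le_of_ne (Complex.arg_le_pi _) fun h => ?_⟩
  · exact hw.ne' (Complex.arg_eq_zero_iff.1 h.symm).2
  · exact hw.ne' (Complex.arg_eq_pi_iff.1 h).2

/-- The angle at which `z` is seen from a point `x` of the real line grows as `x` moves right. -/
theorem arg_sub_mono {z : ℂ} (hz : 0 < z.im) : Monotone fun x : ℝ => (z - (x : ℂ)).arg := by
  intro x y hxy
  have hx := arg_mem_Ioo (w := z - x) (by simpa using hz)
  have hy := arg_mem_Ioo (w := z - y) (by simpa using hz)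
  by_contra! hlt
  have hs : 0 < Real.sin ((z - x).arg - (z - y).arg) :=
    Real.sin_pos_of_pos_of_lt_pi (by linarith) (by linarith [hx.2, hy.1])
  have hnx : z - x ≠ 0 := fun h => by simp [h] at hx
  have hny : z - y ≠ 0 := fun h => by simp [h] at hy
  rw [Real.sin_sub, Complex.sin_arg, Complex.sin_arg, Complex.cos_arg hnx, Complex.cos_arg hny]
    at hs
  have hx0 := norm_pos_iff.2 hnx
  have hy0 := norm_pos_iff.2 hny
  have : (z - x).im / ‖z - x‖ * ((z - y).re / ‖z - y‖) -
      (z - x).re / ‖z - x‖ * ((z - y).im / ‖z - y‖) = -(z.im * (y - x)) / (‖z - x‖ * ‖z - y‖) := by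
    simp
    field_simp
    ring
  rw [this] at hs
  have h2 : -(z.im * (y - x)) / (‖z - x‖ * ‖z - y‖) ≤ 0 :=
    div_nonpos_of_nonpos_of_nonneg (by nlinarith) (by positivity)
  linarith

theorem sum_gap_le_of_monotone (hE : StrictMono E) {F : ℝ → ℝ} (hF : Monotone F) :
    ∑ j, (F (gapRight E j) - F (gapLeft E j)) ≤ F (E (Fin.last _)) - F (E 0) := by
  have key : ∀ (n : ℕ) (H : ℕ → ℝ), Monotone H →
      ∑ j ∈ Finset.range n, (H (2 * j + 2) - H (2 * j + 1)) ≤ H (2 * n + 1) - H 0 := by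
    intro n H hH
    induction n with
    | zero => simpa using hH (Nat.zero_le 1)
    | succ n ih =>
      rw [Finset.sum_range_succ]
      have : H (2 * n + 2) ≤ H (2 * (n + 1) + 1) := hH (by omega)
      linarith
  have h := key g (fun i => F (E ⟨min i (2 * g + 1), by omega⟩)) fun i j hij =>
    hF (hE.monotone (by simp only [Fin.le_def]; omega))
  rw [← Fin.sum_univ_eq_sum_range (fun j => F (E ⟨min (2 * j + 2) (2 * g + 1), by omega⟩) -
    F (E ⟨min (2 * j + 1) (2 * g + 1), by omega⟩))] at h
  refine le_of_eq_of_le (Finset.sum_congr rfl fun j _ => ?_) (h.trans (le_of_eq ?_))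
  · rw [gapRight, gapLeft]
    congr 4
    all_goals omega
  · congr 3; exact Fin.ext (by simp)

/-- The zeros of the differential interlace the band edges, so that the arguments of numerator and
denominator nearly cancel. -/
theorem phase_mem_Ioo (hE : StrictMono E)
    (hl : ∀ j, lam j ∈ Set.Icc (gapLeft E j) (gapRight E j)) {z : ℂ} (hz : 0 < z.im) :
    phase E lam z ∈ Set.Ioo (-Real.pi) 0 := by
  have hm := arg_sub_mono hz
  have hsum := sum_gap_le_of_monotone hE hm
  have hb : |∑ j, ((z - (lam j : ℂ)).arg - (z - (gapLeft E j : ℂ)).arg / 2 -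
      (z - (gapRight E j : ℂ)).arg / 2)| ≤
      (∑ j, ((z - (gapRight E j : ℂ)).arg - (z - (gapLeft E j : ℂ)).arg)) / 2 := by
    rw [Finset.sum_div]
    refine (Finset.abs_sum_le_sum_abs _ _).trans (Finset.sum_le_sum fun j _ => ?_)
    have h1 := hm (hl j).1
    have h2 := hm (hl j).2
    simp only at h1 h2
    rw [abs_le]
    constructor <;> linarith
  have h0 := arg_mem_Ioo (w := z - (E 0 : ℂ)) (by simpa using hz)
  have h1 := arg_mem_Ioo (w := z - (E (Fin.last _) : ℂ)) (by simpa using hz)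
  rw [phase_eq]
  have := abs_le.1 hb
  constructor
  · linarith [h1.2]
  · linarith [h0.1]

theorem sub_ofReal_ne_zero {z : ℂ} (hz : z.im ≠ 0) (x : ℝ) : z - (x : ℂ) ≠ 0 := fun h =>
  hz (by simpa using congrArg Complex.im h)

theorem omegaCoeff_ne_zero {z : ℂ} (hl : ∀ j, z ≠ lam j) (hE : ∀ i, z ≠ E i) :
    omegaCoeff E lam z ≠ 0 := by
  rw [← norm_ne_zero_iff, norm_omegaCoeff]
  refine mul_ne_zero (Finset.prod_ne_zero_iff.2 fun j _ => ?_)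
    (Finset.prod_ne_zero_iff.2 fun i _ => ?_)
  · exact norm_ne_zero_iff.2 (sub_ne_zero.2 (hl j))
  · exact inv_ne_zero (Real.sqrt_ne_zero'.2 (norm_pos_iff.2 (sub_ne_zero.2 (hE i))))

/-- The differential is a Herglotz function. -/
theorem omegaCoeff_im_pos (hE : StrictMono E)
    (hl : ∀ j, lam j ∈ Set.Icc (gapLeft E j) (gapRight E j)) {z : ℂ} (hz : 0 < z.im) :
    0 < (omegaCoeff E lam z).im := by
  have hne : omegaCoeff E lam z ≠ 0 := omegaCoeff_ne_zero
    (fun j => sub_ne_zero.1 (sub_ofReal_ne_zero hz.ne' _))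
    (fun j => sub_ne_zero.1 (sub_ofReal_ne_zero hz.ne' _))
  have hp := phase_mem_Ioo hE hl hz
  rw [omegaCoeff_im]
  have := Real.sin_neg_of_neg_of_neg_pi_lt hp.2 hp.1
  have h0 := norm_pos_iff.2 hne
  nlinarith

theorem arg_ofReal_sub_of_lt {x e : ℝ} (h : x < e) : ((x : ℂ) - (e : ℂ)).arg = Real.pi := by
  rw [← Complex.ofReal_sub, Complex.arg_ofReal_of_neg (by linarith)]

theorem arg_ofReal_sub_of_le {x e : ℝ} (h : e ≤ x) : ((x : ℂ) - (e : ℂ)).arg = 0 := by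
  rw [← Complex.ofReal_sub, Complex.arg_ofReal_of_nonneg (by linarith)]

/-- On the real line a gap contributes to the phase only at points of the gap itself. At the edges
the value `arg 0 = 0` is the limit from the right. -/
theorem phase_bracket_eq_zero {x l m r : ℝ} (hm : m ∈ Set.Ioo l r) (hx : x < l ∨ r ≤ x) :
    ((x : ℂ) - (m : ℂ)).arg - ((x : ℂ) - (l : ℂ)).arg / 2 - ((x : ℂ) - (r : ℂ)).arg / 2 = 0 := by
  rcases hx with h | h
  · rw [arg_ofReal_sub_of_lt (h.trans hm.1), arg_ofReal_sub_of_lt h,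
      arg_ofReal_sub_of_lt (h.trans (hm.1.trans hm.2))]; ring
  · rw [arg_ofReal_sub_of_le (by linarith [hm.1, hm.2]),
      arg_ofReal_sub_of_le (by linarith [hm.1, hm.2]), arg_ofReal_sub_of_le h]; ring

theorem phase_of_lt_first (hE : StrictMono E)
    (hl : ∀ j, lam j ∈ Set.Ioo (gapLeft E j) (gapRight E j))
    {x : ℝ} (hx : x < E 0) : phase E lam x = -Real.pi := by
  rw [phase_eq, Finset.sum_eq_zero fun j _ => phase_bracket_eq_zero (hl j)
    (Or.inl (hx.trans (first_lt_gapLeft hE j))), arg_ofReal_sub_of_lt hx,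
    arg_ofReal_sub_of_lt (hx.trans (first_lt_last hE))]
  ring

theorem phase_of_last_le (hE : StrictMono E)
    (hl : ∀ j, lam j ∈ Set.Ioo (gapLeft E j) (gapRight E j))
    {x : ℝ} (hx : E (Fin.last _) ≤ x) : phase E lam x = 0 := by
  rw [phase_eq, Finset.sum_eq_zero fun j _ => phase_bracket_eq_zero (hl j)
    (Or.inr ((gapRight_lt_last hE j).le.trans hx)), arg_ofReal_sub_of_le hx,
    arg_ofReal_sub_of_le ((first_lt_last hE).le.trans hx)]
  ring

theorem phase_of_band (hE : StrictMono E) (hl : ∀ j, lam j ∈ Set.Ioo (gapLeft E j) (gapRight E j))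
    {x : ℝ} {k : Fin (g + 1)} (h0 : E ⟨2 * k, by omega⟩ ≤ x) (h1 : x < E ⟨2 * k + 1, by omega⟩) :
    phase E lam x = -Real.pi / 2 := by
  rw [phase_eq, Finset.sum_eq_zero fun j _ => phase_bracket_eq_zero (hl j) ?_,
    arg_ofReal_sub_of_le (le_trans (hE.monotone (Fin.zero_le _)) h0),
    arg_ofReal_sub_of_lt (lt_of_lt_of_le h1 (hE.monotone (Fin.le_last _)))]
  · ring
  · exact (band_le_gapLeft_or_gapRight_le hE k j).imp h1.trans_le h0.trans'

theorem phase_of_gap (hE : StrictMono E) (hl : ∀ j, lam j ∈ Set.Ioo (gapLeft E j) (gapRight E j))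
    {x : ℝ} {j : Fin g} (h0 : gapLeft E j ≤ x) (h1 : x < gapRight E j) :
    phase E lam x = ((x : ℂ) - (lam j : ℂ)).arg - Real.pi := by
  rw [phase_eq, Finset.sum_eq_single j, arg_ofReal_sub_of_le h0, arg_ofReal_sub_of_lt h1,
    arg_ofReal_sub_of_le ((first_lt_gapLeft hE j).le.trans h0),
    arg_ofReal_sub_of_lt (h1.trans (gapRight_lt_last hE j))]
  · ring
  · intro i _ hi
    refine phase_bracket_eq_zero (hl i) ?_
    rcases lt_or_gt_of_ne hi with h | h
    · exact Or.inr ((gapRight_lt_gapLeft hE h).le.trans h0)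
    · exact Or.inl (h1.trans (gapRight_lt_gapLeft hE h))
  · simp

end

/-! ### Size of the differential near the band edges -/

section
open Filter Topology MeasureTheory
variable {g : ℕ} {E : Fin (2 * g + 2) → ℝ} {lam : Fin g → ℝ}

/-- Since the band edges are distinct, the singularities of `R^{-1/2}` do not interact. -/
theorem exists_prod_inv_sqrt_le {ι : Type*} {e : ι → ℝ} (he : Function.Injective e)
    (s : Finset ι) (hs : s.Nonempty) :
    ∃ C : ℝ, 0 ≤ C ∧ ∀ z : ℂ, ∏ i ∈ s, (√‖z - (e i : ℂ)‖)⁻¹ ≤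
      C * ∑ i ∈ s, (√‖z - (e i : ℂ)‖)⁻¹ := by
  classical
  -- `1 / (s t) ≤ c (1 / s + 1 / t)` as soon as `1 / c ≤ s + t`
  have pair : ∀ i j, i ≠ j → ∀ z : ℂ, (√‖z - (e i : ℂ)‖)⁻¹ * (√‖z - (e j : ℂ)‖)⁻¹ ≤
      (√|e i - e j|)⁻¹ * ((√‖z - (e i : ℂ)‖)⁻¹ + (√‖z - (e j : ℂ)‖)⁻¹) := by
    intro i j hij z
    have hd : 0 < √|e i - e j| := Real.sqrt_pos.2 (abs_pos.2 (sub_ne_zero.2 (he.ne hij)))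
    rcases (Real.sqrt_nonneg ‖z - (e i : ℂ)‖).eq_or_lt with h1 | h1
    · rw [← h1]; simp; positivity
    rcases (Real.sqrt_nonneg ‖z - (e j : ℂ)‖).eq_or_lt with h2 | h2
    · rw [← h2]; simp; positivity
    have htri : √|e i - e j| ≤ √‖z - (e i : ℂ)‖ + √‖z - (e j : ℂ)‖ := by
      refine Real.sqrt_le_iff.2 ⟨by positivity, ?_⟩
      have h3 : |e i - e j| ≤ ‖z - (e i : ℂ)‖ + ‖z - (e j : ℂ)‖ := by
        rw [← Real.norm_eq_abs, ← Complex.norm_real,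
          show ((e i - e j : ℝ) : ℂ) = (z - e j) - (z - e i) by
          push_cast; ring]
        exact (norm_sub_le _ _).trans (by rw [add_comm])
      have h4 := Real.sq_sqrt (norm_nonneg (z - (e i : ℂ)))
      have h5 := Real.sq_sqrt (norm_nonneg (z - (e j : ℂ)))
      nlinarith
    rw [← mul_inv, inv_le_iff_one_le_mul₀ (by positivity)]
    have : (√|e i - e j|)⁻¹ * ((√‖z - (e i : ℂ)‖)⁻¹ + (√‖z - (e j : ℂ)‖)⁻¹) *
        (√‖z - (e i : ℂ)‖ * √‖z - (e j : ℂ)‖) =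
        (√‖z - (e i : ℂ)‖ + √‖z - (e j : ℂ)‖) / √|e i - e j| := by
      field_simp
      ring
    rw [this, one_le_div hd]
    exact htri
  induction hs using Finset.Nonempty.cons_induction with
  | singleton i => exact ⟨1, zero_le_one, fun z => by simp⟩
  | cons k s hk hs ih =>
    obtain ⟨C, hC, h⟩ := ih
    refine ⟨C * ∑ i ∈ s, (√|e k - e i|)⁻¹, mul_nonneg hC (Finset.sum_nonneg fun _ _ => by
      positivity), fun z => ?_⟩
    rw [Finset.prod_cons, Finset.sum_cons]
    calc (√‖z - (e k : ℂ)‖)⁻¹ * ∏ i ∈ s, (√‖z - (e i : ℂ)‖)⁻¹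
        ≤ (√‖z - (e k : ℂ)‖)⁻¹ * (C * ∑ i ∈ s, (√‖z - (e i : ℂ)‖)⁻¹) :=
          mul_le_mul_of_nonneg_left (h z) (by positivity)
      _ = C * ∑ i ∈ s, (√‖z - (e k : ℂ)‖)⁻¹ * (√‖z - (e i : ℂ)‖)⁻¹ := by
          rw [← Finset.mul_sum]; ring
      _ ≤ C * ∑ i ∈ s, (√|e k - e i|)⁻¹ *
            ((√‖z - (e k : ℂ)‖)⁻¹ + ∑ i ∈ s, (√‖z - (e i : ℂ)‖)⁻¹) := by
          refine mul_le_mul_of_nonneg_left (Finset.sum_le_sum fun i hi => ?_) hC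
          refine (pair k i (fun h => hk (h ▸ hi)) z).trans (mul_le_mul_of_nonneg_left ?_
            (by positivity))
          gcongr
          exact Finset.single_le_sum (f := fun i => (√‖z - (e i : ℂ)‖)⁻¹)
            (fun _ _ => by positivity) hi
      _ = _ := by rw [← Finset.sum_mul]; ring

/-- A locally integrable majorant on the real line of the differential on horizontal lines. -/
noncomputable def edgeWeight (E : Fin (2 * g + 2) → ℝ) (x : ℝ) : ℝ := ∑ i, (√|x - E i|)⁻¹

/-- At the band edges both sides are finite, since the inverse of `0` is `0`; the singularities are
of order `-1 / 2`. -/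
theorem exists_norm_omegaCoeff_le (hE : StrictMono E) (lam : Fin g → ℝ) (M : ℝ) :
    ∃ C : ℝ, 0 ≤ C ∧ ∀ z : ℂ, ‖z‖ ≤ M →
      ‖omegaCoeff E lam z‖ ≤ C * ∑ i, (√‖z - (E i : ℂ)‖)⁻¹ := by
  obtain ⟨C, hC, h⟩ := exists_prod_inv_sqrt_le hE.injective Finset.univ Finset.univ_nonempty
  refine ⟨(∏ j, (|M| + |lam j|)) * C, mul_nonneg (Finset.prod_nonneg fun _ _ => by positivity) hC,
    fun z hz => ?_⟩
  rw [norm_omegaCoeff, mul_assoc]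
  refine mul_le_mul (Finset.prod_le_prod (fun _ _ => norm_nonneg _) fun j _ => ?_) (h z)
    (Finset.prod_nonneg fun _ _ => by positivity) (Finset.prod_nonneg fun _ _ => by positivity)
  refine (norm_sub_le _ _).trans (add_le_add (hz.trans (le_abs_self _)) ?_)
  rw [Complex.norm_real, Real.norm_eq_abs]

theorem exists_norm_omegaCoeff_le_im (hE : StrictMono E) (lam : Fin g → ℝ) (M : ℝ) :
    ∃ C : ℝ, 0 ≤ C ∧ ∀ z : ℂ, 0 < z.im → ‖z‖ ≤ M →
      ‖omegaCoeff E lam z‖ ≤ C * (√z.im)⁻¹ := by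
  obtain ⟨C, hC, h⟩ := exists_norm_omegaCoeff_le hE lam M
  refine ⟨C * (2 * g + 2), by positivity, fun z hz hM => (h z hM).trans ?_⟩
  rw [mul_assoc]
  refine mul_le_mul_of_nonneg_left ?_ hC
  have : ∀ i ∈ Finset.univ, (√‖z - (E i : ℂ)‖)⁻¹ ≤ (√z.im)⁻¹ := fun i _ => by
    refine inv_anti₀ (Real.sqrt_pos.2 hz) (Real.sqrt_le_sqrt ?_)
    have := Complex.abs_im_le_norm (z - E i)
    simp only [Complex.sub_im, Complex.ofReal_im, sub_zero] at this
    exact (le_abs_self _).trans this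
  refine (Finset.sum_le_sum this).trans (le_of_eq ?_)
  simp

theorem exists_norm_omegaCoeff_le_edgeWeight (hE : StrictMono E) (lam : Fin g → ℝ) (M : ℝ) :
    ∃ C : ℝ, 0 ≤ C ∧ ∀ z : ℂ, ‖z‖ ≤ M → (∀ i, z.re ≠ E i) →
      ‖omegaCoeff E lam z‖ ≤ C * edgeWeight E z.re := by
  obtain ⟨C, hC, h⟩ := exists_norm_omegaCoeff_le hE lam M
  refine ⟨C, hC, fun z hM hne => (h z hM).trans (mul_le_mul_of_nonneg_left
    (Finset.sum_le_sum fun i _ => ?_) hC)⟩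
  refine inv_anti₀ (Real.sqrt_pos.2 (abs_pos.2 (sub_ne_zero.2 (hne i)))) (Real.sqrt_le_sqrt ?_)
  simpa using Complex.abs_re_le_norm (z - E i)

theorem intervalIntegrable_inv_sqrt_abs (a b : ℝ) :
    IntervalIntegrable (fun x : ℝ => (√|x|)⁻¹) volume a b := by
  have pos : ∀ c : ℝ, 0 ≤ c → IntervalIntegrable (fun x : ℝ => (√|x|)⁻¹) volume 0 c := by
    intro c hc
    refine (intervalIntegral.intervalIntegrable_rpow' (r := -(1 / 2)) (by norm_num)).congr ?_
    intro x hx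
    rw [Set.uIoc_of_le hc] at hx
    simp only
    rw [abs_of_pos hx.1, Real.rpow_neg hx.1.le, Real.sqrt_eq_rpow]
  have h0 : ∀ c : ℝ, IntervalIntegrable (fun x : ℝ => (√|x|)⁻¹) volume 0 c := by
    intro c
    rcases le_total 0 c with hc | hc
    · exact pos c hc
    · have := (IntervalIntegrable.iff_comp_neg).1 (pos (-c) (by linarith))
      simpa using this
  exact (h0 a).symm.trans (h0 b)

theorem intervalIntegrable_edgeWeight (E : Fin (2 * g + 2) → ℝ) (a b : ℝ) :
    IntervalIntegrable (edgeWeight E) volume a b := by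
  have : edgeWeight E = ∑ i, fun x : ℝ => (√|x - E i|)⁻¹ := by
    ext x; simp [edgeWeight]
  rw [this]
  refine IntervalIntegrable.sum _ fun i _ => ?_
  simpa using (intervalIntegrable_inv_sqrt_abs (a - E i) (b - E i)).comp_sub_right (E i)

theorem ae_forall_ne_edge (E : Fin (2 * g + 2) → ℝ) : ∀ᵐ x : ℝ, ∀ i, x ≠ E i := by
  rw [ae_all_iff]
  intro i
  simp [ae_iff]

theorem measurable_omegaCoeff (E : Fin (2 * g + 2) → ℝ) (lam : Fin g → ℝ) :
    Measurable (omegaCoeff E lam) := by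
  unfold omegaCoeff rootR
  fun_prop

theorem intervalIntegrable_omegaCoeff (hE : StrictMono E) (lam : Fin g → ℝ) (a b : ℝ) :
    IntervalIntegrable (fun x : ℝ => omegaCoeff E lam x) volume a b := by
  obtain ⟨C, hC, h⟩ := exists_norm_omegaCoeff_le_edgeWeight hE lam (max |a| |b|)
  refine ((intervalIntegrable_edgeWeight E a b).const_mul C).mono_fun
    ((measurable_omegaCoeff E lam).comp Complex.measurable_ofReal).aestronglyMeasurable ?_
  rw [Filter.EventuallyLE, ae_restrict_iff' measurableSet_uIoc]
  filter_upwards [ae_forall_ne_edge E] with x hx hxab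
  refine (h x ?_ (by simpa using hx)).trans (le_abs_self _)
  rw [Complex.norm_real, Real.norm_eq_abs]
  rcases Set.mem_uIoc.1 hxab with h | h
  · exact abs_le_max_abs_abs h.1.le h.2
  · rw [max_comm]; exact abs_le_max_abs_abs h.1.le h.2

/-- The zeros of the normalized differential lie in the gaps, one in each. -/
theorem IsNormalized.mem_gap (hE : StrictMono E) (h : IsNormalized E lam) (j : Fin g) :
    lam j ∈ Set.Ioo (gapLeft E j) (gapRight E j) := by
  have ex : ∀ j : Fin g, ∃ k : Fin g, lam k ∈ Set.Ioo (gapLeft E j) (gapRight E j) := by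
    intro j
    by_contra! hno
    have hlt := gapLeft_lt_gapRight hE j
    -- inside the gap the denominator has constant argument and the numerator constant sign
    set m := (gapLeft E j + gapRight E j) / 2 with hm
    have harg : ∀ x ∈ Set.Ioo (gapLeft E j) (gapRight E j), ∀ i : Fin (2 * g + 2),
        ((x : ℂ) - (E i : ℂ)).arg = ((m : ℂ) - (E i : ℂ)).arg := by
      intro x hx i
      have hi : E i ≤ gapLeft E j ∨ gapRight E j ≤ E i := by
        rcases le_or_gt i.1 (2 * j + 1) with h | h
        · exact Or.inl (hE.monotone h)
        · exact Or.inr (hE.monotone (by simp only [Fin.le_def]; omega))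
      rcases hi with hi | hi
      · rw [arg_ofReal_sub_of_le (hi.trans hx.1.le), arg_ofReal_sub_of_le (by linarith)]
      · rw [arg_ofReal_sub_of_lt (hx.2.trans_le hi), arg_ofReal_sub_of_lt (by linarith)]
    obtain ⟨κ, hκ⟩ : ∃ κ : ℝ, (∑ i, ((m : ℂ) - (E i : ℂ)).arg) / 2 = κ := ⟨_, rfl⟩
    let φ : ℝ → ℝ := fun x => (∏ k, (x - lam k)) * (∏ i, √|x - E i|)⁻¹
    have hφ : ∀ x ∈ Set.Ioo (gapLeft E j) (gapRight E j),
        omegaCoeff E lam x * (-Complex.exp (κ * Complex.I)) = φ x := by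
      intro x hx
      have e0 : Complex.exp (κ * Complex.I) ≠ 0 := Complex.exp_ne_zero _
      rw [omegaCoeff, rootR_eq, Finset.sum_congr rfl fun i _ => harg x hx i, hκ]
      generalize Complex.exp (κ * Complex.I) = ε at e0
      simp only [φ, ← Complex.ofReal_sub, Complex.norm_real, Real.norm_eq_abs]
      push_cast
      rw [div_neg, neg_mul_neg, div_eq_mul_inv, mul_inv, mul_assoc, mul_assoc,
        inv_mul_cancel₀ e0, mul_one]
    have hφint : ∫ x in gapLeft E j..gapRight E j, φ x = 0 := by
      have h1 := h.period_eq_zero j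
      have h2 : ∫ x in gapLeft E j..gapRight E j, ((φ x : ℝ) : ℂ) = 0 := by
        rw [← zero_mul (-Complex.exp (κ * Complex.I)), ← h1,
          ← intervalIntegral.integral_mul_const]
        refine intervalIntegral.integral_congr_Ioo_of_le hlt.le fun x hx => ?_
        exact (hφ x hx).symm
      rw [intervalIntegral.integral_ofReal] at h2
      exact_mod_cast h2
    have hsign : ∀ x ∈ Set.Ioo (gapLeft E j) (gapRight E j), 0 < φ m * φ x := by
      intro x hx
      have hw : ∀ y ∈ Set.Ioo (gapLeft E j) (gapRight E j), 0 < (∏ i, √|y - E i|)⁻¹ := by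
        intro y hy
        refine inv_pos.2 (Finset.prod_pos fun i _ => Real.sqrt_pos.2 (abs_pos.2 ?_))
        rcases le_or_gt i.1 (2 * j + 1) with h | h
        · have : E i ≤ gapLeft E j := hE.monotone h
          linarith [hy.1]
        · have : gapRight E j ≤ E i := hE.monotone (by simp only [Fin.le_def]; omega)
          exact (sub_neg.2 (hy.2.trans_le this)).ne
      have hmm : m ∈ Set.Ioo (gapLeft E j) (gapRight E j) := ⟨by linarith, by linarith⟩
      have : φ m * φ x = (∏ k, (m - lam k) * (x - lam k)) *
          ((∏ i, √|m - E i|)⁻¹ * (∏ i, √|x - E i|)⁻¹) := by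
        simp only [φ, Finset.prod_mul_distrib]; ring
      rw [this]
      refine mul_pos (Finset.prod_pos fun k _ => ?_) (mul_pos (hw m hmm) (hw x hx))
      by_cases hk : gapLeft E j < lam k
      · have : gapRight E j ≤ lam k := by
          by_contra! h'; exact hno k ⟨hk, h'⟩
        exact mul_pos_of_neg_of_neg (by linarith) (by linarith [hx.2])
      · rw [not_lt] at hk
        exact mul_pos (by linarith) (by linarith [hx.1])
    have hint : IntervalIntegrable (fun x => φ m * φ x) volume (gapLeft E j) (gapRight E j) := by
      refine IntervalIntegrable.const_mul ?_ _
      have h1 := (intervalIntegrable_omegaCoeff hE lam (gapLeft E j) (gapRight E j)).mul_const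
        (-Complex.exp (κ * Complex.I))
      rw [intervalIntegrable_iff_integrableOn_Ioo_of_le hlt.le] at h1 ⊢
      have h2 : IntegrableOn (fun x => ((φ x : ℝ) : ℂ)) (Set.Ioo (gapLeft E j) (gapRight E j)) :=
        h1.congr_fun (fun x hx => hφ x hx) measurableSet_Ioo
      exact h2.re
    have hpos := intervalIntegral.intervalIntegral_pos_of_pos_on hint hsign hlt
    rw [intervalIntegral.integral_const_mul, hφint, mul_zero] at hpos
    exact lt_irrefl _ hpos
  choose k hk using ex
  have hmono : StrictMono k := by
    intro i j hij
    by_contra! hle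
    have h1 := h.strictMono.monotone hle
    have h2 := gapRight_lt_gapLeft hE hij
    linarith [(hk i).2, (hk j).1]
  have hid : k j = j := le_antisymm (hmono.apply_le) (hmono.le_apply)
  rw [← hid]
  simpa [hid] using hk j

end

/-! ### Primitives on the upper half plane and their boundary values -/

section
open Filter Topology MeasureTheory
variable {g : ℕ} {E : Fin (2 * g + 2) → ℝ} {lam : Fin g → ℝ}

theorem isOpen_upper : IsOpen {z : ℂ | 0 < z.im} := isOpen_lt continuous_const Complex.continuous_im

theorem convex_upper : Convex ℝ {z : ℂ | 0 < z.im} := convex_halfSpace_im_gt 0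

theorem closed_upper_subset_closure : {z : ℂ | 0 ≤ z.im} ⊆ closure {z : ℂ | 0 < z.im} := by
  rw [Complex.closure_setOfPred_lt_im]

/-- A primitive of a function that grows at most like `(Im z)^{-1/2}` is nearly constant on small
half discs: every point is joined to the top of the half disc by a segment that leaves the real
line at a linear rate. -/
theorem norm_sub_le_of_deriv_le_inv_sqrt {f F : ℂ → ℂ} {C : ℝ}
    (hF : ∀ z : ℂ, 0 < z.im → HasDerivAt F (f z) z)
    (hf : ContinuousOn f {z : ℂ | 0 < z.im}) {x a : ℂ} (hx : x.im = 0) {r : ℝ} (hr : 0 < r)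
    (hb : ∀ z : ℂ, 0 < z.im → ‖z‖ ≤ ‖x‖ + r → ‖f z‖ ≤ C * (√z.im)⁻¹)
    (ha : 0 < a.im) (har : ‖a - x‖ ≤ r) :
    ‖F (x + r * Complex.I) - F a‖ ≤ 4 * C * √r := by
  set p : ℂ := x + r * Complex.I with hp
  have hpim : p.im = r := by simp [hp, hx]
  let γ : ℝ → ℂ := fun t => a + t * (p - a)
  have hγim : ∀ t, (γ t).im = (1 - t) * a.im + t * r := fun t => by
    simp only [γ, Complex.add_im, Complex.im_ofReal_mul, Complex.sub_im, hpim]; ring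
  have hγpos : ∀ t ∈ Set.Icc (0 : ℝ) 1, 0 < (γ t).im := by
    intro t ht
    rw [hγim]
    rcases ht.1.eq_or_lt with rfl | h0
    · simpa using ha
    · nlinarith [ht.2, mul_pos h0 hr]
  have hγle : ∀ t ∈ Set.Icc (0 : ℝ) 1, t * r ≤ (γ t).im := by
    intro t ht
    rw [hγim]
    nlinarith [ht.2]
  have hγn : ∀ t ∈ Set.Icc (0 : ℝ) 1, ‖γ t‖ ≤ ‖x‖ + r := by
    intro t ht
    have h1 : γ t = x + ((1 - t : ℝ) * (a - x) + (t : ℝ) * (r * Complex.I)) := by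
      simp only [γ, hp]; push_cast; ring
    rw [h1]
    refine (norm_add_le _ _).trans (add_le_add le_rfl ((norm_add_le _ _).trans ?_))
    rw [norm_mul, norm_mul, norm_mul, Complex.norm_I, Complex.norm_real, Complex.norm_real,
      Complex.norm_real, Real.norm_of_nonneg ht.1, Real.norm_of_nonneg hr.le,
      Real.norm_of_nonneg (sub_nonneg.2 ht.2)]
    nlinarith [ht.2]
  have hpa : ‖p - a‖ ≤ 2 * r := by
    have : p - a = r * Complex.I - (a - x) := by rw [hp]; ring
    rw [this]
    refine (norm_sub_le _ _).trans ?_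
    rw [norm_mul, Complex.norm_I, Complex.norm_real, Real.norm_of_nonneg hr.le]
    linarith
  have hC : 0 ≤ C := by
    have := (norm_nonneg _).trans (hb a ha (by
      calc ‖a‖ = ‖x + (a - x)‖ := by ring_nf
        _ ≤ _ := (norm_add_le _ _).trans (by linarith)))
    exact nonneg_of_mul_nonneg_left this (by positivity)
  have hγc : Continuous γ := by fun_prop
  have hderiv : ∀ t ∈ Set.uIcc (0 : ℝ) 1,
      HasDerivAt (fun t => F (γ t)) (f (γ t) * (p - a)) t := by
    intro t ht
    rw [Set.uIcc_of_le zero_le_one] at ht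
    have h1 : HasDerivAt γ (p - a) t := by
      have := ((Complex.ofRealCLM.hasDerivAt (x := t)).mul_const (p - a)).const_add a
      simpa [γ] using this
    exact (hF _ (hγpos t ht)).comp t h1
  have hcont : ContinuousOn (fun t => f (γ t) * (p - a)) (Set.uIcc 0 1) := by
    refine ContinuousOn.mul (hf.comp hγc.continuousOn fun t ht => hγpos t ?_) continuousOn_const
    rwa [Set.uIcc_of_le zero_le_one] at ht
  have e1 := intervalIntegral.integral_eq_sub_of_hasDerivAt hderiv hcont.intervalIntegrable
  have e2 : γ 1 = p := by simp [γ]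
  have e3 : γ 0 = a := by simp [γ]
  simp only [e2, e3] at e1
  have hint : IntervalIntegrable (fun t : ℝ => 2 * C * √r * (√|t|)⁻¹) volume 0 1 :=
    (intervalIntegrable_inv_sqrt_abs 0 1).const_mul _
  rw [← e1]
  refine (intervalIntegral.norm_integral_le_of_norm_le zero_le_one (ae_of_all _ fun t ht => ?_)
    hint).trans (le_of_eq ?_)
  · have ht' : t ∈ Set.Icc (0 : ℝ) 1 := ⟨ht.1.le, ht.2⟩
    rw [norm_mul, abs_of_pos ht.1]
    calc ‖f (γ t)‖ * ‖p - a‖ ≤ C * (√(γ t).im)⁻¹ * (2 * r) :=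
          mul_le_mul (hb _ (hγpos t ht') (hγn t ht')) hpa (norm_nonneg _) (by positivity)
      _ ≤ C * (√(t * r))⁻¹ * (2 * r) := by
          have := mul_pos ht.1 hr
          gcongr
          exact hγle t ht'
      _ = 2 * C * √r * (√t)⁻¹ := by
          rw [Real.sqrt_mul ht.1.le, mul_inv]
          have h2 : r = √r * √r := (Real.mul_self_sqrt hr.le).symm
          have h3 : √r ≠ 0 := (Real.sqrt_pos.2 hr).ne'
          have h4 : √t ≠ 0 := (Real.sqrt_pos.2 ht.1).ne'
          nth_rewrite 2 [h2]
          field_simp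
  · rw [intervalIntegral.integral_const_mul]
    have : ∫ t in (0 : ℝ)..1, (√|t|)⁻¹ = 2 := by
      have h1 : ∫ t in (0 : ℝ)..1, (√|t|)⁻¹ = ∫ t in (0 : ℝ)..1, t ^ (-(1 / 2) : ℝ) := by
        refine intervalIntegral.integral_congr fun t ht => ?_
        rw [Set.uIcc_of_le zero_le_one] at ht
        rw [abs_of_nonneg ht.1, Real.rpow_neg ht.1, Real.sqrt_eq_rpow]
      rw [h1, integral_rpow (Or.inl (by norm_num))]
      norm_num
    rw [this]; ring

/-- A holomorphic function on the upper half plane that grows at most like `(Im z)^{-1/2}` has a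
primitive that is continuous up to the real line. -/
theorem exists_primitive_continuousOn {f : ℂ → ℂ} (hf : DifferentiableOn ℂ f {z : ℂ | 0 < z.im})
    (hb : ∀ M : ℝ, ∃ C : ℝ, 0 ≤ C ∧ ∀ z : ℂ, 0 < z.im → ‖z‖ ≤ M → ‖f z‖ ≤ C * (√z.im)⁻¹) :
    ∃ F : ℂ → ℂ, ContinuousOn F {z : ℂ | 0 ≤ z.im} ∧
      ∀ z : ℂ, 0 < z.im → HasDerivAt F (f z) z := by
  obtain ⟨F, hF⟩ := convex_upper.exists_forall_hasDerivWithinAt hf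
  replace hF : ∀ z : ℂ, 0 < z.im → HasDerivAt F (f z) z := fun z hz =>
    (hF z hz).hasDerivAt (isOpen_upper.mem_nhds hz)
  have hlim : ∀ z ∈ {z : ℂ | 0 ≤ z.im}, ∃ y, Tendsto F (𝓝[{z : ℂ | 0 < z.im}] z) (𝓝 y) := by
    intro z hz
    rcases (show 0 ≤ z.im from hz).eq_or_lt with h0 | h0
    · have : (𝓝[{z : ℂ | 0 < z.im}] z).NeBot :=
        mem_closure_iff_nhdsWithin_neBot.1 (closed_upper_subset_closure hz)
      refine cauchy_map_iff_exists_tendsto.1 (Metric.cauchy_iff.2 ⟨inferInstance, fun ε hε => ?_⟩)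
      obtain ⟨C, hC, hCb⟩ := hb (‖z‖ + 1)
      obtain ⟨r, hr0, hr1, hr⟩ : ∃ r : ℝ, 0 < r ∧ r ≤ 1 ∧ 8 * C * √r < ε := by
        have ht : Tendsto (fun r : ℝ => 8 * C * √r) (𝓝[>] 0) (𝓝 0) := by
          have h1 : Continuous fun r : ℝ => 8 * C * √r := by fun_prop
          have := h1.tendsto 0
          simp only [Real.sqrt_zero, mul_zero] at this
          exact this.mono_left nhdsWithin_le_nhds
        obtain ⟨r, h1, h2, h3⟩ := ((ht.eventually (gt_mem_nhds hε)).and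
          ((eventually_mem_nhdsWithin (s := Set.Ioi (0:ℝ))).and
          (mem_nhdsWithin_of_mem_nhds (Iic_mem_nhds zero_lt_one)))).exists
        exact ⟨r, h2, h3, h1⟩
      refine ⟨F '' (Metric.closedBall z r ∩ {z : ℂ | 0 < z.im}), image_mem_map (inter_mem
        (mem_nhdsWithin_of_mem_nhds (Metric.closedBall_mem_nhds z hr0)) self_mem_nhdsWithin), ?_⟩
      rintro _ ⟨a, ha, rfl⟩ _ ⟨b, hb', rfl⟩
      have key : ∀ a ∈ Metric.closedBall z r ∩ {z : ℂ | 0 < z.im},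
          ‖F (z + r * Complex.I) - F a‖ ≤ 4 * C * √r := fun a ha =>
        norm_sub_le_of_deriv_le_inv_sqrt hF hf.continuousOn h0.symm hr0
          (fun w hw _ => hCb w hw (by linarith)) ha.2 (by simpa [dist_eq_norm] using ha.1)
      have h1 := key a ha
      have h2 := key b hb'
      rw [dist_eq_norm, show F a - F b = (F (z + r * Complex.I) - F b) -
        (F (z + r * Complex.I) - F a) by ring]
      exact lt_of_le_of_lt ((norm_sub_le _ _).trans (by linarith)) hr
    · exact ⟨F z, (hF z h0).continuousAt.tendsto.mono_left nhdsWithin_le_nhds⟩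
  refine ⟨extendFrom {z : ℂ | 0 < z.im} F,
    continuousOn_extendFrom closed_upper_subset_closure hlim, fun z hz => ?_⟩
  refine (hF z hz).congr_of_eventuallyEq ?_
  filter_upwards [isOpen_upper.mem_nhds hz] with w hw
  exact extendFrom_eq (subset_closure hw)
    ((hF w hw).continuousAt.tendsto.mono_left nhdsWithin_le_nhds)

theorem continuousWithinAt_cpow_half {w : ℂ} (h0 : w ≠ 0) :
    ContinuousWithinAt (fun z : ℂ => z ^ (1 / 2 : ℂ)) {z : ℂ | 0 ≤ z.im} w := by
  have hlog : ContinuousWithinAt Complex.log {z : ℂ | 0 ≤ z.im} w := by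
    by_cases hs : w ∈ Complex.slitPlane
    · exact (continuousAt_clog hs).continuousWithinAt
    · rw [Complex.mem_slitPlane_iff, not_or, not_lt, not_not] at hs
      refine Complex.continuousWithinAt_log_of_re_neg_of_im_zero
        (lt_of_le_of_ne hs.1 fun h => h0 (Complex.ext h hs.2)) hs.2
  have h1 : ContinuousWithinAt (fun z : ℂ => Complex.exp (Complex.log z * (1 / 2)))
      {z : ℂ | 0 ≤ z.im} w := (hlog.mul continuousWithinAt_const).cexp
  refine h1.congr_of_eventuallyEq ?_ (Complex.cpow_def_of_ne_zero h0 _)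
  filter_upwards [mem_nhdsWithin_of_mem_nhds (isOpen_ne.mem_nhds h0)] with z hz
  exact Complex.cpow_def_of_ne_zero hz _

theorem rootR_ne_zero {z : ℂ} (h : ∀ i, z ≠ E i) : rootR E z ≠ 0 := by
  rw [rootR, neg_ne_zero, Finset.prod_ne_zero_iff]
  intro i _
  rw [Complex.cpow_ne_zero_iff]
  exact Or.inl (sub_ne_zero.2 (h i))

theorem continuousWithinAt_omegaCoeff {z : ℂ} (h : ∀ i, z ≠ E i) :
    ContinuousWithinAt (omegaCoeff E lam) {z : ℂ | 0 ≤ z.im} z := by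
  have h1 : ContinuousWithinAt (rootR E) {z : ℂ | 0 ≤ z.im} z := by
    refine Tendsto.neg (tendsto_finsetProd _ fun i _ => ?_)
    exact (continuousWithinAt_cpow_half (sub_ne_zero.2 (h i))).comp
      (f := fun w : ℂ => w - (E i : ℂ)) (by fun_prop) fun w hw => by simpa using hw
  have h2 : ContinuousWithinAt (fun w : ℂ => ∏ j, (w - (lam j : ℂ))) {z : ℂ | 0 ≤ z.im} z :=
    tendsto_finsetProd _ fun j _ => (by fun_prop :
      ContinuousWithinAt (fun w : ℂ => w - (lam j : ℂ)) {z : ℂ | 0 ≤ z.im} z)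
  exact ContinuousWithinAt.div h2 h1 (rootR_ne_zero h)

theorem differentiableAt_omegaCoeff {z : ℂ} (hz : z.im ≠ 0) :
    DifferentiableAt ℂ (omegaCoeff E lam) z := by
  have h1 : DifferentiableAt ℂ (rootR E) z := by
    unfold rootR
    refine DifferentiableAt.neg ?_
    refine DifferentiableAt.fun_finsetProd fun i _ => ?_
    exact DifferentiableAt.cpow_const (by fun_prop)
      (Complex.mem_slitPlane_iff.2 (Or.inr (by simpa using hz)))
  exact DifferentiableAt.div (by fun_prop) h1
    (rootR_ne_zero fun i => sub_ne_zero.1 (sub_ofReal_ne_zero hz _))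

end

/-! ### The quasi-momentum on the closed upper half plane -/

section
open Filter Topology MeasureTheory
variable {g : ℕ} {E : Fin (2 * g + 2) → ℝ} {lam : Fin g → ℝ}

/-- `F` is the integral of the differential from `E₀`, on the closed upper half plane. -/
structure IsUpperPrimitive (E : Fin (2 * g + 2) → ℝ) (lam : Fin g → ℝ) (F : ℂ → ℂ) : Prop where
  continuousOn : ContinuousOn F {z : ℂ | 0 ≤ z.im}
  hasDerivAt : ∀ z : ℂ, 0 < z.im → HasDerivAt F (omegaCoeff E lam z) z
  base : F (E 0) = 0

theorem exists_isUpperPrimitive (hE : StrictMono E) (lam : Fin g → ℝ) :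
    ∃ F, IsUpperPrimitive E lam F := by
  obtain ⟨F, hc, hd⟩ := exists_primitive_continuousOn (f := omegaCoeff E lam)
    (fun z hz => (differentiableAt_omegaCoeff (ne_of_gt hz)).differentiableWithinAt)
    (exists_norm_omegaCoeff_le_im hE lam)
  exact ⟨fun z => F z - F (E 0), hc.sub continuousOn_const, fun z hz => (hd z hz).sub_const _,
    sub_self _⟩

theorem tendsto_add_mul_I (x : ℝ) :
    Tendsto (fun ε : ℝ => (x : ℂ) + ε * Complex.I) (𝓝[>] 0) (𝓝[{z : ℂ | 0 ≤ z.im}] (x : ℂ)) := by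
  refine tendsto_nhdsWithin_iff.2 ⟨?_, ?_⟩
  · have h : Continuous fun ε : ℝ => (x : ℂ) + ε * Complex.I := by fun_prop
    have := h.tendsto 0
    simp only [Complex.ofReal_zero, zero_mul, add_zero] at this
    exact this.mono_left nhdsWithin_le_nhds
  · filter_upwards [self_mem_nhdsWithin] with ε hε
    simpa using (le_of_lt hε)

namespace IsUpperPrimitive
variable {F : ℂ → ℂ}

/-- The boundary values on the real line are integrals of the boundary values of the differential,
also across the band edges. -/
theorem sub_eq_integral (h : IsUpperPrimitive E lam F) (hE : StrictMono E) (a b : ℝ) :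
    F b - F a = ∫ x in a..b, omegaCoeff E lam x := by
  have hlim : ∀ x : ℝ, Tendsto (fun ε : ℝ => F ((x : ℂ) + ε * Complex.I)) (𝓝[>] 0) (𝓝 (F x)) :=
    fun x => (h.continuousOn x (by simp)).tendsto.comp (tendsto_add_mul_I x)
  obtain ⟨C, hC, hb⟩ := exists_norm_omegaCoeff_le_edgeWeight hE lam (max |a| |b| + 1)
  have hint : Tendsto (fun ε : ℝ => ∫ x in a..b, omegaCoeff E lam ((x : ℂ) + ε * Complex.I))
      (𝓝[>] 0) (𝓝 (∫ x in a..b, omegaCoeff E lam x)) := by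
    refine intervalIntegral.tendsto_integral_filter_of_dominated_convergence
      (fun x => C * edgeWeight E x) ?_ ?_ ((intervalIntegrable_edgeWeight E a b).const_mul C) ?_
    · refine Eventually.of_forall fun ε => ?_
      exact ((measurable_omegaCoeff E lam).comp (by fun_prop)).aestronglyMeasurable
    · have h1 : ∀ᶠ ε : ℝ in 𝓝[>] 0, 0 < ε ∧ ε ≤ 1 := by
        filter_upwards [self_mem_nhdsWithin, mem_nhdsWithin_of_mem_nhds (Iic_mem_nhds zero_lt_one)]
          with ε h1 h2 using ⟨h1, h2⟩
      filter_upwards [h1] with ε hε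
      filter_upwards [ae_forall_ne_edge E] with x hx hxab
      have := hb ((x : ℂ) + ε * Complex.I) ?_ (by simpa using hx)
      · simpa using this
      · refine (norm_add_le _ _).trans (add_le_add ?_ ?_)
        · rw [Complex.norm_real, Real.norm_eq_abs]
          rcases Set.mem_uIoc.1 hxab with h | h
          · exact abs_le_max_abs_abs h.1.le h.2
          · rw [max_comm]; exact abs_le_max_abs_abs h.1.le h.2
        · simpa [abs_of_pos hε.1] using hε.2
    · filter_upwards [ae_forall_ne_edge E] with x hx _
      exact (continuousWithinAt_omegaCoeff (by simpa using hx)).tendsto.comp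
        (tendsto_add_mul_I x)
  refine tendsto_nhds_unique ((hlim b).sub (hlim a)) (hint.congr' ?_)
  filter_upwards [self_mem_nhdsWithin] with ε hε
  have hpos : ∀ x : ℝ, 0 < ((x : ℂ) + ε * Complex.I).im := fun x => by simpa using hε
  refine intervalIntegral.integral_eq_sub_of_hasDerivAt (f := fun x : ℝ => F (x + ε * Complex.I))
    (fun x _ => ?_) (ContinuousOn.intervalIntegrable fun x _ => ?_)
  · have h1 : HasDerivAt (fun x : ℝ => (x : ℂ) + ε * Complex.I) 1 x := by
      simpa using (Complex.ofRealCLM.hasDerivAt (x := x)).add_const (ε * Complex.I)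
    have h2 := (h.hasDerivAt _ (hpos x)).comp x h1
    rw [mul_one] at h2
    exact h2
  · refine ContinuousAt.continuousWithinAt ?_
    exact ContinuousAt.comp (f := fun x : ℝ => (x : ℂ) + ε * Complex.I)
      (differentiableAt_omegaCoeff (hpos x).ne').continuousAt (by fun_prop)

theorem quasiMomentum_eq (h : IsUpperPrimitive E lam F) (hE : StrictMono E) {z : ℂ}
    (hz : 0 < z.im) : quasiMomentum E lam z = F z := by
  let γ : ℝ → ℂ := fun t => (E 0 : ℂ) + t * (z - E 0)
  have hγim : ∀ t, (γ t).im = t * z.im := fun t => by simp [γ]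
  have hγc : Continuous γ := by fun_prop
  have hcont : ContinuousOn (fun t => F (γ t)) (Set.Icc 0 1) :=
    h.continuousOn.comp hγc.continuousOn fun t ht => by
      simp only [Set.mem_ofPred_eq, hγim]; exact mul_nonneg ht.1 hz.le
  have hpos : ∀ t : ℝ, 0 < t → 0 < (γ t).im := fun t ht => by rw [hγim]; exact mul_pos ht hz
  have hderiv : ∀ t ∈ Set.Ioo (0 : ℝ) 1,
      HasDerivAt (fun t => F (γ t)) ((z - E 0) * omegaCoeff E lam (γ t)) t := by
    intro t ht
    have h1 : HasDerivAt γ (z - E 0) t := by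
      have := ((Complex.ofRealCLM.hasDerivAt (x := t)).mul_const (z - E 0)).const_add (E 0 : ℂ)
      simpa [γ] using this
    rw [mul_comm]
    exact (h.hasDerivAt _ (hpos t ht.1)).comp t h1
  obtain ⟨C, hC, hb⟩ := exists_norm_omegaCoeff_le_im hE lam (|E 0| + ‖z - E 0‖)
  have hint : IntervalIntegrable (fun t => (z - E 0) * omegaCoeff E lam (γ t)) volume 0 1 := by
    refine ((intervalIntegrable_inv_sqrt_abs 0 1).const_mul
      (‖z - E 0‖ * (C * (√z.im)⁻¹))).mono_fun
      (((measurable_omegaCoeff E lam).comp hγc.measurable).const_mul _).aestronglyMeasurable ?_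
    rw [Filter.EventuallyLE, ae_restrict_iff' measurableSet_uIoc]
    refine ae_of_all _ fun t ht => ?_
    rw [Set.uIoc_of_le zero_le_one] at ht
    refine le_trans ?_ (le_abs_self _)
    rw [norm_mul, mul_assoc]
    refine mul_le_mul_of_nonneg_left ((hb _ (hpos t ht.1) ?_).trans (le_of_eq ?_)) (norm_nonneg _)
    · refine (norm_add_le _ _).trans (add_le_add ?_ ?_)
      · rw [Complex.norm_real, Real.norm_eq_abs]
      · rw [norm_mul, Complex.norm_real, Real.norm_of_nonneg ht.1.le]
        exact mul_le_of_le_one_left (norm_nonneg _) ht.2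
    · rw [hγim, Real.sqrt_mul ht.1.le, mul_inv, abs_of_pos ht.1]; ring
  have := intervalIntegral.integral_eq_sub_of_hasDerivAt_of_le zero_le_one hcont hderiv hint
  rw [quasiMomentum, this]
  simp [γ, h.base]

theorem tendsto (h : IsUpperPrimitive E lam F) (hE : StrictMono E) {z : ℂ} (hz : 0 ≤ z.im) :
    Tendsto (quasiMomentum E lam) (𝓝[{z : ℂ | 0 < z.im}] z) (𝓝 (F z)) := by
  refine ((h.continuousOn z hz).mono (fun w (hw : 0 < w.im) => hw.le)).congr' ?_
  filter_upwards [self_mem_nhdsWithin] with w hw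
  exact (h.quasiMomentum_eq hE hw).symm

theorem halfPlane_one : halfPlane 1 = {z : ℂ | 0 < z.im} := by
  ext z; simp [halfPlane]

theorem quasiMomentumExt_eq (h : IsUpperPrimitive E lam F) (hE : StrictMono E) {z : ℂ}
    (hz : 0 ≤ z.im) : quasiMomentumExt E lam 1 z = F z := by
  rw [quasiMomentumExt, halfPlane_one]
  exact extendFrom_eq (closed_upper_subset_closure hz) (h.tendsto hE hz)

end IsUpperPrimitive

end

/-! ### Boundary values on the real line -/

section
open Filter Topology MeasureTheory
variable {g : ℕ} {E : Fin (2 * g + 2) → ℝ} {lam : Fin g → ℝ}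

theorem intervalIntegrable_omegaCoeff_re (hE : StrictMono E) (lam : Fin g → ℝ) (a b : ℝ) :
    IntervalIntegrable (fun x : ℝ => (omegaCoeff E lam x).re) volume a b :=
  ⟨(intervalIntegrable_omegaCoeff hE lam a b).1.re, (intervalIntegrable_omegaCoeff hE lam a b).2.re⟩

namespace IsUpperPrimitive
variable {F : ℂ → ℂ}

theorem re_sub_eq (h : IsUpperPrimitive E lam F) (hE : StrictMono E) (a b : ℝ) :
    (F b).re - (F a).re = ∫ x in a..b, (omegaCoeff E lam x).re := by
  have h1 := congrArg Complex.re (h.sub_eq_integral hE a b)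
  rw [Complex.sub_re] at h1
  rw [h1]
  exact (Complex.reCLM.intervalIntegral_comp_comm (intervalIntegrable_omegaCoeff hE lam a b)).symm

theorem im_sub_eq (h : IsUpperPrimitive E lam F) (hE : StrictMono E) (a b : ℝ) :
    (F b).im - (F a).im = ∫ x in a..b, (omegaCoeff E lam x).im := by
  have h1 := congrArg Complex.im (h.sub_eq_integral hE a b)
  rw [Complex.sub_im] at h1
  rw [h1]
  exact (Complex.imCLM.intervalIntegral_comp_comm (intervalIntegrable_omegaCoeff hE lam a b)).symm

theorem re_eq_of_forall (h : IsUpperPrimitive E lam F) (hE : StrictMono E) {a b : ℝ} (hab : a ≤ b)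
    (h0 : ∀ x ∈ Set.Ioo a b, (omegaCoeff E lam x).re = 0) : (F b).re = (F a).re := by
  rw [← sub_eq_zero, h.re_sub_eq hE]
  rw [intervalIntegral.integral_congr_Ioo_of_le (g := fun _ => (0 : ℝ)) hab h0]
  simp

theorem im_eq_of_forall (h : IsUpperPrimitive E lam F) (hE : StrictMono E) {a b : ℝ} (hab : a ≤ b)
    (h0 : ∀ x ∈ Set.Ioo a b, (omegaCoeff E lam x).im = 0) : (F b).im = (F a).im := by
  rw [← sub_eq_zero, h.im_sub_eq hE]
  rw [intervalIntegral.integral_congr_Ioo_of_le (g := fun _ => (0 : ℝ)) hab h0]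
  simp

theorem re_lt_of_forall_pos (h : IsUpperPrimitive E lam F) (hE : StrictMono E) {a b : ℝ}
    (hab : a < b) (h0 : ∀ x ∈ Set.Ioo a b, 0 < (omegaCoeff E lam x).re) : (F a).re < (F b).re := by
  rw [← sub_pos, h.re_sub_eq hE]
  exact intervalIntegral.intervalIntegral_pos_of_pos_on
    (intervalIntegrable_omegaCoeff_re hE lam a b) h0 hab

theorem re_lt_of_forall_neg (h : IsUpperPrimitive E lam F) (hE : StrictMono E) {a b : ℝ}
    (hab : a < b) (h0 : ∀ x ∈ Set.Ioo a b, (omegaCoeff E lam x).re < 0) : (F b).re < (F a).re := by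
  rw [← sub_pos, ← neg_sub, h.re_sub_eq hE, ← intervalIntegral.integral_neg]
  exact intervalIntegral.intervalIntegral_pos_of_pos_on
    (intervalIntegrable_omegaCoeff_re hE lam a b).neg (fun x hx => neg_pos.2 (h0 x hx)) hab

end IsUpperPrimitive

theorem omegaCoeff_ofReal_ne_zero {x : ℝ} (hl : ∀ j, x ≠ lam j) (hE : ∀ i, x ≠ E i) :
    omegaCoeff E lam x ≠ 0 :=
  omegaCoeff_ne_zero (fun j h => hl j (by exact_mod_cast h)) fun i h => hE i (by exact_mod_cast h)

section Real
variable (hE : StrictMono E) (hl : ∀ j, lam j ∈ Set.Ioo (gapLeft E j) (gapRight E j))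
include hE hl

theorem omegaCoeff_re_pos_of_lt_first {x : ℝ} (hx : x < E 0) : 0 < (omegaCoeff E lam x).re := by
  rw [omegaCoeff_re, phase_of_lt_first hE hl hx, Real.cos_neg, Real.cos_pi]
  have : omegaCoeff E lam x ≠ 0 := omegaCoeff_ofReal_ne_zero
    (fun j => (hx.trans ((first_lt_gapLeft hE j).trans (hl j).1)).ne)
    (fun i => (hx.trans_le (hE.monotone (Fin.zero_le i))).ne)
  have := norm_pos_iff.2 this
  linarith

theorem omegaCoeff_im_eq_zero_of_lt_first {x : ℝ} (hx : x < E 0) : (omegaCoeff E lam x).im = 0 := by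
  rw [omegaCoeff_im, phase_of_lt_first hE hl hx]; simp

theorem omegaCoeff_re_neg_of_last_lt {x : ℝ} (hx : E (Fin.last _) < x) :
    (omegaCoeff E lam x).re < 0 := by
  rw [omegaCoeff_re, phase_of_last_le hE hl hx.le, Real.cos_zero]
  have : omegaCoeff E lam x ≠ 0 := omegaCoeff_ofReal_ne_zero
    (fun j => ((hl j).2.trans ((gapRight_lt_last hE j).trans hx)).ne')
    (fun i => ((hE.monotone (Fin.le_last i)).trans_lt hx).ne')
  have := norm_pos_iff.2 this
  linarith

theorem omegaCoeff_im_eq_zero_of_last_lt {x : ℝ} (hx : E (Fin.last _) < x) :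
    (omegaCoeff E lam x).im = 0 := by
  rw [omegaCoeff_im, phase_of_last_le hE hl hx.le]; simp

theorem omegaCoeff_re_eq_zero_of_band {x : ℝ} {k : Fin (g + 1)} (h0 : E ⟨2 * k, by omega⟩ ≤ x)
    (h1 : x < E ⟨2 * k + 1, by omega⟩) : (omegaCoeff E lam x).re = 0 := by
  rw [omegaCoeff_re, phase_of_band hE hl h0 h1, neg_div, Real.cos_neg, Real.cos_pi_div_two]; simp

theorem omegaCoeff_im_eq_zero_of_gap {x : ℝ} {j : Fin g} (h0 : gapLeft E j ≤ x)
    (h1 : x < gapRight E j) : (omegaCoeff E lam x).im = 0 := by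
  rw [omegaCoeff_im, phase_of_gap hE hl h0 h1]
  rcases lt_or_ge x (lam j) with h | h
  · rw [arg_ofReal_sub_of_lt h]; simp
  · rw [arg_ofReal_sub_of_le h]; simp

theorem omegaCoeff_ne_zero_of_gap {x : ℝ} {j : Fin g} (h0 : gapLeft E j < x)
    (h1 : x < gapRight E j) (h : x ≠ lam j) : omegaCoeff E lam x ≠ 0 := by
  refine omegaCoeff_ofReal_ne_zero (fun i => ?_) (fun i hi => ?_)
  · rcases lt_trichotomy i j with hij | rfl | hij
    · exact ((hl i).2.trans ((gapRight_lt_gapLeft hE hij).trans h0)).ne'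
    · exact h
    · exact (h1.trans ((gapRight_lt_gapLeft hE hij).trans (hl i).1)).ne
  · have := prod_sub_edges_pos_of_mem_gap hE h0 h1
    rw [Finset.prod_eq_zero (Finset.mem_univ i) (sub_eq_zero.2 hi)] at this
    exact lt_irrefl _ this

theorem omegaCoeff_re_neg_of_gap {x : ℝ} {j : Fin g} (h0 : gapLeft E j < x)
    (h1 : x < lam j) : (omegaCoeff E lam x).re < 0 := by
  have := norm_pos_iff.2 (omegaCoeff_ne_zero_of_gap hE hl h0 (h1.trans (hl j).2) h1.ne)
  rw [omegaCoeff_re, phase_of_gap hE hl h0.le (h1.trans (hl j).2), arg_ofReal_sub_of_lt h1]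
  simpa using this

theorem omegaCoeff_re_pos_of_gap {x : ℝ} {j : Fin g} (h0 : lam j < x)
    (h1 : x < gapRight E j) : 0 < (omegaCoeff E lam x).re := by
  have := norm_pos_iff.2 (omegaCoeff_ne_zero_of_gap hE hl ((hl j).1.trans h0) h1 h0.ne')
  rw [omegaCoeff_re, phase_of_gap hE hl ((hl j).1.trans h0).le h1, arg_ofReal_sub_of_le h0.le]
  simpa using this

theorem omegaCoeff_im_nonneg (x : ℝ) : 0 ≤ (omegaCoeff E lam x).im := by
  rcases lt_or_ge x (E 0) with h0 | h0
  · rw [omegaCoeff_im_eq_zero_of_lt_first hE hl h0]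
  rcases lt_or_ge (E (Fin.last _)) x with h1 | h1
  · rw [omegaCoeff_im_eq_zero_of_last_lt hE hl h1]
  rcases mem_gap_or_mem_band hE h0 h1 with ⟨j, hj0, hj1⟩ | ⟨k, hk0, hk1⟩
  · rw [omegaCoeff_im_eq_zero_of_gap hE hl hj0.le hj1]
  · rcases hk1.eq_or_lt with he | hlt
    -- at a band edge the denominator vanishes, so that the quotient is `0` by convention
    · have : omegaCoeff E lam x = 0 := by
        rw [← norm_eq_zero, norm_omegaCoeff, Finset.prod_eq_zero
          (Finset.mem_univ (⟨2 * k + 1, by omega⟩ : Fin (2 * g + 2))) (by simp [he]), mul_zero]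
      rw [this]; simp
    · rw [omegaCoeff_im, phase_of_band hE hl hk0 hlt, neg_div, Real.sin_neg, Real.sin_pi_div_two]
      simp

end Real

namespace IsUpperPrimitive
variable {F : ℂ → ℂ} (h : IsUpperPrimitive E lam F) (hE : StrictMono E)
  (hl : ∀ j, lam j ∈ Set.Ioo (gapLeft E j) (gapRight E j))
include h hE hl

theorem im_mono : Monotone fun x : ℝ => (F x).im := fun a b hab => by
  have := h.im_sub_eq hE a b
  have h2 := intervalIntegral.integral_nonneg (μ := volume) hab
    fun x _ => omegaCoeff_im_nonneg hE hl x
  simp only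
  linarith

theorem im_of_le_first {x : ℝ} (hx : x ≤ E 0) : (F x).im = 0 := by
  have := h.im_eq_of_forall hE hx fun y hy => omegaCoeff_im_eq_zero_of_lt_first hE hl hy.2
  rw [h.base] at this
  simpa using this.symm

theorem im_of_last_le {x : ℝ} (hx : E (Fin.last _) ≤ x) : (F x).im = (F (E (Fin.last _))).im :=
  h.im_eq_of_forall hE hx fun _ hy => omegaCoeff_im_eq_zero_of_last_lt hE hl hy.1

theorem re_neg_of_lt_first {x : ℝ} (hx : x < E 0) : (F x).re < 0 := by
  have := h.re_lt_of_forall_pos hE hx fun y hy => omegaCoeff_re_pos_of_lt_first hE hl hy.2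
  rw [h.base] at this
  simpa using this

theorem im_of_gap {x : ℝ} {j : Fin g} (h0 : gapLeft E j ≤ x) (h1 : x ≤ gapRight E j) :
    (F x).im = (F (gapRight E j)).im :=
  (h.im_eq_of_forall hE h1 fun _ hy =>
    omegaCoeff_im_eq_zero_of_gap hE hl (h0.trans hy.1.le) hy.2).symm

theorem re_of_band {x : ℝ} {k : Fin (g + 1)} (h0 : E ⟨2 * k, by omega⟩ ≤ x)
    (h1 : x ≤ E ⟨2 * k + 1, by omega⟩) : (F x).re = (F (E ⟨2 * k, by omega⟩)).re :=
  h.re_eq_of_forall hE h0 fun _ hy =>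
    omegaCoeff_re_eq_zero_of_band hE hl hy.1.le (hy.2.trans_le h1)

/-- The real part vanishes at all band edges: it is constant on bands, and its increments over the
gaps are the periods that the normalization makes zero. -/
theorem re_edge (hn : IsNormalized E lam) (i : Fin (2 * g + 2)) : (F (E i)).re = 0 := by
  have key : ∀ n (hn : n < 2 * g + 2), (F (E ⟨n, hn⟩)).re = 0 := by
    intro n
    induction n with
    | zero => intro _; change (F (E 0)).re = 0; rw [h.base]; rfl
    | succ n ih =>
      intro hn'
      rw [← ih (by omega)]
      rcases Nat.even_or_odd' n with ⟨k, rfl | rfl⟩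
      · exact h.re_of_band hE hl (k := ⟨k, by omega⟩) (hE.monotone (by simp [Fin.le_def])) le_rfl
      · have h1 := h.sub_eq_integral hE (gapLeft E ⟨k, by omega⟩) (gapRight E ⟨k, by omega⟩)
        rw [hn.period_eq_zero, sub_eq_zero] at h1
        exact congrArg Complex.re h1
  exact key i i.2

theorem re_gapLeft_half {x y : ℝ} {j : Fin g} (h0 : gapLeft E j ≤ x) (hxy : x < y)
    (h1 : y ≤ lam j) : (F y).re < (F x).re :=
  h.re_lt_of_forall_neg hE hxy fun _ hy =>
    omegaCoeff_re_neg_of_gap hE hl (h0.trans_lt hy.1) (hy.2.trans_le h1)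

theorem re_gapRight_half {x y : ℝ} {j : Fin g} (h0 : lam j ≤ x) (hxy : x < y)
    (h1 : y ≤ gapRight E j) : (F x).re < (F y).re :=
  h.re_lt_of_forall_pos hE hxy fun _ hy =>
    omegaCoeff_re_pos_of_gap hE hl (h0.trans_lt hy.1) (hy.2.trans_le h1)

theorem lam_re_le_of_gap {x : ℝ} {j : Fin g} (h0 : gapLeft E j ≤ x) (h1 : x ≤ gapRight E j) :
    (F (lam j)).re ≤ (F x).re := by
  rcases lt_trichotomy x (lam j) with hx | rfl | hx
  · exact (h.re_gapLeft_half hE hl h0 hx le_rfl).le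
  · exact le_rfl
  · exact (h.re_gapRight_half hE hl le_rfl hx h1).le

variable (hn : IsNormalized E lam)
include hn

theorem re_neg_of_last_lt {x : ℝ} (hx : E (Fin.last _) < x) : (F x).re < 0 := by
  have := h.re_lt_of_forall_neg hE hx fun y hy => omegaCoeff_re_neg_of_last_lt hE hl hy.1
  rwa [h.re_edge hE hl hn] at this

theorem re_neg_of_gap {x : ℝ} {j : Fin g} (h0 : gapLeft E j < x) (h1 : x < gapRight E j) :
    (F x).re < 0 := by
  rcases le_or_gt x (lam j) with hx | hx
  · have := h.re_gapLeft_half hE hl le_rfl h0 hx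
    rwa [gapLeft, h.re_edge hE hl hn] at this
  · have := h.re_gapRight_half hE hl hx.le h1 le_rfl
    rwa [gapRight, h.re_edge hE hl hn] at this

theorem re_of_mem_band {x : ℝ} {k : Fin (g + 1)} (h0 : E ⟨2 * k, by omega⟩ ≤ x)
    (h1 : x ≤ E ⟨2 * k + 1, by omega⟩) : (F x).re = 0 := by
  rw [h.re_of_band hE hl h0 h1, h.re_edge hE hl hn]

theorem re_nonpos (x : ℝ) : (F x).re ≤ 0 := by
  rcases lt_or_ge x (E 0) with h0 | h0
  · exact (h.re_neg_of_lt_first hE hl h0).le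
  rcases lt_or_ge (E (Fin.last _)) x with h1 | h1
  · exact (h.re_neg_of_last_lt hE hl hn h1).le
  rcases mem_gap_or_mem_band hE h0 h1 with ⟨j, hj0, hj1⟩ | ⟨k, hk0, hk1⟩
  · exact (h.re_neg_of_gap hE hl hn hj0 hj1).le
  · exact (h.re_of_mem_band hE hl hn hk0 hk1).le

theorem re_eq_zero_iff (x : ℝ) : (F x).re = 0 ↔ ∏ i, (x - E i) ≤ 0 := by
  constructor
  · intro h0
    by_contra! hp
    rcases lt_or_ge x (E 0) with h1 | h1
    · exact (h.re_neg_of_lt_first hE hl h1).ne h0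
    rcases lt_or_ge (E (Fin.last _)) x with h2 | h2
    · exact (h.re_neg_of_last_lt hE hl hn h2).ne h0
    rcases mem_gap_or_mem_band hE h1 h2 with ⟨j, hj0, hj1⟩ | ⟨k, hk0, hk1⟩
    · exact (h.re_neg_of_gap hE hl hn hj0 hj1).ne h0
    · exact (prod_sub_edges_nonpos hE hk0 hk1).not_gt hp
  · intro hp
    obtain ⟨k, hk0, hk1⟩ := exists_band_of_prod_sub_edges_nonpos hE hp
    exact h.re_of_mem_band hE hl hn hk0 hk1

end IsUpperPrimitive

end

/-! ### Behavior at infinity -/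

section
open Filter Topology MeasureTheory
variable {g : ℕ} {E : Fin (2 * g + 2) → ℝ} {lam : Fin g → ℝ}

theorem cpow_half_sub_eq {z : ℂ} (hz : 0 < z.im) {e : ℝ} (he : |e| < ‖z‖) :
    (z - (e : ℂ)) ^ (1 / 2 : ℂ) = z ^ (1 / 2 : ℂ) * (1 - e / z) ^ (1 / 2 : ℂ) := by
  have hz0 : z ≠ 0 := fun h => by simp [h] at hz
  set y : ℂ := 1 - e / z with hy
  have hzy : z - e = z * y := by rw [hy]; field_simp
  have hyre : 0 < y.re := by
    have h1 : ‖(e : ℂ) / z‖ < 1 := by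
      rw [norm_div, Complex.norm_real, Real.norm_eq_abs, div_lt_one (norm_pos_iff.2 hz0)]
      exact he
    have h2 := (Complex.re_le_norm ((e : ℂ) / z)).trans_lt h1
    rw [hy, Complex.sub_re, Complex.one_re]; linarith
  have hy0 : y ≠ 0 := fun h => by simp [h] at hyre
  have harg : z.arg + y.arg ∈ Set.Ioc (-Real.pi) Real.pi := by
    have h1 := arg_mem_Ioo hz
    have h2 := abs_lt.1 (Complex.abs_arg_lt_pi_div_two_iff.2 (Or.inl hyre))
    refine ⟨by linarith [h1.1, h2.1, Real.pi_pos], ?_⟩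
    by_contra! hlt
    have h3 : Real.sin (z.arg + y.arg) < 0 := by
      rw [← Real.sin_sub_two_pi]
      exact Real.sin_neg_of_neg_of_neg_pi_lt (by linarith [h1.2, h2.2]) (by linarith)
    rw [Real.sin_add, Complex.sin_arg, Complex.sin_arg, Complex.cos_arg hz0,
      Complex.cos_arg hy0] at h3
    have h4 : z.im / ‖z‖ * (y.re / ‖y‖) + z.re / ‖z‖ * (y.im / ‖y‖) =
        (z * y).im / (‖z‖ * ‖y‖) := by
      rw [Complex.mul_im, div_mul_div_comm, div_mul_div_comm, ← add_div]; ring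
    rw [h4, ← hzy] at h3
    have h5 : 0 ≤ (z - (e : ℂ)).im / (‖z‖ * ‖y‖) := by
      rw [Complex.sub_im, Complex.ofReal_im, sub_zero]; positivity
    linarith
  rw [hzy, Complex.cpow_def_of_ne_zero (mul_ne_zero hz0 hy0), Complex.cpow_def_of_ne_zero hz0,
    Complex.cpow_def_of_ne_zero hy0, (Complex.log_mul_eq_add_log_iff hz0 hy0).2 harg, add_mul,
    Complex.exp_add]

theorem mul_omegaCoeff_eq {z : ℂ} (hz : 0 < z.im) (h : ∀ i, |E i| < ‖z‖) :
    z * omegaCoeff E lam z =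
      -((∏ j, (1 - (lam j : ℂ) * z⁻¹)) / ∏ i, (1 - (E i : ℂ) * z⁻¹) ^ (1 / 2 : ℂ)) := by
  have hz0 : z ≠ 0 := fun h => by simp [h] at hz
  have h1 : ∏ j, (z - (lam j : ℂ)) = z ^ g * ∏ j, (1 - (lam j : ℂ) * z⁻¹) := by
    have : ∀ j, z - (lam j : ℂ) = z * (1 - (lam j : ℂ) * z⁻¹) := fun j => by field_simp
    simp only [this, Finset.prod_mul_distrib, Finset.prod_const, Finset.card_univ,
      Fintype.card_fin]
  have hsq : (z ^ (1 / 2 : ℂ)) ^ 2 = z := by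
    rw [← Complex.cpow_nat_mul]; norm_num
  have h2 : rootR E z = -(z ^ (g + 1) * ∏ i, (1 - (E i : ℂ) * z⁻¹) ^ (1 / 2 : ℂ)) := by
    simp only [rootR, cpow_half_sub_eq hz (h _), div_eq_mul_inv (E _ : ℂ) z,
      Finset.prod_mul_distrib, Finset.prod_const,
      Finset.card_univ, Fintype.card_fin]
    have hp : (z ^ (1 / 2 : ℂ)) ^ (2 * g + 2) = z ^ (g + 1) := by
      rw [show 2 * g + 2 = 2 * (g + 1) by ring, pow_mul, hsq]
    rw [hp]
  rw [omegaCoeff, h1, h2, div_neg, mul_neg, pow_succ, mul_comm (z ^ g) z, mul_assoc z,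
    mul_div_assoc', mul_div_mul_left _ _ hz0, mul_div_mul_left _ _ (pow_ne_zero _ hz0)]

/-- The differential has a simple pole with residue `1` at infinity. -/
theorem exists_norm_mul_omegaCoeff_add_one_le (E : Fin (2 * g + 2) → ℝ) (lam : Fin g → ℝ) {ε : ℝ}
    (hε : 0 < ε) : ∃ r : ℝ, 0 < r ∧ ∀ z : ℂ, 0 < z.im → r ≤ ‖z‖ →
      ‖z * omegaCoeff E lam z + 1‖ ≤ ε := by
  let Φ : ℂ → ℂ := fun w => -((∏ j, (1 - (lam j : ℂ) * w)) / ∏ i, (1 - (E i : ℂ) * w) ^ (1 / 2 : ℂ))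
  have hΦ : Tendsto Φ (𝓝 0) (𝓝 (-1)) := by
    have h1 : Tendsto (fun w : ℂ => ∏ j, (1 - (lam j : ℂ) * w)) (𝓝 0) (𝓝 1) := by
      rw [← Finset.prod_const_one (s := (Finset.univ : Finset (Fin g)))]
      refine tendsto_finsetProd _ fun j _ => ?_
      have h : Continuous fun w : ℂ => 1 - (lam j : ℂ) * w := by fun_prop
      simpa using h.tendsto 0
    have h2 : Tendsto (fun w : ℂ => ∏ i, (1 - (E i : ℂ) * w) ^ (1 / 2 : ℂ)) (𝓝 0) (𝓝 1) := by
      rw [← Finset.prod_const_one (s := (Finset.univ : Finset (Fin (2 * g + 2))))]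
      refine tendsto_finsetProd _ fun i _ => ?_
      have h : ContinuousAt (fun w : ℂ => (1 - (E i : ℂ) * w) ^ (1 / 2 : ℂ)) 0 :=
        ContinuousAt.cpow (by fun_prop) (by fun_prop) (by simp)
      simpa using h.tendsto
    have h3 := (h1.div h2 one_ne_zero).neg
    rw [div_one] at h3
    exact h3
  obtain ⟨δ, hδ, hb⟩ := Metric.tendsto_nhds_nhds.1 hΦ ε hε
  refine ⟨δ⁻¹ + 1 + ∑ i, |E i|, by positivity, fun z hz hr => ?_⟩
  have hsum : ∀ i, |E i| ≤ ∑ i, |E i| := fun i =>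
    Finset.single_le_sum (f := fun i => |E i|) (fun _ _ => abs_nonneg _) (Finset.mem_univ i)
  have hδ' := inv_pos.2 hδ
  rw [mul_omegaCoeff_eq hz fun i => by linarith [hsum i]]
  have h1 : ‖z⁻¹‖ < δ := by
    rw [norm_inv]
    refine inv_lt_of_inv_lt₀ hδ ?_
    linarith [hsum 0, abs_nonneg (E 0)]
  have := hb (x := z⁻¹) (by simpa using h1)
  rw [dist_eq_norm, sub_neg_eq_add] at this
  exact this.le

namespace IsUpperPrimitive
variable {F : ℂ → ℂ} (h : IsUpperPrimitive E lam F)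
include h

/-- The increment of the integral of the differential along a large half circle is close to
`-π i`, as the differential is close to `-dz / z`. -/
theorem norm_half_circle_le {ε r : ℝ} (hr : 0 < r) (hb : ∀ z : ℂ, 0 < z.im → r ≤ ‖z‖ →
      ‖z * omegaCoeff E lam z + 1‖ ≤ ε) :
    ‖(F (-r : ℝ) + Real.pi * Complex.I) - F r‖ ≤ ε * Real.pi := by
  let c : ℝ → ℂ := fun θ => r * Complex.exp (θ * Complex.I)
  let ψ : ℝ → ℂ := fun θ => F (c θ) + θ * Complex.I
  have hcim : ∀ θ, (c θ).im = r * Real.sin θ := fun θ => by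
    simp only [c, Complex.im_ofReal_mul, Complex.exp_ofReal_mul_I_im]
  have hcc : Continuous c := by fun_prop
  have hcn : ∀ θ, ‖c θ‖ = r := fun θ => by
    simp only [c, norm_mul, Complex.norm_exp_ofReal_mul_I, Complex.norm_real,
      Real.norm_of_nonneg hr.le, mul_one]
  have hψc : ContinuousOn ψ (Set.Icc 0 Real.pi) := by
    refine (h.continuousOn.comp hcc.continuousOn fun θ hθ => ?_).add (by fun_prop)
    simp only [Set.mem_ofPred_eq, hcim]
    exact mul_nonneg hr.le (Real.sin_nonneg_of_mem_Icc hθ)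
  have hderiv : ∀ θ ∈ Set.Ioo 0 Real.pi,
      HasDerivAt ψ (Complex.I * (c θ * omegaCoeff E lam (c θ) + 1)) θ := by
    intro θ hθ
    have h1 : HasDerivAt (fun θ : ℝ => (θ : ℂ) * Complex.I) Complex.I θ := by
      simpa using (Complex.ofRealCLM.hasDerivAt (x := θ)).mul_const Complex.I
    have h2 : HasDerivAt c (c θ * Complex.I) θ := by
      have := (h1.cexp).const_mul (r : ℂ)
      simpa [c, mul_assoc] using this
    have h3 := (h.hasDerivAt (c θ) (by
      rw [hcim]; exact mul_pos hr (Real.sin_pos_of_mem_Ioo hθ))).comp θ h2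
    have h4 := h3.add h1
    rw [show Complex.I * (c θ * omegaCoeff E lam (c θ) + 1) =
      omegaCoeff E lam (c θ) * (c θ * Complex.I) + Complex.I by ring]
    exact h4
  have hle : ∀ δ ∈ Set.Ioo 0 (Real.pi / 2), ‖ψ (Real.pi - δ) - ψ δ‖ ≤ ε * Real.pi := by
    intro δ hδ
    have hε : 0 ≤ ε := (norm_nonneg _).trans (hb (c (Real.pi / 2)) (by rw [hcim]; simpa using hr)
      (hcn _).ge)
    have hsub : Set.Icc δ (Real.pi - δ) ⊆ Set.Ioo 0 Real.pi := fun t ht =>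
      ⟨hδ.1.trans_le ht.1, ht.2.trans_lt (by linarith [hδ.1])⟩
    have := Convex.norm_image_sub_le_of_norm_hasDerivWithin_le (C := ε)
      (fun t ht => (hderiv t (hsub ht)).hasDerivWithinAt) (fun t ht => ?_)
      (convex_Icc δ (Real.pi - δ)) (x := δ) (y := Real.pi - δ)
      ⟨le_rfl, by linarith [hδ.2]⟩ ⟨by linarith [hδ.2], le_rfl⟩
    · refine this.trans (mul_le_mul_of_nonneg_left ?_ hε)
      rw [Real.norm_of_nonneg (by linarith [hδ.2])]
      linarith [hδ.1]
    · rw [norm_mul, Complex.norm_I, one_mul]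
      refine hb _ ?_ (hcn t).ge
      rw [hcim]
      exact mul_pos hr (Real.sin_pos_of_mem_Ioo (hsub ht))
  have hev : ∀ᶠ δ : ℝ in 𝓝[>] 0, δ ∈ Set.Ioo 0 (Real.pi / 2) :=
    Ioo_mem_nhdsGT (by positivity)
  have hid : Tendsto (fun δ : ℝ => δ) (𝓝[>] 0) (𝓝 0) := nhdsWithin_le_nhds
  have ht0 : Tendsto (fun δ => ψ δ) (𝓝[>] 0) (𝓝 (ψ 0)) := by
    refine (hψc 0 ⟨le_rfl, Real.pi_pos.le⟩).tendsto.comp (tendsto_nhdsWithin_iff.2 ⟨hid, ?_⟩)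
    filter_upwards [hev] with δ hδ using ⟨hδ.1.le, by linarith [hδ.2, Real.pi_pos]⟩
  have ht1 : Tendsto (fun δ => ψ (Real.pi - δ)) (𝓝[>] 0) (𝓝 (ψ Real.pi)) := by
    refine (hψc Real.pi ⟨Real.pi_pos.le, le_rfl⟩).tendsto.comp
      (tendsto_nhdsWithin_iff.2 ⟨?_, ?_⟩)
    · simpa using hid.const_sub Real.pi
    · filter_upwards [hev] with δ hδ using ⟨by linarith [hδ.2, Real.pi_pos], by linarith [hδ.1]⟩
  have := le_of_tendsto (ht1.sub ht0).norm (hev.mono hle)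
  have e0 : ψ 0 = F r := by simp [ψ, c]
  have e1 : ψ Real.pi = F (-r : ℝ) + Real.pi * Complex.I := by simp [ψ, c, Complex.exp_pi_mul_I]
  rwa [e0, e1] at this

/-- The height of the image strip is `π`. -/
theorem im_last (hE : StrictMono E) (hl : ∀ j, lam j ∈ Set.Ioo (gapLeft E j) (gapRight E j)) :
    (F (E (Fin.last _))).im = Real.pi := by
  have key : ∀ ε > 0, |Real.pi - (F (E (Fin.last _))).im| ≤ ε * Real.pi := by
    intro ε hε
    obtain ⟨r, hr, hb⟩ := exists_norm_mul_omegaCoeff_add_one_le E lam hε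
    set ρ : ℝ := r + |E 0| + |E (Fin.last _)|
    have hρr : r ≤ ρ := by linarith [abs_nonneg (E 0), abs_nonneg (E (Fin.last _))]
    have h1 := h.norm_half_circle_le (hr.trans_le hρr) fun z hz hzr => hb z hz (hρr.trans hzr)
    have h2 := (Complex.abs_im_le_norm _).trans h1
    rw [Complex.sub_im, Complex.add_im, h.im_of_le_first hE hl (x := -ρ)
      (by linarith [neg_abs_le (E 0), abs_nonneg (E (Fin.last _))]), h.im_of_last_le hE hl (x := ρ)
      (by linarith [le_abs_self (E (Fin.last _)), abs_nonneg (E 0)])] at h2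
    simpa using h2
  have h0 : |Real.pi - (F (E (Fin.last _))).im| ≤ 0 := by
    refine le_of_forall_pos_le_add fun ε hε => ?_
    have := key (ε / Real.pi) (div_pos hε Real.pi_pos)
    rwa [div_mul_cancel₀ _ Real.pi_ne_zero, ← zero_add ε] at this
  have := abs_nonpos_iff.1 h0
  linarith

theorem exists_re_le_of_norm_le (R : ℝ) :
    ∃ M : ℝ, ∀ z : ℂ, 0 ≤ z.im → ‖z‖ ≤ R → (F z).re ≤ M := by
  have hc : IsCompact ({z : ℂ | 0 ≤ z.im} ∩ Metric.closedBall 0 R) :=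
    (isCompact_closedBall 0 R).inter_left (isClosed_le continuous_const Complex.continuous_im)
  obtain ⟨M, hM⟩ := hc.bddAbove_image (f := fun z => (F z).re)
    (Complex.continuous_re.comp_continuousOn (h.continuousOn.mono Set.inter_subset_left))
  exact ⟨M, fun z hz hzR => hM ⟨z, ⟨hz, by simpa using hzR⟩, rfl⟩⟩

/-- The real part tends to `-∞` logarithmically at infinity. -/
theorem exists_re_le_log : ∃ R M : ℝ, 0 < R ∧ ∀ z : ℂ, 0 < z.im → R ≤ ‖z‖ →
    (F z).re ≤ M - Real.log ‖z‖ / 2 := by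
  obtain ⟨r, hr, hb⟩ := exists_norm_mul_omegaCoeff_add_one_le E lam (one_half_pos (α := ℝ))
  obtain ⟨M, hM⟩ := h.exists_re_le_of_norm_le r
  refine ⟨r, M + Real.log r / 2, hr, fun z hz hrz => ?_⟩
  have hz0 : 0 < ‖z‖ := hr.trans_le hrz
  set u : ℂ := z / ‖z‖ with hu
  have huim : 0 < u.im := by rw [hu, Complex.div_ofReal_im]; positivity
  have hun : ‖u‖ = 1 := by rw [hu, norm_div, Complex.norm_real, norm_norm, div_self hz0.ne']
  have hpim : ∀ ρ : ℝ, 0 < ρ → 0 < ((ρ : ℂ) * u).im := fun ρ hρ => by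
    rw [Complex.im_ofReal_mul]; exact mul_pos hρ huim
  let χ : ℝ → ℝ := fun ρ => (F (ρ * u)).re + Real.log ρ / 2
  have hderiv : ∀ ρ : ℝ, 0 < ρ →
      HasDerivAt χ ((u * omegaCoeff E lam (ρ * u)).re + ρ⁻¹ / 2) ρ := by
    intro ρ hρ
    have h1 : HasDerivAt (fun ρ : ℝ => (ρ : ℂ) * u) u ρ := by
      simpa using (Complex.ofRealCLM.hasDerivAt (x := ρ)).mul_const u
    have h2 := (h.hasDerivAt _ (hpim ρ hρ)).comp ρ h1
    have h3 := Complex.reCLM.hasFDerivAt.comp_hasDerivAt ρ h2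
    have h4 := h3.add ((Real.hasDerivAt_log hρ.ne').div_const 2)
    rw [mul_comm u]
    exact h4
  have hanti : AntitoneOn χ (Set.Ici r) := by
    refine antitoneOn_of_deriv_nonpos (convex_Ici r) (fun ρ hρ =>
      (hderiv ρ (hr.trans_le hρ)).continuousAt.continuousWithinAt) (fun ρ hρ =>
      (hderiv ρ (hr.trans_le (interior_subset hρ))).differentiableAt.differentiableWithinAt)
      fun ρ hρ => ?_
    have hρ' : r ≤ ρ := interior_subset hρ
    have hρ0 : 0 < ρ := hr.trans_le hρ'
    rw [(hderiv ρ hρ0).deriv]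
    have h1 := hb (ρ * u) (hpim ρ hρ0) (by
      rw [norm_mul, hun, mul_one, Complex.norm_real, Real.norm_of_nonneg hρ0.le]; exact hρ')
    have h2 := (Complex.re_le_norm _).trans h1
    rw [Complex.add_re, mul_assoc, Complex.re_ofReal_mul, Complex.one_re] at h2
    have h3 : (u * omegaCoeff E lam (ρ * u)).re + ρ⁻¹ / 2 =
        (ρ * (u * omegaCoeff E lam (ρ * u)).re + 1 / 2) / ρ := by field_simp
    rw [h3]
    exact div_nonpos_of_nonpos_of_nonneg (by linarith) hρ0.le
  have h1 := hanti (Set.mem_Ici.2 le_rfl) (Set.mem_Ici.2 hrz) hrz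
  have h2 : ((‖z‖ : ℝ) : ℂ) * u = z := by
    rw [hu, mul_div_cancel₀ _ (by exact_mod_cast hz0.ne')]
  have h3 := hM (r * u) (hpim r hr).le (by
    rw [norm_mul, hun, mul_one, Complex.norm_real, Real.norm_of_nonneg hr.le])
  simp only [χ, h2] at h1
  linarith

theorem exists_re_le : ∃ M : ℝ, ∀ z : ℂ, 0 < z.im → (F z).re ≤ M := by
  obtain ⟨R, M, hR, hM⟩ := h.exists_re_le_log
  obtain ⟨M', hM'⟩ := h.exists_re_le_of_norm_le R
  refine ⟨max M' (M - Real.log R / 2), fun z hz => ?_⟩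
  rcases le_total ‖z‖ R with h1 | h1
  · exact (hM' z hz.le h1).trans (le_max_left _ _)
  · refine ((hM z hz h1).trans ?_).trans (le_max_right _ _)
    linarith [Real.log_le_log hR h1]

/-- The map is proper towards infinity: on sets where the real part is bounded below it has bounded
preimages. -/
theorem exists_norm_le_of_le_re (m : ℝ) :
    ∃ B : ℝ, ∀ z : ℂ, 0 < z.im → m ≤ (F z).re → ‖z‖ ≤ B := by
  obtain ⟨R, M, hR, hM⟩ := h.exists_re_le_log
  refine ⟨max R (Real.exp (2 * (M - m))), fun z hz hm => ?_⟩
  rcases le_total ‖z‖ R with h1 | h1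
  · exact h1.trans (le_max_left _ _)
  · refine le_trans ?_ (le_max_right _ _)
    rw [← Real.log_le_iff_le_exp (hR.trans_le h1)]
    linarith [hM z hz h1]

end IsUpperPrimitive

end

/-! ### The image of the upper half plane -/

section
open Filter Topology MeasureTheory
variable {g : ℕ} {E : Fin (2 * g + 2) → ℝ} {lam : Fin g → ℝ}

theorem mem_segment_iff_of_im_eq {p q w : ℂ} (him : p.im = q.im) (hre : p.re < q.re) :
    w ∈ segment ℝ p q ↔ w.im = q.im ∧ p.re ≤ w.re ∧ w.re ≤ q.re := by
  constructor
  · rintro ⟨s, t, hs, ht, hst, rfl⟩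
    obtain rfl : s = 1 - t := by linarith
    simp only [Complex.add_im, Complex.add_re, Complex.real_smul, Complex.re_ofReal_mul,
      Complex.im_ofReal_mul, him]
    exact ⟨by ring, by nlinarith, by nlinarith⟩
  · rintro ⟨h1, h2, h3⟩
    have hd : 0 < q.re - p.re := sub_pos.2 hre
    refine ⟨(q.re - w.re) / (q.re - p.re), (w.re - p.re) / (q.re - p.re),
      div_nonneg (by linarith) hd.le, div_nonneg (by linarith) hd.le, by field_simp; ring, ?_⟩
    apply Complex.ext
    · simp only [Complex.add_re, Complex.real_smul, Complex.re_ofReal_mul]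
      field_simp; ring
    · simp only [Complex.add_im, Complex.real_smul, Complex.im_ofReal_mul, him, h1]
      field_simp; ring

/-- A half strip with finitely many horizontal slits attached to its right end is connected: its
points can be moved left, past all slits, along horizontal half lines. -/
theorem isPreconnected_slit_half_strip {ι : Type*} [Finite ι] (c l : ι → ℝ) :
    IsPreconnected ({w : ℂ | w.re < 0 ∧ 0 < w.im ∧ w.im < Real.pi} \
      ⋃ j, {w : ℂ | w.im = c j ∧ l j ≤ w.re ∧ w.re ≤ 0}) := by
  obtain ⟨m, hm⟩ : ∃ m : ℝ, ∀ j, m ≤ l j := by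
    obtain ⟨m, hm⟩ := (Set.finite_range l).bddBelow
    exact ⟨m, fun j => hm ⟨j, rfl⟩⟩
  set n := min m 0 with hn
  have hnm : n ≤ m := min_le_left _ _
  have hn0 : n ≤ 0 := min_le_right _ _
  let L : Set ℂ := {w : ℂ | w.re < n} ∩ ({w : ℂ | 0 < w.im} ∩ {w : ℂ | w.im < Real.pi})
  have hL : IsPreconnected L := ((convex_halfSpace_re_lt n).inter
    ((convex_halfSpace_im_gt 0).inter (convex_halfSpace_im_lt Real.pi))).isPreconnected
  refine isPreconnected_of_forall (⟨n - 1, Real.pi / 2⟩ : ℂ) fun w hw => ?_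
  obtain ⟨⟨h1, h2, h3⟩, h4⟩ := hw
  simp only [Set.mem_iUnion, Set.mem_ofPred_eq, not_exists, not_and, not_le] at h4
  let A : Set ℂ := {v : ℂ | v.im ≤ w.im} ∩ {v : ℂ | w.im ≤ v.im} ∩ {v : ℂ | v.re ≤ w.re}
  have hA : IsPreconnected A := (((convex_halfSpace_im_le w.im).inter
    (convex_halfSpace_im_ge w.im)).inter (convex_halfSpace_re_le w.re)).isPreconnected
  have hmeet : (⟨min w.re (n - 1), w.im⟩ : ℂ) ∈ L ∩ A :=
    ⟨⟨show min w.re (n - 1) < n from (min_le_right _ _).trans_lt (sub_one_lt n), h2, h3⟩,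
      ⟨show w.im ≤ w.im from le_rfl, show w.im ≤ w.im from le_rfl⟩,
      show min w.re (n - 1) ≤ w.re from min_le_left _ _⟩
  refine ⟨L ∪ A, ?_, Or.inl ⟨?_, ?_, ?_⟩,
    Or.inr ⟨⟨show w.im ≤ w.im from le_rfl, show w.im ≤ w.im from le_rfl⟩,
      show w.re ≤ w.re from le_rfl⟩,
    hL.union _ hmeet.1 hmeet.2 hA⟩
  · rintro v (⟨hv1, hv2, hv3⟩ | ⟨⟨hv1, hv2⟩, hv3⟩)
    · refine ⟨⟨hv1.trans_le hn0, hv2, hv3⟩, ?_⟩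
      simp only [Set.mem_iUnion, Set.mem_ofPred_eq, not_exists, not_and, not_le] at *
      intro j _ hlj
      linarith [hm j]
    · have him : v.im = w.im := le_antisymm hv1 hv2
      simp only [Set.mem_ofPred_eq] at hv3
      refine ⟨⟨hv3.trans_lt h1, him ▸ h2, him ▸ h3⟩, ?_⟩
      simp only [Set.mem_iUnion, Set.mem_ofPred_eq, not_exists, not_and, not_le]
      intro j hj hlj
      linarith [h4 j (him ▸ hj) (hlj.trans hv3)]
  · simp only [Set.mem_ofPred_eq]; linarith
  · simp only [Set.mem_ofPred_eq]; positivity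
  · simp only [Set.mem_ofPred_eq]; linarith [Real.pi_pos]

theorem isPreconnected_compl_half_strip :
    IsPreconnected {w : ℂ | 0 < w.re ∨ w.im < 0 ∨ Real.pi < w.im} := by
  have h1 : IsPreconnected {w : ℂ | 0 < w.re} := (convex_halfSpace_re_gt 0).isPreconnected
  have h2 : IsPreconnected {w : ℂ | w.im < 0} := (convex_halfSpace_im_lt 0).isPreconnected
  have h3 : IsPreconnected {w : ℂ | Real.pi < w.im} :=
    (convex_halfSpace_im_gt Real.pi).isPreconnected
  have h12 := h1.union (⟨1, -1⟩ : ℂ) (by simp) (by simp) h2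
  have h123 := h12.union (⟨1, Real.pi + 1⟩ : ℂ) (Or.inl (by simp)) (by simp) h3
  convert h123 using 1
  ext w
  simp [or_assoc]

namespace IsUpperPrimitive
variable {F : ℂ → ℂ} (h : IsUpperPrimitive E lam F) (hE : StrictMono E)
  (hl : ∀ j, lam j ∈ Set.Ioo (gapLeft E j) (gapRight E j))
include h hE hl

/-- A function whose derivative has positive imaginary part on a convex set is injective. -/
theorem injOn : Set.InjOn F {z : ℂ | 0 < z.im} := by
  intro z hz w hw heq
  by_contra hne
  have hd : w - z ≠ 0 := sub_ne_zero.2 (Ne.symm hne)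
  let χ : ℝ → ℝ := fun t => (F (z + t * (w - z)) / (w - z)).im
  have hpos : ∀ t ∈ Set.Icc (0 : ℝ) 1, 0 < (z + t * (w - z)).im := by
    intro t ht
    have hz' : 0 < z.im := hz
    have hw' : 0 < w.im := hw
    rw [Complex.add_im, Complex.im_ofReal_mul, Complex.sub_im]
    rcases ht.1.eq_or_lt with rfl | h0
    · simpa using hz'
    · nlinarith [ht.2, mul_pos h0 hw']
  have hderiv : ∀ t ∈ Set.Icc (0 : ℝ) 1,
      HasDerivAt χ (omegaCoeff E lam (z + t * (w - z))).im t := by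
    intro t ht
    have h1 : HasDerivAt (fun t : ℝ => z + (t : ℂ) * (w - z)) (w - z) t := by
      simpa using ((Complex.ofRealCLM.hasDerivAt (x := t)).mul_const (w - z)).const_add z
    have h2 := ((h.hasDerivAt _ (hpos t ht)).comp t h1).div_const (w - z)
    have h3 := Complex.imCLM.hasFDerivAt.comp_hasDerivAt t h2
    rw [mul_div_cancel_right₀ _ hd] at h3
    exact h3
  have hmono : StrictMonoOn χ (Set.Icc 0 1) := by
    refine strictMonoOn_of_deriv_pos (convex_Icc 0 1)
      (fun t ht => (hderiv t ht).continuousAt.continuousWithinAt) fun t ht => ?_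
    have ht' := interior_subset ht
    rw [(hderiv t ht').deriv]
    exact omegaCoeff_im_pos hE (fun j => Set.Ioo_subset_Icc_self (hl j)) (hpos t ht')
  have h01 := hmono (Set.left_mem_Icc.2 zero_le_one) (Set.right_mem_Icc.2 zero_le_one) zero_lt_one
  simp [χ, heq] at h01

theorem map_nhds_eq {z : ℂ} (hz : 0 < z.im) : map F (𝓝 z) = 𝓝 (F z) := by
  have hd : DifferentiableOn ℂ F {z : ℂ | 0 < z.im} := fun w hw =>
    (h.hasDerivAt w hw).differentiableAt.differentiableWithinAt
  have han : AnalyticAt ℂ F z := hd.analyticAt (isOpen_upper.mem_nhds hz)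
  refine han.hasStrictDerivAt.map_nhds_eq ?_
  rw [(h.hasDerivAt z hz).deriv]
  intro h0
  have := omegaCoeff_im_pos (lam := lam) hE (fun j => Set.Ioo_subset_Icc_self (hl j)) hz
  rw [h0] at this
  exact lt_irrefl _ this

theorem isOpen_image : IsOpen (F '' {z : ℂ | 0 < z.im}) := by
  rw [isOpen_iff_mem_nhds]
  rintro _ ⟨z, hz, rfl⟩
  rw [← h.map_nhds_eq hE hl hz]
  exact image_mem_map (isOpen_upper.mem_nhds hz)

omit hE hl in
/-- The image has no boundary points other than the values on the real line, as the preimage of a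
bounded set is bounded. -/
theorem closure_image_subset :
    closure (F '' {z : ℂ | 0 < z.im}) ⊆ F '' {z : ℂ | 0 < z.im} ∪ Set.range fun x : ℝ => F x := by
  intro w hw
  obtain ⟨v, hv, hvw⟩ := mem_closure_iff_seq_limit.1 hw
  choose z hz hzv using hv
  have hre : Tendsto (fun n => (F (z n)).re) atTop (𝓝 w.re) := by
    simp only [hzv]; exact (Complex.continuous_re.tendsto w).comp hvw
  obtain ⟨B, hB⟩ := h.exists_norm_le_of_le_re (w.re - 1)
  have hev : ∀ᶠ n in atTop, z n ∈ Metric.closedBall (0 : ℂ) B := by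
    filter_upwards [hre.eventually (lt_mem_nhds (sub_one_lt w.re))] with n hn
    simpa using hB (z n) (hz n) hn.le
  obtain ⟨z₀, -, φ, hφ, hlim⟩ := tendsto_subseq_of_frequently_bounded Metric.isBounded_closedBall
    hev.frequently
  have hz₀ : 0 ≤ z₀.im := ge_of_tendsto' ((Complex.continuous_im.tendsto z₀).comp hlim)
    fun n => (hz (φ n)).le
  have hF : Tendsto (fun n => F (z (φ n))) atTop (𝓝 (F z₀)) :=
    (h.continuousOn z₀ hz₀).tendsto.comp (tendsto_nhdsWithin_iff.2
      ⟨hlim, Eventually.of_forall fun n => show 0 ≤ (z (φ n)).im from le_of_lt (hz (φ n))⟩)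
  have hF2 : Tendsto (fun n => F (z (φ n))) atTop (𝓝 w) := by
    simp only [hzv]; exact hvw.comp hφ.tendsto_atTop
  have hw' := tendsto_nhds_unique hF2 hF
  rcases hz₀.eq_or_lt with h0 | h0
  · refine Or.inr ⟨z₀.re, ?_⟩
    rw [hw']
    exact congrArg F (Complex.ext rfl (by simpa using h0))
  · exact Or.inl ⟨z₀, h0, hw'.symm⟩

/-- No boundary value is attained inside: by openness its neighborhood would be covered twice. -/
theorem disjoint_image_range : Disjoint (F '' {z : ℂ | 0 < z.im}) (Set.range fun x : ℝ => F x) := by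
  rw [Set.disjoint_left]
  rintro _ ⟨z₀, hz₀, rfl⟩ ⟨x, hx⟩
  have hz₀' : 0 < z₀.im := hz₀
  have hnb : F '' {z : ℂ | z₀.im / 2 < z.im} ∈ 𝓝 (F x) := by
    simp only at hx
    rw [hx, ← h.map_nhds_eq hE hl hz₀]
    exact image_mem_map ((isOpen_lt continuous_const Complex.continuous_im).mem_nhds
      (show z₀.im / 2 < z₀.im by linarith))
  have hlim := (h.continuousOn x (by simp)).tendsto.comp (tendsto_add_mul_I x)
  have hsmall : ∀ᶠ ε : ℝ in 𝓝[>] 0, ε ∈ Set.Ioo 0 (z₀.im / 2) := Ioo_mem_nhdsGT (by positivity)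
  obtain ⟨ε, ⟨b, hb, hbF⟩, hε⟩ := ((hlim.eventually hnb).and hsmall).exists
  have hb' : z₀.im / 2 < b.im := hb
  have him : ((x : ℂ) + ε * Complex.I).im = ε := by simp
  have hbe := h.injOn hE hl (show 0 < b.im by linarith)
    (show 0 < ((x : ℂ) + ε * Complex.I).im by rw [him]; exact hε.1) hbF
  rw [hbe, him] at hb'
  exact lt_asymm hb' hε.2

variable (hn : IsNormalized E lam)
include hn

theorem mem_slit_iff (j : Fin g) {w : ℂ} : w ∈ segment ℝ (F (lam j)) (F (gapRight E j)) ↔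
    w.im = (F (gapRight E j)).im ∧ (F (lam j)).re ≤ w.re ∧ w.re ≤ 0 := by
  have h0 : (F (gapRight E j)).re = 0 := h.re_edge hE hl hn _
  rw [mem_segment_iff_of_im_eq (h.im_of_gap hE hl (hl j).1.le (hl j).2.le)
    (by rw [h0]; exact h.re_neg_of_gap hE hl hn (hl j).1 (hl j).2), h0]

theorem slit_subset_range (j : Fin g) :
    segment ℝ (F (lam j)) (F (gapRight E j)) ⊆ Set.range fun x : ℝ => F x := by
  intro w hw
  rw [h.mem_slit_iff hE hl hn] at hw
  have h0 : (F (gapRight E j)).re = 0 := h.re_edge hE hl hn _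
  have hc : Continuous fun x : ℝ => (F x).re := by
    refine Complex.continuous_re.comp (h.continuousOn.comp_continuous Complex.continuous_ofReal ?_)
    simp
  obtain ⟨x, hx, hxw⟩ := intermediate_value_Icc (hl j).2.le hc.continuousOn
    (show w.re ∈ Set.Icc (F (lam j)).re (F (gapRight E j)).re by rw [h0]; exact hw.2)
  exact ⟨x, Complex.ext hxw ((h.im_of_gap hE hl ((hl j).1.le.trans hx.1) hx.2).trans hw.1.symm)⟩

/-- The boundary values lie on the boundary of the half strip or on the slits. -/
theorem boundary_value (x : ℝ) : (F x).re ≤ 0 ∧ 0 ≤ (F x).im ∧ (F x).im ≤ Real.pi ∧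
    ((F x).re = 0 ∨ (F x).im = 0 ∨ (F x).im = Real.pi ∨
      ∃ j, F x ∈ segment ℝ (F (lam j)) (F (gapRight E j))) := by
  have hlast := h.im_last hE hl
  have hm := h.im_mono hE hl
  refine ⟨h.re_nonpos hE hl hn x, ?_, ?_, ?_⟩
  · rcases le_total x (E 0) with h0 | h0
    · exact (h.im_of_le_first hE hl h0).ge
    · exact (h.im_of_le_first hE hl le_rfl).ge.trans (hm h0)
  · rcases le_total (E (Fin.last _)) x with h0 | h0
    · exact ((h.im_of_last_le hE hl h0).trans hlast).le
    · exact (hm h0).trans hlast.le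
  rcases lt_or_ge x (E 0) with h0 | h0
  · exact Or.inr (Or.inl (h.im_of_le_first hE hl h0.le))
  rcases lt_or_ge (E (Fin.last _)) x with h1 | h1
  · exact Or.inr (Or.inr (Or.inl ((h.im_of_last_le hE hl h1.le).trans hlast)))
  rcases mem_gap_or_mem_band hE h0 h1 with ⟨j, hj0, hj1⟩ | ⟨k, hk0, hk1⟩
  · refine Or.inr (Or.inr (Or.inr ⟨j, (h.mem_slit_iff hE hl hn j).2 ⟨?_, ?_, ?_⟩⟩))
    · exact h.im_of_gap hE hl hj0.le hj1.le
    · exact h.lam_re_le_of_gap hE hl hj0.le hj1.le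
    · exact h.re_nonpos hE hl hn x
  · exact Or.inl (h.re_of_mem_band hE hl hn hk0 hk1)

/-- The image of the open upper half plane misses the exterior of the half strip, which is
connected and contains no boundary values, because the real part is bounded above. -/
theorem disjoint_image_exterior :
    Disjoint {w : ℂ | 0 < w.re ∨ w.im < 0 ∨ Real.pi < w.im} (F '' {z : ℂ | 0 < z.im}) := by
  rw [Set.disjoint_iff_inter_eq_empty]
  by_contra hne
  have hsub := isPreconnected_compl_half_strip.subset_of_closure_inter_subset
    (h.isOpen_image hE hl) (Set.nonempty_iff_ne_empty.2 hne) (by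
      rintro w ⟨hw, hw'⟩
      rcases h.closure_image_subset hw with h1 | ⟨x, rfl⟩
      · exact h1
      · obtain ⟨b1, b2, b3, -⟩ := h.boundary_value hE hl hn x
        rcases hw' with h2 | h2 | h2
        · exact absurd h2 (not_lt.2 b1)
        · exact absurd h2 (not_lt.2 b2)
        · exact absurd h2 (not_lt.2 b3))
  obtain ⟨M, hM⟩ := h.exists_re_le
  obtain ⟨z, hz, hzw⟩ := hsub (show (⟨|M| + 1, 0⟩ : ℂ) ∈ _ from Or.inl (by
    simp only; positivity))
  have h1 := hM z hz
  rw [hzw] at h1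
  simp only at h1
  linarith [le_abs_self M]

/-- The image is contained in the slit half strip, as it is open and avoids its exterior and the
slits. It is open and closed in the slit half strip, which contains no boundary values. -/
theorem image_eq : F '' {z : ℂ | 0 < z.im} =
    {w : ℂ | w.re < 0 ∧ 0 < w.im ∧ w.im < Real.pi} \
      ⋃ j, segment ℝ (F (lam j)) (F (gapRight E j)) := by
  have hext := Set.disjoint_left.1 (h.disjoint_image_exterior hE hl hn)
  have hopen := h.isOpen_image hE hl
  have hsub : F '' {z : ℂ | 0 < z.im} ⊆ {w : ℂ | w.re < 0 ∧ 0 < w.im ∧ w.im < Real.pi} \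
      ⋃ j, segment ℝ (F (lam j)) (F (gapRight E j)) := by
    intro w hw
    obtain ⟨ε, hε, hball⟩ := Metric.isOpen_iff.1 hopen w hw
    have hmove : ∀ d : ℂ, ‖d‖ = 1 → w + (ε / 2 : ℝ) * d ∈ F '' {z : ℂ | 0 < z.im} := by
      intro d hd
      refine hball ?_
      rw [Metric.mem_ball, dist_eq_norm, add_sub_cancel_left, norm_mul, hd, mul_one,
        Complex.norm_real, Real.norm_of_nonneg (by positivity)]
      linarith
    refine ⟨⟨?_, ?_, ?_⟩, ?_⟩
    · by_contra! hge
      refine hext (Or.inl ?_) (hmove 1 (by simp))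
      simp; linarith
    · by_contra! hge
      refine hext (Or.inr (Or.inl ?_)) (hmove (-Complex.I) (by simp))
      simp; linarith
    · by_contra! hge
      refine hext (Or.inr (Or.inr ?_)) (hmove Complex.I (by simp))
      simp; linarith
    · rw [Set.mem_iUnion]
      rintro ⟨j, hj⟩
      exact Set.disjoint_left.1 (h.disjoint_image_range hE hl) hw
        (h.slit_subset_range hE hl hn j hj)
  refine hsub.antisymm ?_
  have hpre : IsPreconnected ({w : ℂ | w.re < 0 ∧ 0 < w.im ∧ w.im < Real.pi} \
      ⋃ j, segment ℝ (F (lam j)) (F (gapRight E j))) := by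
    have := isPreconnected_slit_half_strip (fun j => (F (gapRight E j)).im)
      (fun j => (F (lam j)).re)
    convert this using 4 with j
    ext w
    exact h.mem_slit_iff hE hl hn j
  have hne : F Complex.I ∈ F '' {z : ℂ | 0 < z.im} := ⟨Complex.I, by simp, rfl⟩
  refine hpre.subset_of_closure_inter_subset hopen ⟨_, hsub hne, hne⟩ ?_
  rintro w ⟨hw, ⟨h1, h2, h3⟩, h4⟩
  rcases h.closure_image_subset hw with h5 | ⟨x, rfl⟩
  · exact h5
  · obtain ⟨-, -, -, b | b | b | ⟨j, b⟩⟩ := h.boundary_value hE hl hn x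
    · exact absurd b h1.ne
    · exact absurd b h2.ne'
    · exact absurd b h3.ne
    · exact absurd (Set.mem_iUnion.2 ⟨j, b⟩) h4

end IsUpperPrimitive

end

/-! ### The lower half plane -/

section
open Filter Topology MeasureTheory
open scoped ComplexConjugate
variable {g : ℕ} {E : Fin (2 * g + 2) → ℝ} {lam : Fin g → ℝ}

theorem omegaCoeff_conj {z : ℂ} (hz : z.im ≠ 0) :
    omegaCoeff E lam (conj z) = conj (omegaCoeff E lam z) := by
  have h : ∀ i, (conj z - (E i : ℂ)) ^ (1 / 2 : ℂ) = conj ((z - (E i : ℂ)) ^ (1 / 2 : ℂ)) := by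
    intro i
    have h := Complex.conj_cpow (z - (E i : ℂ)) (1 / 2) (fun h => hz (by
      simpa using (Complex.arg_eq_pi_iff.1 h).2))
    have h2 : conj (1 / 2 : ℂ) = 1 / 2 := by simp [map_ofNat]
    rwa [h2, map_sub, Complex.conj_ofReal] at h
  simp only [omegaCoeff, rootR, map_div₀, map_neg, map_prod, map_sub, Complex.conj_ofReal, h]

theorem quasiMomentum_conj {z : ℂ} (hz : z.im ≠ 0) :
    quasiMomentum E lam (conj z) = conj (quasiMomentum E lam z) := by
  rw [quasiMomentum, quasiMomentum, ← intervalIntegral.intervalIntegral_conj]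
  refine intervalIntegral.integral_congr_Ioo_of_le zero_le_one fun t ht => ?_
  have h1 : ((E 0 : ℂ) + t * (z - E 0)).im ≠ 0 := by
    simp [hz, ht.1.ne']
  simp only [map_mul, ← omegaCoeff_conj h1, map_sub, map_add, Complex.conj_ofReal]

theorem mem_halfPlane_neg_one {z : ℂ} : z ∈ halfPlane (-1) ↔ conj z ∈ halfPlane 1 := by
  simp [halfPlane]

/-- The extension to the closed lower half plane is conjugate to that to the upper one. -/
theorem tendsto_quasiMomentum_neg_one {z y : ℂ}
    (h : Tendsto (quasiMomentum E lam) (𝓝[halfPlane 1] (conj z)) (𝓝 y)) :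
    Tendsto (quasiMomentum E lam) (𝓝[halfPlane (-1)] z) (𝓝 (conj y)) := by
  have h1 : Tendsto (fun w : ℂ => conj w) (𝓝[halfPlane (-1)] z) (𝓝[halfPlane 1] (conj z)) := by
    refine tendsto_nhdsWithin_iff.2 ⟨(Complex.continuous_conj.tendsto z).mono_left
      nhdsWithin_le_nhds, ?_⟩
    filter_upwards [self_mem_nhdsWithin] with w hw using mem_halfPlane_neg_one.1 hw
  refine ((Complex.continuous_conj.tendsto y).comp (h.comp h1)).congr' ?_
  filter_upwards [self_mem_nhdsWithin] with w hw
  have hw' : w.im ≠ 0 := by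
    intro h0; simp [halfPlane, h0] at hw
  simp only [Function.comp_apply, quasiMomentum_conj hw', Complex.conj_conj]

theorem mem_closure_halfPlane_neg_one {z : ℂ} (hz : 0 ≤ (conj z).im) :
    z ∈ closure (halfPlane (-1)) := by
  have : halfPlane (-1) = {z : ℂ | z.im < 0} := by ext w; simp [halfPlane]
  rw [this, Complex.closure_setOfPred_im_lt]
  simpa using hz

namespace IsUpperPrimitive
variable {F : ℂ → ℂ} (h : IsUpperPrimitive E lam F) (hE : StrictMono E)
include h hE

theorem tendsto_neg_one {z : ℂ} (hz : 0 ≤ (conj z).im) :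
    Tendsto (quasiMomentum E lam) (𝓝[halfPlane (-1)] z) (𝓝 (conj (F (conj z)))) := by
  have := h.tendsto hE hz
  rw [← halfPlane_one] at this
  exact tendsto_quasiMomentum_neg_one this

theorem quasiMomentumExt_neg_one {z : ℂ} (hz : 0 ≤ (conj z).im) :
    quasiMomentumExt E lam (-1) z = conj (F (conj z)) :=
  extendFrom_eq (mem_closure_halfPlane_neg_one hz) (h.tendsto_neg_one hE hz)

theorem slitStrip_one : slitStrip E lam 1 =
    {w : ℂ | w.re < 0 ∧ 0 < w.im ∧ w.im < Real.pi} \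
      ⋃ j, segment ℝ (F (lam j)) (F (gapRight E j)) := by
  rw [slitStrip]
  simp only [h.quasiMomentumExt_eq hE (z := ((_ : ℝ) : ℂ)) (by simp)]
  simp

theorem mem_slitStrip_neg_one {w : ℂ} : w ∈ slitStrip E lam (-1) ↔ conj w ∈ slitStrip E lam 1 := by
  have hseg : ∀ (p q : ℂ), w ∈ segment ℝ (conj p) (conj q) ↔ conj w ∈ segment ℝ p q := by
    intro p q
    constructor
    · rintro ⟨s, t, hs, ht, hst, rfl⟩
      exact ⟨s, t, hs, ht, hst, by simp⟩
    · rintro ⟨s, t, hs, ht, hst, hw⟩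
      exact ⟨s, t, hs, ht, hst, by rw [← Complex.conj_conj w, ← hw]; simp⟩
  rw [h.slitStrip_one hE, slitStrip]
  simp only [h.quasiMomentumExt_neg_one hE (z := ((_ : ℝ) : ℂ)) (by simp), Complex.conj_ofReal,
    Set.mem_sdiff, Set.mem_iUnion, hseg]
  simp

end IsUpperPrimitive

end

section
open Filter Topology MeasureTheory
open scoped ComplexConjugate

theorem mainTheorem9 (g : ℕ) (E : Fin (2 * g + 2) → ℝ) (hE : StrictMono E)
    (lam : Fin g → ℝ) (hlam : IsNormalized E lam)
    (μ : Fin g → ℝ) (σ : Fin g → ℤˣ) (a b : ℤ → ℝ) (hab : IsFiniteGap E μ σ a b)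
    (Hq : lp (fun _ : ℤ => ℂ) 2 →L[ℂ] lp (fun _ : ℤ => ℂ) 2) (hHq : IsJacobiOperator a b Hq)
    (s : ℤˣ) :
    (∀ z : ℂ, 0 ≤ ((s : ℤ) : ℝ) * z.im →
      Filter.Tendsto (quasiMomentum E lam) (nhdsWithin z (halfPlane s))
        (nhds (quasiMomentumExt E lam s z))) ∧
    Set.BijOn (quasiMomentum E lam) (halfPlane s) (slitStrip E lam s) ∧
    spectrum ℂ Hq =
      {z : ℂ | 0 ≤ ((s : ℤ) : ℝ) * z.im ∧ (quasiMomentumExt E lam s z).re = 0} ∧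
    quasiMomentumExt E lam s '' spectrum ℂ Hq =
      {w : ℂ | w.re = 0 ∧ 0 ≤ ((s : ℤ) : ℝ) * w.im ∧ ((s : ℤ) : ℝ) * w.im ≤ Real.pi} := by
  obtain ⟨F, hF⟩ := exists_isUpperPrimitive hE lam
  have hl := fun j => hlam.mem_gap hE j
  have hbij : Set.BijOn (quasiMomentum E lam) (halfPlane 1) (slitStrip E lam 1) := by
    rw [hF.slitStrip_one hE, ← hF.image_eq hE hl hlam, IsUpperPrimitive.halfPlane_one]
    exact (hF.injOn hE hl).bijOn_image.congr fun z hz => (hF.quasiMomentum_eq hE hz).symm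
  have hspec : spectrum ℂ Hq = {z : ℂ | 0 ≤ z.im ∧ (F z).re = 0} := by
    rw [spectrum_eq hE hab hHq]
    ext z
    constructor
    · rintro ⟨h0, h1⟩
      refine ⟨h0.ge, ?_⟩
      rw [← hF.re_eq_zero_iff hE hl hlam] at h1
      rwa [show z = (z.re : ℂ) from Complex.ext rfl (by simpa using h0)]
    · rintro ⟨h0, h1⟩
      rcases h0.eq_or_lt with h2 | h2
      · refine ⟨h2.symm, ?_⟩
        rw [← hF.re_eq_zero_iff hE hl hlam]
        rwa [show z = (z.re : ℂ) from Complex.ext rfl (by simpa using h2.symm)] at h1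
      · have hm : F z ∈ F '' {z : ℂ | 0 < z.im} := ⟨z, h2, rfl⟩
        rw [hF.image_eq hE hl hlam] at hm
        exact absurd h1 hm.1.1.ne
  have himage : F '' spectrum ℂ Hq = {w : ℂ | w.re = 0 ∧ 0 ≤ w.im ∧ w.im ≤ Real.pi} := by
    rw [hspec]
    apply Set.Subset.antisymm
    · rintro _ ⟨z, hz, rfl⟩
      have hz0 : z.im = 0 := by
        rw [← hspec, spectrum_eq hE hab hHq] at hz; exact hz.1
      rw [show z = (z.re : ℂ) from Complex.ext rfl (by simpa using hz0)] at hz ⊢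
      obtain ⟨-, h1, h2, -⟩ := hF.boundary_value hE hl hlam z.re
      exact ⟨hz.2, h1, h2⟩
    · rintro w ⟨h0, h1, h2⟩
      have hc : Continuous fun x : ℝ => (F x).im := by
        refine Complex.continuous_im.comp
          (hF.continuousOn.comp_continuous Complex.continuous_ofReal ?_)
        simp
      obtain ⟨x, hx, hxw⟩ := intermediate_value_Icc (first_lt_last hE).le hc.continuousOn
        (show w.im ∈ Set.Icc (F (E 0)).im (F (E (Fin.last _))).im by
          rw [hF.base, hF.im_last hE hl]; exact ⟨by simpa using h1, h2⟩)
      simp only at hxw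
      -- a value attained inside a gap is attained at the end of the gap as well
      obtain ⟨y, hy0, hy1⟩ : ∃ y : ℝ, (F y).re = 0 ∧ (F y).im = (F x).im := by
        rcases mem_gap_or_mem_band hE hx.1 hx.2 with ⟨j, hj0, hj1⟩ | ⟨k, hk0, hk1⟩
        · exact ⟨gapRight E j, hF.re_edge hE hl hlam _, (hF.im_of_gap hE hl hj0.le hj1.le).symm⟩
        · exact ⟨x, hF.re_of_mem_band hE hl hlam hk0 hk1, rfl⟩
      exact ⟨y, ⟨by simp, hy0⟩, Complex.ext (hy0.trans h0.symm) (hy1.trans hxw)⟩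
  rcases Int.units_eq_one_or s with rfl | rfl
  · refine ⟨fun z hz => ?_, hbij, ?_, ?_⟩
    · have hz' : 0 ≤ z.im := by simpa using hz
      rw [hF.quasiMomentumExt_eq hE hz', IsUpperPrimitive.halfPlane_one]
      exact hF.tendsto hE hz'
    · rw [hspec]
      ext z
      simp only [Units.val_one, Int.cast_one, one_mul, Set.mem_ofPred_eq]
      exact and_congr_right fun hz => by rw [hF.quasiMomentumExt_eq hE hz]
    · have : Set.EqOn (quasiMomentumExt E lam 1) F (spectrum ℂ Hq) := fun z hz => by
        rw [hspec] at hz; exact hF.quasiMomentumExt_eq hE hz.1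
      rw [this.image_eq, himage]
      simp
  · have hreal : ∀ z ∈ spectrum ℂ Hq, conj z = z := fun z hz => by
      rw [spectrum_eq hE hab hHq] at hz
      exact Complex.conj_eq_iff_im.2 hz.1
    refine ⟨fun z hz => ?_, ⟨?_, ?_, ?_⟩, ?_, ?_⟩
    · have hz' : 0 ≤ (conj z).im := by simpa using hz
      rw [hF.quasiMomentumExt_neg_one hE hz']
      exact hF.tendsto_neg_one hE hz'
    · intro z hz
      have hz0 : z.im ≠ 0 := by rintro h0; simp [halfPlane, h0] at hz
      rw [hF.mem_slitStrip_neg_one hE, ← quasiMomentum_conj hz0]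
      exact hbij.mapsTo (mem_halfPlane_neg_one.1 hz)
    · intro z hz w hw hzw
      have hz0 : z.im ≠ 0 := by rintro h0; simp [halfPlane, h0] at hz
      have hw0 : w.im ≠ 0 := by rintro h0; simp [halfPlane, h0] at hw
      have := hbij.injOn (mem_halfPlane_neg_one.1 hz) (mem_halfPlane_neg_one.1 hw) (by
        rw [quasiMomentum_conj hz0, quasiMomentum_conj hw0, hzw])
      simpa using congrArg conj this
    · intro w hw
      obtain ⟨z, hz, hzw⟩ := hbij.surjOn ((hF.mem_slitStrip_neg_one hE).1 hw)
      have hz0 : z.im ≠ 0 := by rintro h0; simp [halfPlane, h0] at hz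
      refine ⟨conj z, mem_halfPlane_neg_one.2 (by rwa [Complex.conj_conj]), ?_⟩
      rw [quasiMomentum_conj hz0, hzw, Complex.conj_conj]
    · ext z
      have hiff : 0 ≤ (((-1 : ℤˣ) : ℤ) : ℝ) * z.im ↔ 0 ≤ (conj z).im := by simp
      simp only [Set.mem_ofPred_eq]
      rw [hiff]
      constructor
      · intro hz
        have hr := hreal z hz
        rw [hspec] at hz
        have h0 : 0 ≤ (conj z).im := by rw [hr]; exact hz.1
        refine ⟨h0, ?_⟩
        rw [hF.quasiMomentumExt_neg_one hE h0, Complex.conj_re, hr]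
        exact hz.2
      · rintro ⟨h0, h1⟩
        rw [hF.quasiMomentumExt_neg_one hE h0, Complex.conj_re] at h1
        have hz : conj z ∈ spectrum ℂ Hq := by rw [hspec]; exact ⟨h0, h1⟩
        have := hreal _ hz
        rw [Complex.conj_conj] at this
        rwa [← this] at hz
    · have heq : Set.EqOn (quasiMomentumExt E lam (-1)) (fun z => conj (F z)) (spectrum ℂ Hq) :=
        fun z hz => by
          have hr := hreal z hz
          rw [hspec] at hz
          have := hF.quasiMomentumExt_neg_one hE (z := z) (by rw [hr]; exact hz.1)
          rwa [hr] at this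
      rw [heq.image_eq, ← Set.image_image (fun w => conj w) F, himage]
      ext w
      constructor
      · rintro ⟨v, ⟨h0, h1, h2⟩, rfl⟩
        simp [h0, h1, h2]
      · rintro ⟨h0, h1, h2⟩
        exact ⟨conj w, ⟨by simpa using h0, by simpa using h1, by simpa using h2⟩, by simp⟩

end
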